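/- Drawings are finite plane graphs, considered up to homeomorphism of the plane. A \emph{near-triangulation} is a non-null connected loopless plane graph in which every finite region is a triangle. A \emph{configuration} $K$ is a near-triangulation $G(K)$ with a map $\gamma_K:V(G(K))\to\mathbb Z$ such that (i) for every vertex $v$, $G(K)\setminus v$ has at most two components, and $\gamma_K(v)=d(v)+2$ if it has two; (ii) $\gamma_K(v)=d(v)$ if $v$ is not incident with the infinite region and $\gamma_K(v)>d(v)$ otherwise, and $\gamma_K(v)\ge5$ always; (iii) the ring-size $\sum(\gamma_K(v)-d(v)-1)$, over all $v$ incident with the infinite region such that $G(K)\setminus v$ is connected, is at least $2$. A configuration $K$ \emph{appears in} a configuration $L$ if $G(K)$ is an induced subdrawing of $G(L)$, every finite region of $G(K)$ is a finite region of $G(L)$, and $\gamma_K$ is the restriction of $\gamma_L$. Isomorphisms may preserve or reverse the orientation. A \emph{cartwheel} is a configuration $W$ with a vertex $w$ (the \emph{hub}) and two circuits $C_1,C_2$ of $G(W)$ that are induced subgraphs, such that $\{w\},V(C_1),V(C_2)$ partition $V(G(W))$, $C_2$ bounds the infinite region, and $w$ is adjacent to all vertices of $C_1$ (the \emph{spokes})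 and to no vertex of $C_2$. The vertices of $C_2$ adjacent to two spokes are \emph{hats}; a vertex of $C_2$ whose only adjacent spoke is $u$ is a \emph{fan vertex over $u$}. The \emph{fan over} $u$ consists of the fan vertices over $u$ and all edges incident with them, or, if there are no fan vertices over $u$, of the edge joining the two hats adjacent to $u$. A \emph{pass} $(K,r,s,t)$ consists of a configuration $K$, an integer $r>0$ and adjacent vertices $s,t$ of $G(K)$ such that every vertex is joined to $s$ and to $t$ by paths of length at most $2$; it appears in $W$ if $K$ does. A \emph{rule} $(G,\beta,\delta,r,s,t)$ consists of a near-triangulation $G$ such that $G\setminus v$ is connected for every vertex $v$, maps $\beta\le\delta$ on $V(G)$ with values in the non-negative integers and in the non-negative integers together with $\infty$, respectively, an integer $r>0$, and adjacent vertices $s,t$ such that every vertex is joined to $s$ and to $t$ by paths of length at most $2$ on which the internal vertex $x$, if there is one, has $\delta(x)\le 8$. A pass \emph{obeys} this rule if it is isomorphic to some $(K,r,s,t)$ with $G(K)=G$ and $\beta\le\gamma_K\le\delta$. For a finite set $\mathcal P$ of rules and a cartwheel $W$ with hub $w$, put $$N_{\mathcal P}(W)=10(6-\gamma_W(w))+\sum_{t(P)=w}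 r(P)-\sum_{s(P)=w} r(P),$$ where the sums are over the passes $P=(K(P),r(P),s(P),t(P))$ appearing in $W$ that obey some member of $\mathcal P$. A \emph{part} $(K,a,b)$ consists of a near-triangulation $K$ with a hub and maps $b:V(K)\to\{5,6,\dots\}$ and $a:V(K)\to\{0,1,2,\dots\}\cup\{\infty\}$, with $a=b=$ the degree of the hub at the hub, that fits at least one cartwheel. Here $(K,a,b)$ \emph{fits} a cartwheel $W$ if, up to isomorphism, $K$ is obtained from $G(W)$ by deleting the fan over each spoke $u$ with $a(u)\ne b(u)$, the hub of $K$ being the hub of $W$, and $b(v)\le\gamma_W(v)\le a(v)$ for every vertex $v$ of $K$. A part is \emph{trivial} if $b(v)=5$ and $a(v)=\infty$ for every vertex $v$ except the hub, and \emph{trivial limited} if $b(v)=5$ and $a(v)=12$ for every vertex $v$ except the hub. Let $\mathcal G$ be any set of configurations $K$ with $\gamma_K(v)\le 11$ for all vertices $v$, and let $\mathcal P$ be any finite set of rules $(G,\beta,\delta,r,s,t)$ with $\beta(v)\le12$ and $\delta(v)\in\{5,6,7,8,\infty\}$ for every $v\in V(G)$. (The reducible configurations and the discharging rules of the Robertson--Sanders--Seymour--Thomas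 proof of the Four-Colour Theorem are of this kind.) Call a configuration \emph{good} if it is isomorphic to a member of $\mathcal G$, and call a part \emph{successful} if for every cartwheel $W$ that it fits, either a good configuration appears in $W$ or $N_{\mathcal P}(W)\le0$. \textbf{Theorem.} Let $d\in\{7,8,9,10,11\}$. If the trivial limited part with hub of degree $d$ is successful, then so is the trivial part with hub of degree $d$. -/

import Mathlib

/-- A finite drawing, up to orientation-preserving homeomorphism, given by its rotation system.
Every edge consists of two darts interchanged by `rev`, a dart `d` leaves the vertex `tail d`, and
`next` sends a dart to the following dart in the (say clockwise) order around its tail.  Parallel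
edges are allowed.  `outer` is the set of darts that lie on the infinite region (see `face`). -/
structure Drawing where
  V : Type
  D : Type
  finite_V : Finite V
  finite_D : Finite D
  tail : D → V
  rev : D → D
  next : Equiv.Perm D
  outer : Set D
  rev_rev : ∀ d, rev (rev d) = d
  rev_ne : ∀ d, rev d ≠ d
  tail_eq_iff : ∀ d e, tail d = tail e ↔ next.SameCycle d e

namespace Drawing

variable (G : Drawing)

/-- The end of a dart. -/
def head (d : G.D) : G.V := G.tail (G.rev d)

/-- The reversal of darts as a permutation. -/
def revPerm : Equiv.Perm G.D := Function.Involutive.toPerm G.rev G.rev_rev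

/-- The permutation that walks along the boundaries of regions.  Its cycles are the regions. -/
def face : Equiv.Perm G.D := G.next * G.revPerm

/-- The underlying simple graph, which carries adjacency, paths and components. -/
def graph : SimpleGraph G.V where
  Adj u v := u ≠ v ∧ ∃ d, G.tail d = u ∧ G.head d = v
  symm := ⟨by
    rintro u v ⟨h, d, h1, h2⟩
    exact ⟨h.symm, G.rev d, h2, by rw [head, G.rev_rev]; exact h1⟩⟩
  loopless := ⟨fun _ h => h.1 rfl⟩

/-- The degree of a vertex (edges counted with multiplicity; loops are excluded below). -/
noncomputable def degree (v : G.V) : ℕ := {d | G.tail d = v}.ncard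

/-- The number of regions.  A drawing without darts has one region. -/
noncomputable def numFaces : ℕ :=
  max 1 (Nat.card (Quotient (Equiv.Perm.SameCycle.setoid G.face)))

/-- The graph obtained by deleting the vertex `v`. -/
def deleteVertex (v : G.V) : SimpleGraph ({v}ᶜ : Set G.V) := G.graph.induce {v}ᶜ

/-- The number of components of the graph obtained by deleting `v`. -/
noncomputable def numComponentsDelete (v : G.V) : ℕ :=
  Nat.card (G.deleteVertex v).ConnectedComponent

/-- `v` is incident with the infinite region. -/
def OnOuter (v : G.V) : Prop :=
  (∃ d ∈ G.outer, G.tail d = v) ∨ ∀ d, G.tail d ≠ v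

/-- A near-triangulation: a non-null connected loopless plane graph (planarity is Euler's formula
`|V| - |E| + |F| = 2`) in which every finite region is a triangle. -/
structure IsNearTriangulation : Prop where
  loopless : ∀ d, G.head d ≠ G.tail d
  connected : G.graph.Connected
  euler : 2 * Nat.card G.V + 2 * G.numFaces = Nat.card G.D + 4
  outer_nonempty : Nonempty G.D → G.outer.Nonempty
  outer_face : ∀ d ∈ G.outer, ∀ e, e ∈ G.outer ↔ G.face.SameCycle d e
  triangle : ∀ d, d ∉ G.outer → G.face (G.face (G.face d)) = d

variable {G}

/-- `S` is the vertex set of a circuit which is an induced subgraph: the subgraph induced by `S`,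
with its parallel edges, is connected and every vertex has degree two in it. -/
def IsInducedCircuit (S : Set G.V) : Prop :=
  (G.graph.induce S).Connected ∧
    ∀ v ∈ S, {d | G.tail d = v ∧ G.head d ∈ S}.ncard = 2

end Drawing

/-- A realization of the drawing `G` as a subdrawing of `H` such that every finite region of `G` is
a finite region of `H`.  The order of the darts around a vertex is the one inherited from `H`. -/
structure SubdrawingEmb (G H : Drawing) where
  v : G.V → H.V
  e : G.D → H.D
  v_injective : Function.Injective v
  e_injective : Function.Injective e
  tail_e : ∀ d, H.tail (e d) = v (G.tail d)
  rev_e : ∀ d, H.rev (e d) = e (G.rev d)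
  next_e : ∀ d, ∃ k, 0 < k ∧ (H.next ^ k) (e d) = e (G.next d) ∧
    ∀ j, 0 < j → j < k → (H.next ^ j) (e d) ∉ Set.range e
  face_e : ∀ d, d ∉ G.outer → e d ∉ H.outer ∧ H.face (e d) = e (G.face d)

/-- The realization is an induced subdrawing. -/
def SubdrawingEmb.IsInduced {G H : Drawing} (f : SubdrawingEmb G H) : Prop :=
  ∀ d, H.tail d ∈ Set.range f.v → H.head d ∈ Set.range f.v → d ∈ Set.range f.e

/-- An isomorphism of drawings, induced by a homeomorphism of the plane that preserves orientation
(first alternative) or reverses it (second alternative; there the region of a dart becomes the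
region of the reversed dart). -/
structure DrawingIso (G H : Drawing) where
  v : G.V ≃ H.V
  e : G.D ≃ H.D
  tail_e : ∀ d, H.tail (e d) = v (G.tail d)
  rev_e : ∀ d, H.rev (e d) = e (G.rev d)
  orientation :
    ((∀ d, e (G.next d) = H.next (e d)) ∧ ∀ d, d ∈ G.outer ↔ e d ∈ H.outer) ∨
    ((∀ d, e (G.next d) = H.next⁻¹ (e d)) ∧ ∀ d, d ∈ G.outer ↔ H.rev (e d) ∈ H.outer)

/-- A configuration: a near-triangulation `G` with a map `γ` on its vertices. -/
structure Configuration where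
  G : Drawing
  γ : G.V → ℕ
  nearTriangulation : G.IsNearTriangulation
  components_le : ∀ v, G.numComponentsDelete v ≤ 2
  gamma_cut : ∀ v, G.numComponentsDelete v = 2 → γ v = G.degree v + 2
  gamma_inner : ∀ v, ¬ G.OnOuter v → γ v = G.degree v
  gamma_outer : ∀ v, G.OnOuter v → G.degree v < γ v
  five_le : ∀ v, 5 ≤ γ v
  /-- The ring-size is at least two. -/
  two_le_ring : 2 ≤ ∑ᶠ v ∈ {v | G.OnOuter v ∧ G.numComponentsDelete v ≤ 1},
    ((γ v : ℤ) - G.degree v - 1)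

namespace Configuration

/-- Isomorphic configurations. -/
def Isomorphic (K L : Configuration) : Prop :=
  ∃ h : DrawingIso K.G L.G, ∀ v, L.γ (h.v v) = K.γ v

/-- An appearance of `K` in `L`: a realization of `K` as an induced subdrawing of `L` such that
every finite region of `K` is a finite region of `L`, and `γ` is the restriction. -/
structure Appearance (K L : Configuration) where
  f : SubdrawingEmb K.G L.G
  induced : f.IsInduced
  gamma : ∀ v, L.γ (f.v v) = K.γ v

/-- `K` appears in `L`. -/
def AppearsIn (K L : Configuration) : Prop := Nonempty (Appearance K L)

/-- Given a list of configurations, `K` is good if it is isomorphic to one in the list. -/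
def IsGood (𝒢 : Set Configuration) (K : Configuration) : Prop := ∃ L ∈ 𝒢, K.Isomorphic L

end Configuration

/-- A cartwheel, with its hub. -/
structure Cartwheel extends Configuration where
  hub : G.V
  circuits : ∃ C₁ C₂ : Set G.V,
    hub ∉ C₁ ∧ hub ∉ C₂ ∧ Disjoint C₁ C₂ ∧ {hub} ∪ C₁ ∪ C₂ = Set.univ ∧
    Drawing.IsInducedCircuit C₁ ∧ Drawing.IsInducedCircuit C₂ ∧
    -- the edges that bound the infinite region are those of the second circuit
    (∀ d, (d ∈ G.outer ∨ G.rev d ∈ G.outer) ↔ (G.tail d ∈ C₂ ∧ G.head d ∈ C₂)) ∧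
    (∀ v ∈ C₁, G.graph.Adj hub v) ∧ (∀ v ∈ C₂, ¬ G.graph.Adj hub v)

namespace Cartwheel

variable (W : Cartwheel)

/-- The spokes are the neighbours of the hub. -/
def IsSpoke (u : W.G.V) : Prop := W.G.graph.Adj W.hub u

/-- The hats are the vertices of the second circuit that are adjacent to two spokes. -/
def IsHat (x : W.G.V) : Prop :=
  x ≠ W.hub ∧ ¬ W.IsSpoke x ∧
    ∃ u u', u ≠ u' ∧ W.IsSpoke u ∧ W.IsSpoke u' ∧ W.G.graph.Adj x u ∧ W.G.graph.Adj x u'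

/-- `x` is a fan over `u`: a vertex of the second circuit whose only adjacent spoke is `u`. -/
def IsFanOver (x u : W.G.V) : Prop :=
  x ≠ W.hub ∧ ¬ W.IsSpoke x ∧ ∀ u', (W.IsSpoke u' ∧ W.G.graph.Adj x u') ↔ u' = u

/-- The edge of the dart `d` belongs to the fan over the spoke `u`: it is incident with a fan vertex
over `u`, or it joins the two hats adjacent to `u` (there are no fan vertices over `u` then). -/
def EdgeOver (d : W.G.D) (u : W.G.V) : Prop :=
  W.IsFanOver (W.G.tail d) u ∨ W.IsFanOver (W.G.head d) u ∨
    (W.IsSpoke u ∧ W.IsHat (W.G.tail d) ∧ W.IsHat (W.G.head d) ∧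
      W.G.graph.Adj (W.G.tail d) u ∧ W.G.graph.Adj (W.G.head d) u)

end Cartwheel

/-- A pass `(K, r, s, t)`. -/
structure Pass where
  K : Configuration
  r : ℕ
  s : K.G.V
  t : K.G.V
  r_pos : 0 < r
  adj : K.G.graph.Adj s t
  near_s : ∀ v, ∃ p : K.G.graph.Walk v s, p.length ≤ 2
  near_t : ∀ v, ∃ p : K.G.graph.Walk v t, p.length ≤ 2

/-- A rule `(G, β, δ, r, s, t)`.  From every vertex there is a path of length at most two to `s`,
and one to `t`, such that `δ ≤ 8` on its internal vertex, if there is one. -/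
structure Rule where
  G : Drawing
  β : G.V → ℕ
  δ : G.V → ℕ∞
  r : ℕ
  s : G.V
  t : G.V
  nearTriangulation : G.IsNearTriangulation
  connected_delete : ∀ v, (G.deleteVertex v).Connected
  le : ∀ v, (β v : ℕ∞) ≤ δ v
  r_pos : 0 < r
  adj : G.graph.Adj s t
  near_s : ∀ v, v = s ∨ G.graph.Adj v s ∨ ∃ w, G.graph.Adj v w ∧ G.graph.Adj w s ∧ δ w ≤ 8
  near_t : ∀ v, v = t ∨ G.graph.Adj v t ∨ ∃ w, G.graph.Adj v w ∧ G.graph.Adj w t ∧ δ w ≤ 8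

/-- The pass `P` obeys the rule `R`: it is isomorphic to some `(K, r, s, t)` with `G(K) = G` and
`β ≤ γ ≤ δ` on all vertices. -/
def Pass.Obeys (P : Pass) (R : Rule) : Prop :=
  P.r = R.r ∧ ∃ h : DrawingIso P.K.G R.G, h.v P.s = R.s ∧ h.v P.t = R.t ∧
    ∀ v, R.β (h.v v) ≤ P.K.γ v ∧ (P.K.γ v : ℕ∞) ≤ R.δ (h.v v)

/-- A pass appearing in `W` is an induced subdrawing of `W`, so it is given by its vertex set
together with its value, source and sink. -/
structure PassIn (W : Configuration) where
  verts : Set W.G.V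
  r : ℕ
  s : W.G.V
  t : W.G.V

/-- The pass `P` appears in `W`, namely as the subdrawing described by `τ`. -/
def Pass.AppearsAs (P : Pass) {W : Configuration} (τ : PassIn W) : Prop :=
  ∃ a : P.K.Appearance W,
    Set.range a.f.v = τ.verts ∧ P.r = τ.r ∧ a.f.v P.s = τ.s ∧ a.f.v P.t = τ.t

/-- The passes that appear in `W` and obey a member of `𝓡`. -/
def passesIn (𝓡 : Set Rule) (W : Configuration) : Set (PassIn W) :=
  {τ | ∃ P : Pass, (∃ R ∈ 𝓡, P.Obeys R) ∧ P.AppearsAs τ}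

/-- The number `N_𝓡(W)`. -/
noncomputable def Cartwheel.N (𝓡 : Set Rule) (W : Cartwheel) : ℤ :=
  10 * (6 - (W.γ W.hub : ℤ))
    + (∑ᶠ τ ∈ {τ | τ ∈ passesIn 𝓡 W.toConfiguration ∧ τ.t = W.hub}, (τ.r : ℤ))
    - (∑ᶠ τ ∈ {τ | τ ∈ passesIn 𝓡 W.toConfiguration ∧ τ.s = W.hub}, (τ.r : ℤ))

/-- A drawing with a distinguished vertex and lower and upper bounds `b`, `a` on its vertices. -/
structure BoundedDrawing where
  K : Drawing
  hub : K.V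
  a : K.V → ℕ∞
  b : K.V → ℕ

/-- `(K, a, b)` fits the cartwheel `W`: `K` is the subdrawing obtained from `W` by deleting the fan
(its interior vertices and its edges) over every spoke `u` with `b u ≠ a u`, and `γ_W` lies between
`b` and `a` on the vertices of `K`. -/
def BoundedDrawing.Fits (P : BoundedDrawing) (W : Cartwheel) : Prop :=
  ∃ f : SubdrawingEmb P.K W.G, f.v P.hub = W.hub ∧
    (∀ x, x ∉ Set.range f.v ↔ ∃ u, (P.b u : ℕ∞) ≠ P.a u ∧ W.IsFanOver x (f.v u)) ∧
    (∀ d, d ∉ Set.range f.e ↔ ∃ u, (P.b u : ℕ∞) ≠ P.a u ∧ W.EdgeOver d (f.v u)) ∧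
    ∀ v, (P.b v : ℕ∞) ≤ W.γ (f.v v) ∧ (W.γ (f.v v) : ℕ∞) ≤ P.a v

/-- A part: a near-triangulation with bounds that is cut out of a cartwheel as described in `Fits`.
The degree of the hub is prescribed. -/
structure CartwheelPart extends BoundedDrawing where
  nearTriangulation : K.IsNearTriangulation
  b_hub : b hub = K.degree hub
  a_hub : a hub = K.degree hub
  five_le : ∀ v, 5 ≤ b v
  exists_fits : ∃ W : Cartwheel, toBoundedDrawing.Fits W

namespace CartwheelPart

/-- The trivial parts. -/
def IsTrivial (P : CartwheelPart) : Prop := ∀ v, v ≠ P.hub → P.b v = 5 ∧ P.a v = ⊤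

/-- The trivial limited parts. -/
def IsTrivialLimited (P : CartwheelPart) : Prop := ∀ v, v ≠ P.hub → P.b v = 5 ∧ P.a v = 12

/-- A part is successful if every cartwheel that it fits has `N_𝓡(W) ≤ 0` unless a good
configuration appears in it. -/
def Successful (𝒢 : Set Configuration) (𝓡 : Set Rule) (P : CartwheelPart) : Prop :=
  ∀ W : Cartwheel, P.Fits W →
    (∃ K : Configuration, K.IsGood 𝒢 ∧ K.AppearsIn W.toConfiguration) ∨ W.N 𝓡 ≤ 0

end CartwheelPart

/-! ### Permutations of finite sets -/

section Perm

variable {α : Type*}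

/-! Values of `γ` above 12 carry no information. A good configuration contains no vertex with value
12 or more, and a rule cannot tell two values that are at least 12 apart: `β` is at most 12, and a
`δ` that admits 12 is infinite. So every cartwheel `W` with hub of degree `d` is changed into one
with all values at most 12, with the same `N` and with no new good configurations; this new
cartwheel is fitted by the trivial limited part.

On the rim the values can simply be cut off at 12 (`Cartwheel.truncate`). At a spoke `u` the value
is the degree, so a large value is lowered by removing fan vertices over `u`. A fan vertex has
degree three: delete its edge to `u` and merge its two edges along the rim (`Suppressible.drawing`).
The neighbouring fan vertex `right` receives the value 12, so that no good configuration uses the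
merged edge or the new triangle (`FanPair.appearsIn`). Iterating, by induction on the number of
vertices, gives `good_or_N_nonpos_of_le_twelve`.

That `N` does not change rests on the condition `δ ≤ 8` in the definition of a rule. In a pass from
or to the hub, every vertex has a path of length at most two to the hub whose internal vertex has
value at most 8. A fan vertex over `u` can only use `u` as internal vertex, so these passes avoid
the fan over any spoke with value above 8 (`Pass.Obeys.fan_notMem`), and they survive the surgery.
Their large values may then be altered (`Pass.Obeys.transfer`), because vertices of the pass with
large value, other than the hub, have degree at most five in it (`Pass.Obeys.degree_le_five`). This
makes the passes at the hub correspond (`Cartwheel.N_eq_of_passes`).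

Finally, in a trivial limited part the bounds differ everywhere but at the hub, so all fans are
deleted. What remains is the hub, the spokes, the hats and the edges between them. This core depends
only on `d`; it is described by explicit darts indexed by `ZMod d`, and a realization in one
cartwheel is carried to any other (`Cartwheel.exists_core_emb`,
`CartwheelPart.IsTrivialLimited.fits`).

Regions and rotations are handled through permutations of darts. The structure of a cartwheel is
extracted from three facts: finite regions are triangles, the two circuits are induced, and vertices
off the rim have degree at least five. -/

theorem Equiv.Perm.SameCycle.induction_forward [Finite α] {σ : Equiv.Perm α} {a b : α}
    (h : σ.SameCycle a b) {p : α → Prop} (ha : p a) (hs : ∀ x, p x → p (σ x)) : p b := by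
  obtain ⟨k, rfl⟩ := h.exists_nat_pow_eq
  clear h
  induction k with
  | zero => exact ha
  | succ k ih => rw [pow_succ', Equiv.Perm.mul_apply]; exact hs _ ih

/-- The number of cycles of a permutation all of whose cycles but one have length three. -/
theorem card_cycles_of_triangles [Finite α] (φ : Equiv.Perm α) (O : Set α) (d₀ : α) (hd₀ : d₀ ∈ O)
    (hO : ∀ d ∈ O, ∀ e, e ∈ O ↔ φ.SameCycle d e)
    (htri : ∀ d, d ∉ O → φ (φ (φ d)) = d) (hne : ∀ d, d ∉ O → φ d ≠ d) :
    3 * Nat.card (Quotient (Equiv.Perm.SameCycle.setoid φ)) = Oᶜ.ncard + 3 := by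
  classical
  have := Fintype.ofFinite α
  let Q := Quotient (Equiv.Perm.SameCycle.setoid φ)
  let mk : α → Q := Quotient.mk _
  have mk_eq : ∀ a b, mk a = mk b ↔ φ.SameCycle a b := fun a b => Quotient.eq
  have : Finite Q := Quotient.finite _
  have := Fintype.ofFinite Q
  let s : Finset α := Finset.univ.filter (· ∉ O)
  have hs : s.card = Oᶜ.ncard := by
    rw [Set.ncard_eq_toFinset_card']; congr 1; ext x; simp [s]
  let t : Finset Q := Finset.univ.erase (mk d₀)
  -- Sort the points outside `O` by their cycles. The cycle of `d₀` is `O` itself, so it is left out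
  -- of `t`.
  have key := Finset.card_eq_sum_card_fiberwise (f := mk) (s := s) (t := t) (by
    intro d hd
    simp only [s, Finset.coe_filter, Finset.mem_univ, true_and, Set.mem_ofPred_eq] at hd
    simp only [t, Finset.coe_erase, Finset.coe_univ, Set.mem_sdiff, Set.mem_univ, true_and,
      Set.mem_singleton_iff]
    intro h
    exact hd ((hO d₀ hd₀ d).2 ((mk_eq _ _).1 h.symm)))
  have fib : ∀ q ∈ t, (s.filter (fun a => mk a = q)).card = 3 := by
    intro q hq
    obtain ⟨d, rfl⟩ := Quotient.exists_rep q
    have hdO : d ∉ O := by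
      intro h
      simp only [t, Finset.mem_erase, Finset.mem_univ, and_true] at hq
      exact hq ((mk_eq _ _).2 ((hO d h d₀).1 hd₀))
    have h3 := htri d hdO
    have h1 := hne d hdO
    have : s.filter (fun a => mk a = mk d) = {d, φ d, φ (φ d)} := by
      ext e
      simp only [Finset.mem_filter, s, Finset.mem_univ, true_and, Finset.mem_insert,
        Finset.mem_singleton]
      constructor
      · rintro ⟨-, he⟩
        refine ((mk_eq _ _).1 he).symm.induction_forward
          (p := fun e => e = d ∨ e = φ d ∨ e = φ (φ d)) (Or.inl rfl) ?_
        rintro x (rfl | rfl | rfl) <;> simp [h3]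
      · have sc : ∀ e, φ.SameCycle d e → e ∉ O ∧ mk e = mk d := fun e he =>
          ⟨fun h => hdO ((hO e h d).2 he.symm), (mk_eq _ _).2 he.symm⟩
        rintro (rfl | rfl | rfl)
        · exact sc _ (.refl _ _)
        · exact sc _ ⟨1, by simp⟩
        · exact sc _ ⟨2, by simp [zpow_ofNat, pow_two]⟩
    change (s.filter (fun a => mk a = mk d)).card = 3
    rw [this, Finset.card_eq_three]
    refine ⟨_, _, _, h1.symm, ?_, ?_, rfl⟩
    · intro h; apply h1; rw [← h] at h3; exact h3
    · intro h; exact h1 (φ.injective h).symm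
  rw [Finset.sum_congr rfl fib, Finset.sum_const, hs, smul_eq_mul, Finset.card_erase_of_mem
    (Finset.mem_univ _), Finset.card_univ] at key
  have hpos : 0 < Fintype.card Q := Fintype.card_pos_iff.2 ⟨mk d₀⟩
  change 3 * Nat.card Q = _
  rw [Nat.card_eq_fintype_card, key]
  omega

/-- The permutation obtained from `σ` by skipping the point `a`, which becomes a fixed point. -/
def Equiv.Perm.skip [DecidableEq α] (σ : Equiv.Perm α) (a : α) : Equiv.Perm α :=
  Equiv.swap a (σ a) * σ

theorem Equiv.Perm.skip_apply_of_eq [DecidableEq α] (σ : Equiv.Perm α) {a b : α} (h : σ b = a) :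
    σ.skip a b = σ a := by
  simp [skip, h]

theorem Equiv.Perm.skip_apply_of_ne [DecidableEq α] (σ : Equiv.Perm α) {a b : α} (hb : b ≠ a)
    (h : σ b ≠ a) : σ.skip a b = σ b := by
  rw [skip, Equiv.Perm.mul_apply, Equiv.swap_apply_of_ne_of_ne h]
  exact fun h => hb (σ.injective h)

theorem Equiv.Perm.skip_apply_self [DecidableEq α] (σ : Equiv.Perm α) (a : α) :
    σ.skip a a = a := by
  simp [skip]

theorem Equiv.Perm.sameCycle_skip_apply [DecidableEq α] (σ : Equiv.Perm α) (a b : α) :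
    σ.SameCycle b (σ.skip a b) := by
  by_cases h1 : b = a
  · subst h1; rw [skip_apply_self]
  by_cases h2 : σ b = a
  · rw [σ.skip_apply_of_eq h2]
    exact ⟨2, by simp [zpow_ofNat, pow_two, h2]⟩
  · rw [σ.skip_apply_of_ne h1 h2]; exact ⟨1, by simp⟩

theorem Equiv.Perm.sameCycle_skip [Finite α] [DecidableEq α] (σ : Equiv.Perm α) {a d e : α}
    (hd : d ≠ a) (he : e ≠ a) : (σ.skip a).SameCycle d e ↔ σ.SameCycle d e := by
  constructor
  · intro h
    exact h.induction_forward (p := fun x => σ.SameCycle d x) (.refl _ _)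
      fun x hx => hx.trans (σ.sameCycle_skip_apply a x)
  · intro h
    -- When the walk along `σ` hits `a`, the invariant speaks of `σ a` instead, the point to which
    -- `skip` jumps.
    have := h.induction_forward
      (p := fun x => (x ≠ a → (σ.skip a).SameCycle d x) ∧ (x = a → (σ.skip a).SameCycle d (σ a)))
      ⟨fun _ => .refl _ _, fun h => absurd h hd⟩ ?_
    · exact this.1 he
    · rintro x ⟨h1, h2⟩
      by_cases hx : x = a
      · subst hx
        refine ⟨fun _ => h2 rfl, fun h => ?_⟩
        have h2 := h2 rfl
        rwa [h, h] at *
      · have h3 := (h1 hx).trans (⟨1, by simp⟩ : (σ.skip a).SameCycle x (σ.skip a x))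
        refine ⟨fun h => ?_, fun h => ?_⟩
        · rwa [σ.skip_apply_of_ne hx h] at h3
        · rwa [σ.skip_apply_of_eq h] at h3

/-- `e` is the first point of `S` after `d` on the cycle of `σ`, when `e ∈ S`. -/
def FirstReturn (σ : Equiv.Perm α) (S : Set α) (d e : α) : Prop :=
  ∃ k, 0 < k ∧ (σ ^ k) d = e ∧ ∀ j, 0 < j → j < k → (σ ^ j) d ∉ S

theorem FirstReturn.of_apply {σ : Equiv.Perm α} {S : Set α} {d e : α} (h : σ d = e) :
    FirstReturn σ S d e :=
  ⟨1, one_pos, by simpa using h, fun j h1 h2 => by omega⟩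

theorem FirstReturn.of_step {σ : Equiv.Perm α} {S : Set α} {d e : α} (h : σ d ∉ S)
    (h' : FirstReturn σ S (σ d) e) : FirstReturn σ S d e := by
  obtain ⟨k, h1, h2, h3⟩ := h'
  refine ⟨k + 1, by omega, by rw [pow_succ]; exact h2, fun j hj1 hj2 => ?_⟩
  obtain rfl | hj : j = 1 ∨ 1 < j := by omega
  · simpa using h
  · obtain ⟨j, rfl⟩ : ∃ i, j = i + 1 := ⟨j - 1, by omega⟩
    rw [pow_succ]
    exact h3 j (by omega) (by omega)

theorem FirstReturn.cases {σ : Equiv.Perm α} {S : Set α} {d e : α} (h : FirstReturn σ S d e) :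
    σ d = e ∨ (σ d ∉ S ∧ FirstReturn σ S (σ d) e) := by
  obtain ⟨k, h1, h2, h3⟩ := h
  obtain rfl | hk : k = 1 ∨ 1 < k := by omega
  · left; simpa using h2
  · right
    refine ⟨by simpa using h3 1 one_pos hk, k - 1, by omega, ?_, fun j hj1 hj2 => ?_⟩
    · rw [← h2, ← Equiv.Perm.mul_apply, ← pow_succ]; congr 2; omega
    · rw [← Equiv.Perm.mul_apply, ← pow_succ]; exact h3 _ (by omega) (by omega)

theorem FirstReturn.unique {σ : Equiv.Perm α} {S : Set α} {d e e' : α}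
    (h : FirstReturn σ S d e) (h' : FirstReturn σ S d e') (he : e ∈ S) (he' : e' ∈ S) :
    e = e' := by
  obtain ⟨k, h1, h2, h3⟩ := h
  obtain ⟨k', h1', h2', h3'⟩ := h'
  rcases lt_trichotomy k k' with hk | hk | hk
  · exact absurd (h2 ▸ he) (h3' k h1 hk)
  · rw [← h2, ← h2', hk]
  · exact absurd (h2' ▸ he') (h3 k' h1' hk)

/-- An induction principle along the way to the first return. -/
theorem FirstReturn.induction {σ : Equiv.Perm α} {S : Set α} {e : α} {p : α → Prop}
    (h1 : ∀ d, σ d = e → p d) (h2 : ∀ d, σ d ∉ S → p (σ d) → p d) {d : α}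
    (h : FirstReturn σ S d e) : p d := by
  obtain ⟨k, hk, h⟩ := h
  induction k generalizing d with
  | zero => omega
  | succ k ih =>
    rcases Nat.eq_zero_or_pos k with rfl | hk0
    · exact h1 _ (by simpa using h.1)
    · rcases FirstReturn.cases ⟨k + 1, hk, h⟩ with h' | ⟨h', -⟩
      · exact h1 _ h'
      refine h2 _ h' (ih hk0 ⟨?_, fun j hj1 hj2 => ?_⟩)
      · rw [← h.1, pow_succ]; rfl
      · rw [← Equiv.Perm.mul_apply, ← pow_succ]; exact h.2 _ (by omega) (by omega)

theorem FirstReturn.skip [DecidableEq α] {σ : Equiv.Perm α} {S : Set α} {a d e : α} (ha : a ∉ S)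
    (he : e ∈ S) (hd : d ≠ a) (h : FirstReturn σ S d e) : FirstReturn (σ.skip a) S d e := by
  have hea : e ≠ a := fun h => ha (h ▸ he)
  -- If the walk arrives at `a`, which `skip` fixes, the second clause speaks of the predecessor
  -- `d'` of `a`, which `skip` sends directly to `σ a`.
  refine (h.induction (p := fun d => (d ≠ a → FirstReturn (σ.skip a) S d e) ∧
    (d = a → ∀ d', d' ≠ a → σ d' = a → FirstReturn (σ.skip a) S d' e)) ?_ ?_).1 hd
  · intro d h
    refine ⟨fun hd => .of_apply ?_, ?_⟩
    · rw [σ.skip_apply_of_ne hd (h ▸ hea), h]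
    · rintro rfl d' - h'
      exact .of_apply (by rw [σ.skip_apply_of_eq h', h])
  · intro d h p
    refine ⟨fun hd => ?_, ?_⟩
    · by_cases h' : σ d = a
      · exact p.2 h' d hd h'
      · have := σ.skip_apply_of_ne hd h'
        exact .of_step (by rwa [this]) (by rw [this]; exact p.1 h')
    · rintro rfl d' hd' h'
      have := σ.skip_apply_of_eq h'
      exact .of_step (by rwa [this])
        (by rw [this]; exact p.1 fun h => hd' (σ.injective (h'.trans h.symm)))

theorem FirstReturn.of_skip [DecidableEq α] {σ : Equiv.Perm α} {S : Set α} {a d e : α} (ha : a ∉ S)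
    (hd : d ≠ a) (h : FirstReturn (σ.skip a) S d e) : FirstReturn σ S d e := by
  refine h.induction (p := fun d => d ≠ a → FirstReturn σ S d e) ?_ ?_ hd
  · intro d h hd
    by_cases h' : σ d = a
    · rw [σ.skip_apply_of_eq h'] at h
      exact .of_step (by rwa [h']) (.of_apply (by rw [h', h]))
    · rw [σ.skip_apply_of_ne hd h'] at h
      exact .of_apply h
  · intro d h p hd
    by_cases h' : σ d = a
    · rw [σ.skip_apply_of_eq h'] at h p
      have : σ a ≠ a := fun h => hd (σ.injective (h'.trans h.symm))
      exact .of_step (by rwa [h']) (by rw [h']; exact .of_step h (p this))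
    · rw [σ.skip_apply_of_ne hd h'] at h p
      exact .of_step h (p h')

/-- First returns only depend on the permutation along the way. -/
theorem FirstReturn.map {β : Type*} {σ : Equiv.Perm α} {τ : Equiv.Perm β} {ι : α → β} {S : Set α}
    {T : Set β} (hσ : ∀ x, ι (σ x) = τ (ι x)) (hS : ∀ x, ι x ∈ T → x ∈ S) {d e : α}
    (h : FirstReturn σ S d e) : FirstReturn τ T (ι d) (ι e) := by
  refine h.induction (p := fun d => FirstReturn τ T (ι d) (ι e)) ?_ ?_
  · rintro d rfl; exact .of_apply (hσ _).symm
  · intro d h p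
    exact .of_step (by rw [← hσ]; exact fun h' => h (hS _ h')) (by rwa [← hσ])

theorem FirstReturn.of_map {β : Type*} {σ : Equiv.Perm α} {τ : Equiv.Perm β} {ι : α → β} {S : Set α}
    {T : Set β} (hσ : ∀ x, ι (σ x) = τ (ι x)) (hι : Function.Injective ι)
    (hS : ∀ x ∈ S, ι x ∈ T) {d e : α}
    (h : FirstReturn τ T (ι d) (ι e)) : FirstReturn σ S d e := by
  refine h.induction (p := fun b => ∀ d, ι d = b → FirstReturn σ S d e) ?_ ?_ d rfl
  · rintro _ h d rfl; exact .of_apply (hι ((hσ _).trans h))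
  · rintro _ h p d rfl
    exact .of_step (fun h' => h (by rw [← hσ]; exact hS _ h')) (p _ (hσ _))

end Perm

/-! ### Connectivity -/

namespace SimpleGraph

variable {V V' : Type*} {G : SimpleGraph V} {G' : SimpleGraph V'}

/-- An edge may go to any connected pair, in particular to a single vertex, so that the lemma
applies to contractions. -/
theorem Reachable.of_weak_hom (f : V → V') (h : ∀ a b, G.Adj a b → G'.Reachable (f a) (f b))
    {a b : V} (hab : G.Reachable a b) : G'.Reachable (f a) (f b) := by
  obtain ⟨p⟩ := hab
  induction p with
  | nil => rfl
  | cons h' _ ih => exact (h _ _ h').trans ih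

theorem Connected.of_weak_hom (f : V → V') (hf : Function.Surjective f)
    (h : ∀ a b, G.Adj a b → G'.Reachable (f a) (f b)) (hG : G.Connected) : G'.Connected := by
  have : Nonempty V' := hG.nonempty.map f
  refine ⟨fun a b => ?_⟩
  obtain ⟨a, rfl⟩ := hf a
  obtain ⟨b, rfl⟩ := hf b
  exact (hG.preconnected a b).of_weak_hom f h

theorem card_connectedComponent_le_of_weak_hom [Finite V] (f : V → V')
    (hf : Function.Surjective f) (h : ∀ a b, G.Adj a b → G'.Reachable (f a) (f b)) :
    Nat.card G'.ConnectedComponent ≤ Nat.card G.ConnectedComponent := by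
  have : Finite G.ConnectedComponent := Quot.finite _
  refine Nat.card_le_card_of_surjective
    (fun c => c.lift (fun v => G'.connectedComponentMk (f v)) ?_) ?_
  · intro v w p _
    exact ConnectedComponent.sound (p.reachable.of_weak_hom f h)
  · intro c
    induction c using ConnectedComponent.ind with
    | _ v =>
      obtain ⟨v, rfl⟩ := hf v
      exact ⟨G.connectedComponentMk v, rfl⟩

theorem card_connectedComponent_le_one (c : V) (h : ∀ v, G.Reachable v c) :
    Nat.card G.ConnectedComponent ≤ 1 := by
  have : Subsingleton G.ConnectedComponent := ⟨fun a b => by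
    induction a using ConnectedComponent.ind with
    | _ a =>
      induction b using ConnectedComponent.ind with
      | _ b => exact ConnectedComponent.sound ((h a).trans (h b).symm)⟩
  exact Finite.card_le_one_iff_subsingleton.2 this

end SimpleGraph

/-! ### Drawings -/

attribute [instance] Drawing.finite_V Drawing.finite_D

namespace Drawing

variable {G : Drawing}

theorem tail_rev (d : G.D) : G.tail (G.rev d) = G.head d := rfl

theorem head_rev (d : G.D) : G.head (G.rev d) = G.tail d := by rw [head, G.rev_rev]

theorem rev_injective : Function.Injective G.rev := fun a b h => by
  rw [← G.rev_rev a, h, G.rev_rev]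

theorem face_apply (d : G.D) : G.face d = G.next (G.rev d) := rfl

theorem tail_next (d : G.D) : G.tail (G.next d) = G.tail d :=
  ((G.tail_eq_iff _ _).2 ⟨1, by simp⟩).symm

theorem tail_next_pow (k : ℕ) (d : G.D) : G.tail ((G.next ^ k) d) = G.tail d :=
  ((G.tail_eq_iff _ _).2 ⟨k, by simp⟩).symm

theorem tail_next_inv (d : G.D) : G.tail (G.next⁻¹ d) = G.tail d :=
  ((G.tail_eq_iff _ _).2 ⟨-1, by simp⟩).symm

theorem tail_face (d : G.D) : G.tail (G.face d) = G.head d := tail_next _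

theorem next_inv_next (d : G.D) : G.next⁻¹ (G.next d) = d := G.next.symm_apply_apply d

theorem next_next_inv (d : G.D) : G.next (G.next⁻¹ d) = d := G.next.apply_symm_apply d

/-- The darts at a vertex are the powers of `next` applied to one of them. -/
theorem exists_next_pow_eq {d e : G.D} (h : G.tail e = G.tail d) : ∃ k, (G.next ^ k) d = e :=
  ((G.tail_eq_iff _ _).1 h.symm).exists_nat_pow_eq

/-- A set of darts that is closed under `next` and contains one dart at a vertex contains them
all. -/
theorem next_induction {d e : G.D} (h : G.tail e = G.tail d) {p : G.D → Prop} (hd : p d)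
    (hs : ∀ x, G.tail x = G.tail d → p x → p (G.next x)) : p e := by
  have := ((G.tail_eq_iff _ _).1 h.symm).induction_forward
    (p := fun x => G.tail x = G.tail d ∧ p x) ⟨rfl, hd⟩
    fun x hx => ⟨(tail_next x).trans hx.1, hs x hx.1 hx.2⟩
  exact this.2

/-- All darts at a vertex form one cycle of `next`, so a return after `k` steps has met all of them.
The contrapositive `next_pow_ne` is the tool that keeps darts around a vertex apart. -/
theorem degree_le_of_next_pow {d : G.D} {k : ℕ} (hk : 0 < k) (h : (G.next ^ k) d = d) :
    G.degree (G.tail d) ≤ k := by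
  have : {e | G.tail e = G.tail d} ⊆ (fun i => (G.next ^ i) d) '' (Set.Iio k) := by
    intro e he
    refine next_induction (d := d) he (p := fun e => e ∈ (fun i => (G.next ^ i) d) '' (Set.Iio k))
      ⟨0, hk, by simp⟩ ?_
    rintro x - ⟨i, hi, rfl⟩
    obtain hi' | hi' : i + 1 < k ∨ i + 1 = k := by
      have : i < k := hi
      omega
    · exact ⟨i + 1, hi', by simp [pow_succ']⟩
    · refine ⟨0, hk, ?_⟩
      change (G.next ^ 0) d = G.next ((G.next ^ i) d)
      rw [← Equiv.Perm.mul_apply, ← pow_succ', hi', h]; simp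
  calc G.degree (G.tail d) ≤ ((fun i => (G.next ^ i) d) '' (Set.Iio k)).ncard :=
        Set.ncard_le_ncard this (Set.toFinite _)
    _ ≤ (Set.Iio k).ncard := Set.ncard_image_le (Set.toFinite _)
    _ = k := by
        rw [Set.ncard_eq_toFinset_card']; simp

theorem next_pow_ne {d : G.D} {k : ℕ} (hk : 0 < k) (h : k < G.degree (G.tail d)) :
    (G.next ^ k) d ≠ d := fun h' => by
  have := degree_le_of_next_pow hk h'
  omega

theorem tail_third (d : G.D) : G.tail (G.next (G.rev (G.next d))) = G.head (G.next d) :=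
  tail_next _

namespace IsNearTriangulation

variable (hG : G.IsNearTriangulation)
include hG

theorem adj (d : G.D) : G.graph.Adj (G.tail d) (G.head d) :=
  ⟨(hG.loopless d).symm, d, rfl, rfl⟩

theorem face_mem_outer (d : G.D) : G.face d ∈ G.outer ↔ d ∈ G.outer := by
  constructor
  · intro h
    exact (hG.outer_face _ h _).2 (Equiv.Perm.SameCycle.symm ⟨1, by simp⟩)
  · intro h
    exact (hG.outer_face _ h _).2 ⟨1, by simp⟩

theorem next_rev_mem_outer (d : G.D) : G.next (G.rev d) ∈ G.outer ↔ d ∈ G.outer :=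
  hG.face_mem_outer d

theorem face_ne (d : G.D) : G.face d ≠ d := fun h =>
  hG.loopless d (by rw [← tail_face, h])

/-- Each finite region accounts for three of the darts off the infinite region. Regions can thus be
counted through darts in Euler's formula. -/
theorem three_mul_numFaces (h : G.outer.Nonempty) : 3 * G.numFaces = G.outerᶜ.ncard + 3 := by
  obtain ⟨d, hd⟩ := h
  have key := card_cycles_of_triangles G.face G.outer d hd hG.outer_face hG.triangle
    fun d _ => hG.face_ne d
  have : 0 < Nat.card (Quotient (Equiv.Perm.SameCycle.setoid G.face)) := by omega
  rw [numFaces, max_eq_right this, key]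

/-- The third side of the triangle in the angle between `d` and `next d`. -/
theorem next_rev_third {d : G.D} (h : G.rev d ∉ G.outer) :
    G.next (G.rev (G.next (G.rev (G.next d)))) = G.rev d := by
  have := hG.triangle _ h
  simpa only [face_apply, G.rev_rev] using this

theorem head_third {d : G.D} (h : G.rev d ∉ G.outer) :
    G.head (G.next (G.rev (G.next d))) = G.head d := by
  have := congrArg G.tail (hG.next_rev_third h)
  rwa [tail_next, tail_rev, tail_rev] at this

/-- The third side, seen from the other end. -/
theorem rev_third {d : G.D} (h : G.rev d ∉ G.outer) :
    G.rev (G.next (G.rev (G.next d))) = G.next⁻¹ (G.rev d) := by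
  exact (next_inv_next _).symm.trans (congrArg _ (hG.next_rev_third h))

end IsNearTriangulation

end Drawing

theorem Set.eq_or_eq_of_ncard_eq_two {α : Type*} [Finite α] {s : Set α} (hs : s.ncard = 2)
    {a b c : α} (ha : a ∈ s) (hb : b ∈ s) (hab : a ≠ b) (hc : c ∈ s) : c = a ∨ c = b := by
  have : ({a, b} : Set α) = s := Set.eq_of_subset_of_ncard_le
    (Set.insert_subset ha (Set.singleton_subset_iff.2 hb)) (by rw [hs, Set.ncard_pair hab])
  rw [← this] at hc
  exact hc

theorem Set.ncard_pair_le {α : Type*} (a b : α) : ({a, b} : Set α).ncard ≤ 2 :=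
  (Set.ncard_insert_le _ _).trans (by rw [Set.ncard_singleton])

/-! ### The structure of cartwheels -/

namespace Cartwheel

open Drawing

variable (W : Cartwheel)

/-- The rim of a cartwheel is its second circuit: the vertices that are neither the hub nor
spokes. -/
def IsRim (v : W.G.V) : Prop := v ≠ W.hub ∧ ¬ W.IsSpoke v

/-- Adjacency to the hub determines both circuits, so the existential choice in `circuits` can be
replaced by the spokes and the rim. -/
theorem circuits_eq : IsInducedCircuit {v | W.IsSpoke v} ∧ IsInducedCircuit {v | W.IsRim v} ∧
    ∀ d, (d ∈ W.G.outer ∨ W.G.rev d ∈ W.G.outer) ↔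
      (W.IsRim (W.G.tail d) ∧ W.IsRim (W.G.head d)) := by
  obtain ⟨C₁, C₂, h1, h2, hdis, huniv, hC1, hC2, hout, hs1, hs2⟩ := W.circuits
  have e1 : {v | W.IsSpoke v} = C₁ := by
    ext v
    constructor
    · intro hv
      rcases (huniv ▸ Set.mem_univ v : v ∈ {W.hub} ∪ C₁ ∪ C₂) with (h | h) | h
      · exact absurd h.symm (show W.IsSpoke v from hv).ne
      · exact h
      · exact absurd hv (hs2 v h)
    · exact hs1 v
  have e2 : {v | W.IsRim v} = C₂ := by
    ext v
    constructor
    · intro hv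
      rcases (huniv ▸ Set.mem_univ v : v ∈ {W.hub} ∪ C₁ ∪ C₂) with (h | h) | h
      · exact absurd h hv.1
      · exact absurd (hs1 v h) hv.2
      · exact h
    · intro hv
      exact ⟨fun h => h2 (h ▸ hv), hs2 v hv⟩
  have e2' : ∀ v, W.IsRim v ↔ v ∈ C₂ := fun v => by rw [← e2]; rfl
  exact ⟨e1 ▸ hC1, e2 ▸ hC2, fun d => by rw [hout, e2', e2']⟩

variable {W}

theorem loopless (d : W.G.D) : W.G.head d ≠ W.G.tail d := W.nearTriangulation.loopless d

theorem IsSpoke.ne_hub {u : W.G.V} (h : W.IsSpoke u) : u ≠ W.hub := h.ne'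

theorem IsSpoke.not_isRim {u : W.G.V} (h : W.IsSpoke u) : ¬ W.IsRim u := fun h' => h'.2 h

theorem not_isRim_hub : ¬ W.IsRim W.hub := fun h => h.1 rfl

theorem not_isSpoke_hub : ¬ W.IsSpoke W.hub := fun h => h.ne rfl

theorem vertex_cases (v : W.G.V) : v = W.hub ∨ W.IsSpoke v ∨ W.IsRim v := by
  unfold IsRim; tauto

theorem isSpoke_head {d : W.G.D} (h : W.G.tail d = W.hub) : W.IsSpoke (W.G.head d) := by
  have := W.nearTriangulation.adj d
  rwa [h] at this

theorem isSpoke_tail {d : W.G.D} (h : W.G.head d = W.hub) : W.IsSpoke (W.G.tail d) := by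
  rw [← head_rev]; exact isSpoke_head h

theorem exists_hub_dart {u : W.G.V} (hu : W.IsSpoke u) :
    ∃ h, W.G.tail h = W.hub ∧ W.G.head h = u := hu.2

theorem head_ne_hub_of_isRim {d : W.G.D} (h : W.IsRim (W.G.tail d)) : W.G.head d ≠ W.hub :=
  fun h' => h.2 (isSpoke_tail h')

theorem head_isSpoke_or_isRim {d : W.G.D} (h : W.IsRim (W.G.tail d)) :
    W.IsSpoke (W.G.head d) ∨ W.IsRim (W.G.head d) :=
  (vertex_cases _).resolve_left (head_ne_hub_of_isRim h)

theorem outer_or_rev_outer_iff (d : W.G.D) : (d ∈ W.G.outer ∨ W.G.rev d ∈ W.G.outer) ↔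
    (W.IsRim (W.G.tail d) ∧ W.IsRim (W.G.head d)) := W.circuits_eq.2.2 d

theorem isRim_of_outer {d : W.G.D} (h : d ∈ W.G.outer) :
    W.IsRim (W.G.tail d) ∧ W.IsRim (W.G.head d) := (outer_or_rev_outer_iff d).1 (.inl h)

theorem notMem_outer_of_tail {d : W.G.D} (h : ¬ W.IsRim (W.G.tail d)) : d ∉ W.G.outer :=
  fun h' => h (isRim_of_outer h').1

theorem notMem_outer_of_head {d : W.G.D} (h : ¬ W.IsRim (W.G.head d)) : d ∉ W.G.outer :=
  fun h' => h (isRim_of_outer h').2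

theorem rev_notMem_outer_of_tail {d : W.G.D} (h : ¬ W.IsRim (W.G.tail d)) :
    W.G.rev d ∉ W.G.outer := notMem_outer_of_head (by rwa [head_rev])

theorem exists_isSpoke : ∃ u, W.IsSpoke u := by
  obtain ⟨u⟩ := W.circuits_eq.1.1.nonempty
  exact ⟨u.1, u.2⟩

theorem ncard_spoke_darts {u : W.G.V} (hu : W.IsSpoke u) :
    {d | W.G.tail d = u ∧ W.IsSpoke (W.G.head d)}.ncard = 2 := W.circuits_eq.1.2 u hu

theorem ncard_rim_darts {x : W.G.V} (hx : W.IsRim x) :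
    {d | W.G.tail d = x ∧ W.IsRim (W.G.head d)}.ncard = 2 := W.circuits_eq.2.1.2 x hx

theorem exists_outer_dart {x : W.G.V} (hx : W.IsRim x) :
    ∃ d ∈ W.G.outer, W.G.tail d = x := by
  obtain ⟨d, hd, hd'⟩ : {d | W.G.tail d = x ∧ W.IsRim (W.G.head d)}.Nonempty :=
    Set.nonempty_of_ncard_ne_zero (by rw [ncard_rim_darts hx]; simp)
  rcases (outer_or_rev_outer_iff d).2 ⟨hd ▸ hx, hd'⟩ with h | h
  · exact ⟨d, h, hd⟩
  -- The dart `next d` follows `rev d` on its region and starts at `x` again.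
  · refine ⟨W.G.next d, ?_, by rw [tail_next, hd]⟩
    rw [← W.G.rev_rev d]
    exact (W.nearTriangulation.next_rev_mem_outer _).2 h

theorem exists_dart (v : W.G.V) : ∃ d, W.G.tail d = v := by
  rcases vertex_cases v with rfl | h | h
  · obtain ⟨u, hu⟩ := W.exists_isSpoke
    obtain ⟨h, hh, -⟩ := exists_hub_dart hu
    exact ⟨h, hh⟩
  · obtain ⟨d, hd, hd'⟩ := exists_hub_dart h
    exact ⟨W.G.rev d, hd'⟩
  · obtain ⟨d, -, hd⟩ := exists_outer_dart h
    exact ⟨d, hd⟩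

theorem onOuter_iff (v : W.G.V) : W.G.OnOuter v ↔ W.IsRim v := by
  constructor
  · rintro (⟨d, hd, rfl⟩ | h)
    · exact (isRim_of_outer hd).1
    · obtain ⟨d, hd⟩ := exists_dart v
      exact absurd hd (h d)
  · intro h
    obtain ⟨d, hd, hd'⟩ := exists_outer_dart h
    exact .inl ⟨d, hd, hd'⟩

theorem gamma_eq_degree {v : W.G.V} (h : ¬ W.IsRim v) : W.γ v = W.G.degree v :=
  W.gamma_inner v (by rwa [onOuter_iff])

theorem five_le_degree {v : W.G.V} (h : ¬ W.IsRim v) : 5 ≤ W.G.degree v :=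
  gamma_eq_degree h ▸ W.five_le v

/-- Off the rim the degree equals `γ`, hence is at least five, and the rotation does not close up
within four steps. Most exclusions of degenerate cartwheels below come from this. -/
theorem next_pow_ne {d : W.G.D} (h : ¬ W.IsRim (W.G.tail d)) {k : ℕ} (hk : 0 < k) (hk' : k < 5) :
    (W.G.next ^ k) d ≠ d :=
  Drawing.next_pow_ne hk (hk'.trans_le (five_le_degree h))

/-! #### Around a spoke -/

section Hub

variable {h : W.G.D} (hh : W.G.tail h = W.hub)
include hh

/-- A dart at the hub is not on the infinite region, so its region is a triangle, with the darts
`h`, `next (rev h)` and `rev (next⁻¹ h)`. -/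
theorem next_rev_next_rev_hub :
    W.G.next (W.G.rev (W.G.next (W.G.rev h))) = W.G.rev (W.G.next⁻¹ h) := by
  have h1 := W.nearTriangulation.next_rev_third (d := W.G.rev h)
    (by rw [W.G.rev_rev]; exact notMem_outer_of_tail (hh ▸ not_isRim_hub))
  rw [W.G.rev_rev] at h1
  conv_rhs => rw [← h1, next_inv_next, W.G.rev_rev]

theorem rev_next_rev_hub :
    W.G.rev (W.G.next (W.G.rev h)) = W.G.next⁻¹ (W.G.rev (W.G.next⁻¹ h)) := by
  rw [← next_rev_next_rev_hub hh, next_inv_next]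

theorem tail_next_hub : W.G.tail (W.G.next h) = W.hub := by rw [tail_next, hh]

theorem tail_next_inv_hub : W.G.tail (W.G.next⁻¹ h) = W.hub := by rw [tail_next_inv, hh]

theorem rev_next_inv_rev_hub :
    W.G.rev (W.G.next⁻¹ (W.G.rev h)) = W.G.next (W.G.rev (W.G.next h)) := by
  have := rev_next_rev_hub (tail_next_hub hh)
  rw [next_inv_next] at this
  rw [← this, W.G.rev_rev]

theorem head_next_rev_hub : W.G.head (W.G.next (W.G.rev h)) = W.G.head (W.G.next⁻¹ h) := by
  rw [head, rev_next_rev_hub hh, tail_next_inv, tail_rev]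

theorem head_next_inv_rev_hub : W.G.head (W.G.next⁻¹ (W.G.rev h)) = W.G.head (W.G.next h) := by
  rw [head, rev_next_inv_rev_hub hh, tail_next, tail_rev]

theorem tail_rev_hub_not_isRim : ¬ W.IsRim (W.G.tail (W.G.rev h)) :=
  (isSpoke_head hh).not_isRim

theorem next_rev_ne_next_inv_rev : W.G.next (W.G.rev h) ≠ W.G.next⁻¹ (W.G.rev h) := fun h' =>
  next_pow_ne (tail_rev_hub_not_isRim hh) (k := 2) (by norm_num) (by norm_num) (by
    rw [pow_two, Equiv.Perm.mul_apply, h', next_next_inv])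

/-- The circuit of the spokes is induced, so exactly two darts lead from a spoke to spokes. By the
triangles at the hub, the two neighbours of `rev h` in the rotation are such darts. -/
theorem eq_of_isSpoke_head {d : W.G.D} (hd : W.G.tail d = W.G.head h)
    (hd' : W.IsSpoke (W.G.head d)) :
    d = W.G.next (W.G.rev h) ∨ d = W.G.next⁻¹ (W.G.rev h) := by
  refine Set.eq_or_eq_of_ncard_eq_two (ncard_spoke_darts (isSpoke_head hh)) ⟨?_, ?_⟩ ⟨?_, ?_⟩
    (next_rev_ne_next_inv_rev hh) ⟨hd, hd'⟩
  · rw [tail_next, tail_rev]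
  · rw [head_next_rev_hub hh]; exact isSpoke_head (tail_next_inv_hub hh)
  · rw [tail_next_inv, tail_rev]
  · rw [head_next_inv_rev_hub hh]; exact isSpoke_head (tail_next_hub hh)

/-- The hub is joined to every spoke by one edge only. -/
theorem hub_dart_unique {h' : W.G.D} (hh' : W.G.tail h' = W.hub) (he : W.G.head h' = W.G.head h) :
    h' = h := by
  have hb := eq_of_isSpoke_head hh (d := W.G.next (W.G.rev h')) (by rw [tail_next, tail_rev, he])
    (by rw [head_next_rev_hub hh']; exact isSpoke_head (tail_next_inv_hub hh'))
  have ha := eq_of_isSpoke_head hh (d := W.G.next⁻¹ (W.G.rev h'))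
    (by rw [tail_next_inv, tail_rev, he])
    (by rw [head_next_inv_rev_hub hh']; exact isSpoke_head (tail_next_hub hh'))
  rcases hb with hb | hb
  · exact rev_injective (W.G.next.injective hb)
  rcases ha with ha | ha
  -- The two darts to spokes follow one another across `rev h` and across `rev h'`, so the rotation
  -- would close up after four darts.
  · exfalso
    refine next_pow_ne (tail_rev_hub_not_isRim hh) (k := 4) (by norm_num) (by norm_num) ?_
    rw [show (4 : ℕ) = 1 + 1 + 1 + 1 from rfl]
    simp only [pow_succ, pow_zero, one_mul, Equiv.Perm.mul_apply]
    rw [← ha, next_next_inv, hb, next_next_inv]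
  · exact rev_injective (W.G.next⁻¹.injective ha)

theorem eq_rev_of_head_eq_hub {d : W.G.D} (hd : W.G.tail d = W.G.head h)
    (hd' : W.G.head d = W.hub) : d = W.G.rev h := by
  rw [← hub_dart_unique hh (h' := W.G.rev d) hd' (by rw [head_rev, hd]), W.G.rev_rev]

theorem isRim_head_iff {d : W.G.D} (hd : W.G.tail d = W.G.head h) :
    W.IsRim (W.G.head d) ↔
      d ≠ W.G.rev h ∧ d ≠ W.G.next (W.G.rev h) ∧ d ≠ W.G.next⁻¹ (W.G.rev h) := by
  constructor
  · intro h1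
    refine ⟨?_, ?_, ?_⟩ <;> rintro rfl
    · rw [head_rev, hh] at h1; exact not_isRim_hub h1
    · rw [head_next_rev_hub hh] at h1
      exact (isSpoke_head (tail_next_inv_hub hh)).not_isRim h1
    · rw [head_next_inv_rev_hub hh] at h1
      exact (isSpoke_head (tail_next_hub hh)).not_isRim h1
  · rintro ⟨h1, h2, h3⟩
    rcases vertex_cases (W.G.head d) with h' | h' | h'
    · exact absurd (eq_rev_of_head_eq_hub hh hd h') h1
    · rcases eq_of_isSpoke_head hh hd h' with h' | h'
      · exact absurd h' h2
      · exact absurd h' h3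
    · exact h'

omit hh in
theorem next_pow_eq_next_inv_iff (k : ℕ) (d : W.G.D) :
    (W.G.next ^ k) d = W.G.next⁻¹ d ↔ (W.G.next ^ (k + 1)) d = d := by
  rw [pow_succ', Equiv.Perm.mul_apply]
  exact ⟨fun h => by rw [h, next_next_inv], fun h => by rw [← h, next_inv_next, h]⟩

omit hh in
theorem next_pow_succ_eq_iff (k : ℕ) (d : W.G.D) :
    (W.G.next ^ (k + 1)) d = W.G.next d ↔ (W.G.next ^ k) d = d := by
  rw [pow_succ', Equiv.Perm.mul_apply, W.G.next.injective.eq_iff]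

/-- Counted from the dart to the hub, the positions `0`, `1` and `degree - 1` are those of the hub
and the two neighbouring spokes; all others lead to the rim. -/
theorem isRim_head_next_pow {k : ℕ} (hk : 2 ≤ k) (hk' : k + 1 < W.G.degree (W.G.head h)) :
    W.IsRim (W.G.head ((W.G.next ^ k) (W.G.rev h))) := by
  rw [isRim_head_iff hh (by rw [tail_next_pow, tail_rev])]
  refine ⟨Drawing.next_pow_ne (by omega) ?_, ?_, ?_⟩
  · rw [tail_rev]; omega
  · obtain ⟨k, rfl⟩ : ∃ j, k = j + 1 := ⟨k - 1, by omega⟩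
    rw [Ne, next_pow_succ_eq_iff]
    exact Drawing.next_pow_ne (by omega) (by rw [tail_rev]; omega)
  · rw [Ne, next_pow_eq_next_inv_iff]
    exact Drawing.next_pow_ne (by omega) (by rw [tail_rev]; omega)

end Hub

end Cartwheel

namespace Cartwheel

open Drawing

variable {W : Cartwheel}

/-! #### Around a rim vertex -/

/-- The darts at a vertex of the rim that run along the rim. -/
theorem rim_dart_cases {d e f : W.G.D} (hd : W.IsRim (W.G.tail d)) (hd' : W.IsRim (W.G.head d))
    (he : W.G.tail e = W.G.tail d) (he' : W.IsRim (W.G.head e)) (hde : d ≠ e)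
    (hf : W.G.tail f = W.G.tail d) (hf' : W.IsRim (W.G.head f)) : f = d ∨ f = e :=
  Set.eq_or_eq_of_ncard_eq_two (ncard_rim_darts hd) (a := d) (b := e) ⟨rfl, hd'⟩ ⟨he, he'⟩ hde
    ⟨hf, hf'⟩

section Outer

variable {d : W.G.D} (hd : d ∈ W.G.outer)
include hd

theorem rev_next_inv_mem_outer : W.G.rev (W.G.next⁻¹ d) ∈ W.G.outer := by
  rw [← W.nearTriangulation.next_rev_mem_outer, W.G.rev_rev, next_next_inv]; exact hd

theorem isRim_head_next_inv : W.IsRim (W.G.head (W.G.next⁻¹ d)) :=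
  (isRim_of_outer (rev_next_inv_mem_outer hd)).1

/-- A fixed dart of `next` would be the only dart at its tail, whereas a vertex of the rim has two
darts along the rim. -/
theorem next_ne_self_of_outer : W.G.next d ≠ d := by
  intro h
  have : {e | W.G.tail e = W.G.tail d ∧ W.IsRim (W.G.head e)} ⊆ {d} := by
    rintro e ⟨he, -⟩
    refine next_induction (d := d) (p := fun e => e = d) he rfl ?_
    rintro x - rfl
    exact h
  have := Set.ncard_le_ncard this
  rw [ncard_rim_darts (isRim_of_outer hd).1, Set.ncard_singleton] at this
  omega

theorem next_inv_ne_self_of_outer : W.G.next⁻¹ d ≠ d := fun h =>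
  next_ne_self_of_outer hd (by conv_lhs => rw [← h, next_next_inv])

theorem eq_of_isRim_head {e : W.G.D} (he : W.G.tail e = W.G.tail d) (he' : W.IsRim (W.G.head e)) :
    e = d ∨ e = W.G.next⁻¹ d :=
  rim_dart_cases (isRim_of_outer hd).1 (isRim_of_outer hd).2 (tail_next_inv _)
    (isRim_head_next_inv hd) (next_inv_ne_self_of_outer hd).symm he he'

/-- This passes a failure of `isSpoke_head_next` on to the next outer dart. If the triangle beyond
`d` has its third vertex on the rim, then `next⁻¹ (rev d)` runs along the rim and must be `face d`.
So `next (face d)` is `rev d`, which also runs along the rim. -/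
theorem isRim_head_next_face (h : W.IsRim (W.G.head (W.G.next d))) :
    W.IsRim (W.G.head (W.G.next (W.G.face d))) := by
  have hd' : W.G.face d ∈ W.G.outer := (W.nearTriangulation.face_mem_outer d).2 hd
  have hf1 : W.G.next⁻¹ (W.G.face d) = W.G.rev d := next_inv_next _
  have hfd := next_inv_ne_self_of_outer hd'
  rw [hf1] at hfd
  suffices h : W.G.next⁻¹ (W.G.rev d) = W.G.face d by
    rw [← h, next_next_inv, head_rev]; exact (isRim_of_outer hd).1
  suffices h : W.IsRim (W.G.head (W.G.next⁻¹ (W.G.rev d))) by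
    rcases eq_of_isRim_head hd' (by rw [tail_next_inv, tail_face, tail_rev]) h with h | h
    · exact h
    · rw [hf1] at h
      have h : W.G.rev d = W.G.next (W.G.rev d) := by conv_rhs => rw [← h, next_next_inv]
      exact absurd h hfd
  by_cases hf : W.G.rev d ∈ W.G.outer
  · exact isRim_head_next_inv hf
  · have := W.nearTriangulation.rev_third hf
    rw [← this, head_rev, tail_third]
    exact h

/-- If the conclusion failed for one outer dart, it would fail for all of them by
`isRim_head_next_face`. Every vertex of the rim would then have only its two darts along the rim,
and the rim would be separated from the hub, against connectivity. -/
theorem isSpoke_head_next : W.IsSpoke (W.G.head (W.G.next d)) := by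
  by_contra hs
  have hr : W.IsRim (W.G.head (W.G.next d)) :=
    (head_isSpoke_or_isRim (by rw [tail_next]; exact (isRim_of_outer hd).1)).resolve_left hs
  have key : ∀ e ∈ W.G.outer, W.IsRim (W.G.head (W.G.next e)) := by
    intro e he
    have := ((W.nearTriangulation.outer_face d hd e).1 he).induction_forward
      (p := fun e => e ∈ W.G.outer ∧ W.IsRim (W.G.head (W.G.next e))) ⟨hd, hr⟩
      fun x hx => ⟨(W.nearTriangulation.face_mem_outer x).2 hx.1, isRim_head_next_face hx.1 hx.2⟩
    exact this.2
  have closed : ∀ a b, W.G.graph.Adj a b → W.IsRim a → W.IsRim b := by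
    rintro _ _ ⟨-, e, rfl, rfl⟩ ha
    obtain ⟨d, hd, hde⟩ := exists_outer_dart ha
    have hn : W.G.next d = W.G.next⁻¹ d :=
      (eq_of_isRim_head hd (tail_next _) (key d hd)).resolve_left (next_ne_self_of_outer hd)
    have : e = d ∨ e = W.G.next d := by
      refine next_induction (d := d) (p := fun e => e = d ∨ e = W.G.next d) hde.symm (.inl rfl) ?_
      rintro x - (rfl | rfl)
      · exact .inr rfl
      · left; rw [hn, next_next_inv]
    rcases this with rfl | rfl
    · exact (isRim_of_outer hd).2
    · exact key d hd
  have hreach : ∀ a b, W.G.graph.Reachable a b → W.IsRim a → W.IsRim b := by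
    rintro a b ⟨p⟩ ha
    induction p with
    | nil => exact ha
    | cons h _ ih => exact ih (closed _ _ h ha)
  exact not_isRim_hub (hreach _ _ (W.nearTriangulation.connected.preconnected _ _)
    (isRim_of_outer hd).1)

theorem next_inv_notMem_outer : W.G.next⁻¹ d ∉ W.G.outer := fun h => by
  have := isSpoke_head_next h
  rw [next_next_inv] at this
  have h2 := isRim_head_next_inv h
  rcases eq_of_isRim_head hd (by rw [tail_next_inv, tail_next_inv]) h2 with h' | h'
  · exact this.not_isRim (isRim_of_outer hd).2
  · exact this.not_isRim (isRim_of_outer hd).2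

/-- If both sides of the edge were infinite, `next d` would be an outer dart too and would end on
the rim instead of at a spoke. -/
theorem rev_notMem_outer : W.G.rev d ∉ W.G.outer := fun h => by
  have := (W.nearTriangulation.next_rev_mem_outer _).2 h
  rw [W.G.rev_rev] at this
  exact (isSpoke_head_next hd).not_isRim (isRim_of_outer this).2

theorem outer_dart_unique {e : W.G.D} (he : e ∈ W.G.outer) (h : W.G.tail e = W.G.tail d) :
    e = d := by
  rcases eq_of_isRim_head hd h (isRim_of_outer he).2 with h | h
  · exact h
  · exact absurd (h ▸ he) (next_inv_notMem_outer hd)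

/-- The ends of an edge of the rim have a common spoke. -/
theorem adj_head_next : W.G.graph.Adj (W.G.tail d) (W.G.head (W.G.next d)) ∧
    W.G.graph.Adj (W.G.head d) (W.G.head (W.G.next d)) := by
  constructor
  · rw [← tail_next]; exact W.nearTriangulation.adj _
  · have h := W.nearTriangulation.adj (W.G.next (W.G.rev (W.G.next d)))
    rw [tail_third, W.nearTriangulation.head_third (rev_notMem_outer hd)] at h
    exact h.symm

end Outer

theorem exists_adj_isSpoke {x : W.G.V} (hx : W.IsRim x) :
    ∃ u, W.IsSpoke u ∧ W.G.graph.Adj x u := by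
  obtain ⟨d, hd, rfl⟩ := exists_outer_dart hx
  exact ⟨_, isSpoke_head_next hd, (adj_head_next hd).1⟩

/-! #### Edges between spokes and the rim -/

section Middle

variable {e : W.G.D} (he : W.IsSpoke (W.G.tail e))
include he

/-- Consecutive darts from a spoke to the rim end at consecutive vertices of the rim. -/
theorem rev_next_rev_next : W.G.rev (W.G.next (W.G.rev (W.G.next e))) = W.G.next⁻¹ (W.G.rev e) :=
  W.nearTriangulation.rev_third (rev_notMem_outer_of_tail he.not_isRim)

theorem head_next_rev_next : W.G.head (W.G.next (W.G.rev (W.G.next e))) = W.G.head e :=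
  W.nearTriangulation.head_third (rev_notMem_outer_of_tail he.not_isRim)

theorem head_next_inv_rev : W.G.head (W.G.next⁻¹ (W.G.rev e)) = W.G.head (W.G.next e) := by
  rw [← rev_next_rev_next he, head_rev, tail_third]

theorem head_next_rev : W.G.head (W.G.next (W.G.rev e)) = W.G.head (W.G.next⁻¹ e) := by
  have := head_next_rev_next (e := W.G.next⁻¹ e) (by rwa [tail_next_inv])
  rwa [next_next_inv] at this

variable (h0 : W.IsRim (W.G.head e)) (h1 : W.IsRim (W.G.head (W.G.next e)))
  (h2 : W.IsRim (W.G.head (W.G.next⁻¹ e)))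
include h0 h1 h2

/-- The darts at the end of an inner edge from a spoke to the rim. -/
theorem middle_dart : ∃ d ∈ W.G.outer, W.G.next d = W.G.rev e ∧
    W.G.next (W.G.rev e) = W.G.next⁻¹ d := by
  obtain ⟨d, hd, hde⟩ := exists_outer_dart h0
  have a1 : W.IsRim (W.G.head (W.G.next⁻¹ (W.G.rev e))) := by rwa [head_next_inv_rev he]
  have a2 : W.IsRim (W.G.head (W.G.next (W.G.rev e))) := by rwa [head_next_rev he]
  have b : ¬ W.IsRim (W.G.head (W.G.rev e)) := by rw [head_rev]; exact he.not_isRim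
  have c1 : W.G.next d = W.G.rev e := by
    rcases eq_of_isRim_head hd (by rw [tail_next_inv, tail_rev, hde]) a1 with h | h
    · rw [← h, next_next_inv]
    · exact absurd (by rw [W.G.next⁻¹.injective h]; exact (isRim_of_outer hd).2) b
  refine ⟨d, hd, c1, ?_⟩
  rcases eq_of_isRim_head hd (by rw [tail_next, tail_rev, hde]) a2 with h | h
  · exact absurd (by rw [← next_inv_next (W.G.rev e), h]; exact isRim_head_next_inv hd) b
  · exact h

/-- By `middle_dart` the end of `e` has just three darts, two along the rim and `rev e`. -/
theorem isFanOver_of_middle : W.IsFanOver (W.G.head e) (W.G.tail e) := by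
  obtain ⟨d, hd, h3, h4⟩ := middle_dart he h0 h1 h2
  refine ⟨h0.1, h0.2, fun u' => ⟨?_, ?_⟩⟩
  · rintro ⟨hu, -, f, hf, rfl⟩
    have ht : W.G.tail d = W.G.head e := by rw [← tail_next, h3, tail_rev]
    have : f = d ∨ f = W.G.rev e ∨ f = W.G.next⁻¹ d := by
      refine next_induction (d := d) (hf.trans ht.symm)
        (p := fun f => f = d ∨ f = W.G.rev e ∨ f = W.G.next⁻¹ d) (.inl rfl) ?_
      rintro x - (rfl | rfl | rfl)
      · exact .inr (.inl h3)
      · exact .inr (.inr h4)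
      · left; rw [next_next_inv]
    rcases this with rfl | rfl | rfl
    · exact absurd (isRim_of_outer hd).2 hu.not_isRim
    · rw [head_rev]
    · exact absurd (isRim_head_next_inv hd) hu.not_isRim
  · rintro rfl
    exact ⟨he, (W.nearTriangulation.adj e).symm⟩

end Middle

/-- A vertex of the rim is not adjacent to three consecutive spokes. -/
theorem not_isSpoke_three {s : W.G.D} (hs : W.IsRim (W.G.tail s)) (h0 : W.IsSpoke (W.G.head s))
    (h1 : W.IsSpoke (W.G.head (W.G.next s))) : ¬ W.IsSpoke (W.G.head (W.G.next⁻¹ s)) := by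
  intro h2
  obtain ⟨h, hh, hu⟩ := exists_hub_dart h0
  have a1 := W.nearTriangulation.rev_third (d := s)
    (notMem_outer_of_tail (by rw [tail_rev]; exact h0.not_isRim))
  have a2 := W.nearTriangulation.head_third (d := W.G.next⁻¹ s)
    (notMem_outer_of_tail (by rw [tail_rev]; exact h2.not_isRim))
  rw [next_next_inv] at a2
  have b1 : W.IsSpoke (W.G.head (W.G.next⁻¹ (W.G.rev s))) := by
    rw [← a1, head_rev, tail_third]; exact h1
  have b2 : W.IsSpoke (W.G.head (W.G.next (W.G.rev s))) := by rwa [a2]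
  have ne : W.G.rev s ≠ W.G.rev h := by
    intro h'
    have := congrArg W.G.head h'
    rw [head_rev, head_rev, hh] at this
    exact not_isRim_hub (this ▸ hs)
  -- At the middle spoke, the two darts to spokes are the rotation neighbours of `rev h` and also
  -- those of `rev s`. This leaves only four darts there.
  have c1 : W.G.next⁻¹ (W.G.rev s) = W.G.next (W.G.rev h) :=
    (eq_of_isSpoke_head hh (by rw [tail_next_inv, tail_rev, hu]) b1).resolve_right
      fun h' => ne (W.G.next⁻¹.injective h')
  have c2 : W.G.next (W.G.rev s) = W.G.next⁻¹ (W.G.rev h) :=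
    (eq_of_isSpoke_head hh (by rw [tail_next, tail_rev, hu]) b2).resolve_left
      fun h' => ne (W.G.next.injective h')
  refine next_pow_ne (tail_rev_hub_not_isRim hh) (k := 4) (by norm_num) (by norm_num) ?_
  rw [show (4 : ℕ) = 1 + 1 + 1 + 1 from rfl]
  simp only [pow_succ, pow_zero, one_mul, Equiv.Perm.mul_apply]
  rw [← c1, next_next_inv, c2, next_next_inv]

/-- Among three consecutive darts one runs along the rim, so each dart is within one step of `d` or
`next⁻¹ d`, the two darts along the rim. The bound leaves room for setting `γ` to 12 on the rim. -/
theorem degree_le_four {x : W.G.V} (hx : W.IsRim x) : W.G.degree x ≤ 4 := by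
  obtain ⟨d, hd, rfl⟩ := exists_outer_dart hx
  have : {e | W.G.tail e = W.G.tail d} ⊆
      {d, W.G.next d, W.G.next⁻¹ d, W.G.next⁻¹ (W.G.next⁻¹ d)} := by
    intro e (he : W.G.tail e = W.G.tail d)
    rcases head_isSpoke_or_isRim (he ▸ hx) with h0 | h0
    · have h12 : W.IsRim (W.G.head (W.G.next e)) ∨ W.IsRim (W.G.head (W.G.next⁻¹ e)) := by
        by_contra! h
        exact not_isSpoke_three (he ▸ hx) h0
          ((head_isSpoke_or_isRim (by rw [tail_next, he]; exact hx)).resolve_right h.1)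
          ((head_isSpoke_or_isRim (by rw [tail_next_inv, he]; exact hx)).resolve_right h.2)
      rcases h12 with h | h
      · rcases eq_of_isRim_head hd (by rw [tail_next, he]) h with h | h
        · rw [← next_inv_next e, h]; simp
        · rw [← next_inv_next e, h]; simp
      · rcases eq_of_isRim_head hd (by rw [tail_next_inv, he]) h with h | h
        · rw [← next_next_inv e, h]; simp
        · rw [← next_next_inv e, h, next_next_inv]; simp
    · rcases eq_of_isRim_head hd he h0 with rfl | rfl <;> simp
  calc W.G.degree (W.G.tail d) ≤ _ := Set.ncard_le_ncard this (Set.toFinite _)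
    _ ≤ 4 := by
      refine (Set.ncard_insert_le _ _).trans ?_
      refine Nat.succ_le_succ ((Set.ncard_insert_le _ _).trans ?_)
      exact Nat.succ_le_succ (Set.ncard_pair_le _ _)

/-- At a spoke, at most five edges do not end at fan vertices. -/
theorem ncard_not_fan_le {u : W.G.V} (hu : W.IsSpoke u) :
    {e | W.G.tail e = u ∧ ¬ W.IsFanOver (W.G.head e) u}.ncard ≤ 5 := by
  obtain ⟨h, hh, rfl⟩ := exists_hub_dart hu
  set r := W.G.rev h with hr
  have key : ∀ e, W.G.tail e = W.G.head h → ¬ W.IsRim (W.G.head e) →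
      e = r ∨ e = W.G.next r ∨ e = W.G.next⁻¹ r := by
    intro e he he'
    rw [isRim_head_iff hh he] at he'
    tauto
  -- A dart to the rim with both rotation neighbours leading to the rim ends at a fan vertex. Any
  -- other dart is one of `r`, `next r`, `next⁻¹ r`, or is next to one of them.
  have : {e | W.G.tail e = W.G.head h ∧ ¬ W.IsFanOver (W.G.head e) (W.G.head h)} ⊆
      {r, W.G.next r, W.G.next⁻¹ r, W.G.next (W.G.next r), W.G.next⁻¹ (W.G.next⁻¹ r)} := by
    rintro e ⟨he, he'⟩
    by_cases h0 : W.IsRim (W.G.head e)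
    · by_cases h1 : W.IsRim (W.G.head (W.G.next e))
      · by_cases h2 : W.IsRim (W.G.head (W.G.next⁻¹ e))
        · exact absurd (he ▸ isFanOver_of_middle (he ▸ hu) h0 h1 h2) he'
        · rw [← next_next_inv e]
          rcases key _ (by rw [tail_next_inv, he]) h2 with h | h | h <;> rw [h] <;>
            simp
      · rw [← next_inv_next e]
        rcases key _ (by rw [tail_next, he]) h1 with h | h | h <;> rw [h] <;>
          simp [next_inv_next]
    · rcases key e he h0 with h | h | h <;> rw [h] <;> simp
  refine (Set.ncard_le_ncard this (Set.toFinite _)).trans ?_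
  refine (Set.ncard_insert_le _ _).trans ?_
  refine Nat.succ_le_succ ((Set.ncard_insert_le _ _).trans ?_)
  refine Nat.succ_le_succ ((Set.ncard_insert_le _ _).trans ?_)
  exact Nat.succ_le_succ (Set.ncard_pair_le _ _)

/-- Deleting a vertex of the rim leaves a connected graph. -/
theorem numComponentsDelete_le_one {x : W.G.V} (hx : W.IsRim x) :
    W.G.numComponentsDelete x ≤ 1 := by
  refine SimpleGraph.card_connectedComponent_le_one
    ⟨W.hub, fun h : W.hub = x => not_isRim_hub (h ▸ hx)⟩ ?_
  have spoke : ∀ u (hu : W.IsSpoke u), (W.G.deleteVertex x).Reachable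
      ⟨u, fun h : u = x => hu.not_isRim (h ▸ hx)⟩
      ⟨W.hub, fun h : W.hub = x => not_isRim_hub (h ▸ hx)⟩ :=
    fun u hu => SimpleGraph.Adj.reachable (show W.G.graph.Adj u W.hub from hu.symm)
  rintro ⟨v, hv⟩
  rcases vertex_cases v with rfl | h | h
  · rfl
  · exact spoke v h
  · obtain ⟨u, hu, huv⟩ := exists_adj_isSpoke h
    exact (SimpleGraph.Adj.reachable (show (W.G.deleteVertex x).Adj ⟨v, hv⟩ ⟨u, _⟩ from huv)).trans
      (spoke u hu)

end Cartwheel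

/-! ### Isomorphisms and subdrawings -/

theorem DrawingIso.head_e {G H : Drawing} (f : DrawingIso G H) (d : G.D) :
    H.head (f.e d) = f.v (G.head d) := by
  rw [Drawing.head, f.rev_e, f.tail_e]; rfl

theorem DrawingIso.adj_iff {G H : Drawing} (f : DrawingIso G H) (a b : G.V) :
    H.graph.Adj (f.v a) (f.v b) ↔ G.graph.Adj a b := by
  constructor
  · rintro ⟨h, d, h1, h2⟩
    refine ⟨fun h' => h (h' ▸ rfl), f.e.symm d, ?_, ?_⟩
    · apply f.v.injective; rw [← f.tail_e, Equiv.apply_symm_apply, h1]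
    · apply f.v.injective; rw [← f.head_e, Equiv.apply_symm_apply, h2]
  · rintro ⟨h, d, rfl, rfl⟩
    exact ⟨fun h' => h (f.v.injective h'), f.e d, f.tail_e d, f.head_e d⟩

theorem SubdrawingEmb.head_e {G H : Drawing} (f : SubdrawingEmb G H) (d : G.D) :
    H.head (f.e d) = f.v (G.head d) := by
  rw [Drawing.head, f.rev_e, f.tail_e]; rfl

theorem SubdrawingEmb.adj {G H : Drawing} (f : SubdrawingEmb G H) {a b : G.V}
    (h : G.graph.Adj a b) : H.graph.Adj (f.v a) (f.v b) := by
  obtain ⟨h, d, rfl, rfl⟩ := h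
  exact ⟨fun h' => h (f.v_injective h'), f.e d, f.tail_e d, f.head_e d⟩

theorem SubdrawingEmb.degree_le {G H : Drawing} (f : SubdrawingEmb G H) (v : G.V) :
    G.degree v ≤ {e | H.tail e = f.v v ∧ H.head e ∈ Set.range f.v}.ncard := by
  refine Set.ncard_le_ncard_of_injOn f.e ?_ f.e_injective.injOn (Set.toFinite _)
  rintro d rfl
  exact ⟨f.tail_e d, _, (f.head_e d).symm⟩

theorem DrawingIso.numComponentsDelete_le_one {G H : Drawing} (f : DrawingIso G H) (v : G.V)
    (h : (H.deleteVertex (f.v v)).Connected) : G.numComponentsDelete v ≤ 1 := by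
  have hmem : ∀ x : ({f.v v}ᶜ : Set H.V), f.v.symm x.1 ∈ ({v}ᶜ : Set G.V) := by
    rintro ⟨x, hx⟩ (h' : f.v.symm x = v)
    exact hx (by rw [← h']; simp)
  have : (G.deleteVertex v).Connected := by
    refine h.of_weak_hom (fun x => ⟨f.v.symm x.1, hmem x⟩) ?_ ?_
    · rintro ⟨x, hx⟩
      exact ⟨⟨f.v x, fun h' => hx (f.v.injective h')⟩, by simp⟩
    · rintro ⟨a, ha⟩ ⟨b, hb⟩ hab
      refine SimpleGraph.Adj.reachable (show G.graph.Adj _ _ from ?_)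
      rw [← f.adj_iff]
      simpa using (show H.graph.Adj a b from hab)
  obtain ⟨c⟩ := this.nonempty
  exact SimpleGraph.card_connectedComponent_le_one c fun w => this.preconnected w c

/-! ### Changing the map `γ` of a configuration -/

/-- No summand is negative, and the one at `v₀` is at least two on its own. -/
theorem two_le_ring_of_exists (G : Drawing) (γ : G.V → ℕ)
    (h : ∀ v, G.OnOuter v → G.degree v < γ v) {v₀ : G.V} (h1 : G.OnOuter v₀)
    (h2 : G.numComponentsDelete v₀ ≤ 1) (h3 : G.degree v₀ + 3 ≤ γ v₀) :
    2 ≤ ∑ᶠ v ∈ {v | G.OnOuter v ∧ G.numComponentsDelete v ≤ 1}, ((γ v : ℤ) - G.degree v - 1) := by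
  rw [finsum_mem_eq_finite_toFinset_sum _ (Set.toFinite _)]
  refine le_trans ?_ (Finset.single_le_sum (f := fun v => (γ v : ℤ) - G.degree v - 1) ?_
    (a := v₀) ?_)
  · omega
  · intro v hv
    have := h v ((Set.Finite.mem_toFinset _).1 hv).1
    omega
  · exact (Set.Finite.mem_toFinset _).2 ⟨h1, h2⟩

/-- Large values of `γ` at vertices of small degree may be replaced by other large values, if there
are no cut vertices. -/
def Configuration.regamma (K : Configuration) (hcut : ∀ v, K.G.numComponentsDelete v ≤ 1)
    (γ : K.G.V → ℕ)
    (h : ∀ v, γ v = K.γ v ∨ (12 ≤ K.γ v ∧ 12 ≤ γ v ∧ K.G.degree v ≤ 5)) : Configuration where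
  G := K.G
  γ := γ
  nearTriangulation := K.nearTriangulation
  components_le := K.components_le
  gamma_cut v hv := by have := hcut v; omega
  gamma_inner v hv := by
    have := K.gamma_inner v hv
    have := h v
    omega
  gamma_outer v hv := by
    have := K.gamma_outer v hv
    have := h v
    omega
  five_le v := by
    have := K.five_le v
    have := h v
    omega
  two_le_ring := by
    by_cases h' : γ = K.γ
    · rw [h']; exact K.two_le_ring
    -- At a vertex whose value has changed, the new value exceeds the degree by at least seven. This
    -- vertex alone secures the ring-size.
    · obtain ⟨v, hv⟩ := Function.ne_iff.1 h'
      obtain ⟨h1, h2, h3⟩ := (h v).resolve_left hv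
      refine two_le_ring_of_exists _ _ (fun v hv => ?_) (v₀ := v) ?_ (hcut v) (by omega)
      · have := K.gamma_outer v hv
        have := h v
        omega
      · by_contra h4
        have := K.gamma_inner v h4
        omega

/-! ### Passes at the hub -/

namespace Pass

variable {P : Pass} {R : Rule}

theorem Obeys.near_s (hR : P.Obeys R) (v : P.K.G.V) : v = P.s ∨ P.K.G.graph.Adj v P.s ∨
    ∃ w, P.K.G.graph.Adj v w ∧ P.K.G.graph.Adj w P.s ∧ P.K.γ w ≤ 8 := by
  obtain ⟨-, h, hs, ht, hγ⟩ := hR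
  rcases R.near_s (h.v v) with h1 | h1 | ⟨w, h1, h2, h3⟩
  · exact .inl (h.v.injective (h1.trans hs.symm))
  · rw [← hs, h.adj_iff] at h1
    exact .inr (.inl h1)
  · obtain ⟨w, rfl⟩ := h.v.surjective w
    rw [h.adj_iff] at h1
    rw [← hs, h.adj_iff] at h2
    exact .inr (.inr ⟨w, h1, h2, by exact_mod_cast (hγ w).2.trans h3⟩)

theorem Obeys.near_t (hR : P.Obeys R) (v : P.K.G.V) : v = P.t ∨ P.K.G.graph.Adj v P.t ∨
    ∃ w, P.K.G.graph.Adj v w ∧ P.K.G.graph.Adj w P.t ∧ P.K.γ w ≤ 8 := by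
  obtain ⟨-, h, hs, ht, hγ⟩ := hR
  rcases R.near_t (h.v v) with h1 | h1 | ⟨w, h1, h2, h3⟩
  · exact .inl (h.v.injective (h1.trans ht.symm))
  · rw [← ht, h.adj_iff] at h1
    exact .inr (.inl h1)
  · obtain ⟨w, rfl⟩ := h.v.surjective w
    rw [h.adj_iff] at h1
    rw [← ht, h.adj_iff] at h2
    exact .inr (.inr ⟨w, h1, h2, by exact_mod_cast (hγ w).2.trans h3⟩)

variable {W : Cartwheel} (hR : P.Obeys R) (a : P.K.Appearance W.toConfiguration)
  (hub : a.f.v P.s = W.hub ∨ a.f.v P.t = W.hub)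
include hR hub

/-- A pass from or to the hub avoids the fans over the spokes of large degree. -/
theorem Obeys.fan_notMem {x u : W.G.V} (hx : W.IsFanOver x u) (hu : 8 < W.γ u) :
    x ∉ Set.range a.f.v := by
  rintro ⟨v, rfl⟩
  -- A fan vertex is neither the hub nor adjacent to it, so the internal vertex of its path to the
  -- hub is a spoke adjacent to it. That spoke is `u`, whose value exceeds 8.
  have key : ∀ c, a.f.v c = W.hub → ¬ (v = c ∨ P.K.G.graph.Adj v c ∨
      ∃ w, P.K.G.graph.Adj v w ∧ P.K.G.graph.Adj w c ∧ P.K.γ w ≤ 8) := by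
    rintro c hc (rfl | h | ⟨w, h1, h2, h3⟩)
    · exact hx.1 hc
    · have := a.f.adj h
      rw [hc] at this
      exact hx.2.1 this.symm
    · have h4 := a.f.adj h2
      rw [hc] at h4
      have := (hx.2.2 _).1 ⟨h4.symm, a.f.adj h1⟩
      rw [← a.gamma, this] at h3
      omega
  rcases hub with h | h
  · exact key _ h (hR.near_s v)
  · exact key _ h (hR.near_t v)

/-- At a spoke of large value the pass misses all fan vertices, and at most five edges lead
elsewhere. On the rim degrees are at most four anyway. -/
theorem Obeys.degree_le_five {v : P.K.G.V} (hv : a.f.v v ≠ W.hub) (h8 : 8 < P.K.γ v) :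
    P.K.G.degree v ≤ 5 := by
  refine (a.f.degree_le v).trans ?_
  rcases Cartwheel.vertex_cases (a.f.v v) with h | h | h
  · exact absurd h hv
  · refine (Set.ncard_le_ncard ?_ (Set.toFinite _)).trans (Cartwheel.ncard_not_fan_le h)
    rintro e ⟨h1, h2⟩
    exact ⟨h1, fun h3 => hR.fan_notMem a hub h3 (by rwa [a.gamma]) h2⟩
  · refine (Set.ncard_le_ncard ?_ (Set.toFinite _)).trans
      ((Cartwheel.degree_le_four h).trans (by norm_num))
    exact fun e h => h.1

/-- A pass from or to the hub may be realized in another configuration, with other large values of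
`γ`. -/
theorem Obeys.transfer (hβ : ∀ v, R.β v ≤ 12)
    (hδ : ∀ v, R.δ v = 5 ∨ R.δ v = 6 ∨ R.δ v = 7 ∨ R.δ v = 8 ∨ R.δ v = ⊤)
    {L : Configuration} (f : SubdrawingEmb P.K.G L.G) (hf : f.IsInduced)
    (hγ : ∀ v, L.γ (f.v v) = P.K.γ v ∨
      (a.f.v v ≠ W.hub ∧ 12 ≤ P.K.γ v ∧ 12 ≤ L.γ (f.v v))) :
    ∃ P' : Pass, P'.Obeys R ∧
      P'.AppearsAs (W := L) ⟨Set.range f.v, P.r, f.v P.s, f.v P.t⟩ := by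
  have hcut : ∀ v, P.K.G.numComponentsDelete v ≤ 1 := fun v => by
    obtain ⟨-, h, -⟩ := hR
    exact h.numComponentsDelete_le_one v (R.connected_delete _)
  -- The drawing of a rule has no cut vertices, and altered vertices have degree at most five, so
  -- the values taken from `L` again give a configuration.
  let K' := P.K.regamma hcut (fun v => L.γ (f.v v)) fun v =>
    (hγ v).imp id fun h => ⟨h.2.1, h.2.2, hR.degree_le_five a hub h.1 (by omega)⟩
  refine ⟨⟨K', P.r, P.s, P.t, P.r_pos, P.adj, P.near_s, P.near_t⟩, ?_, ⟨f, hf, fun v => rfl⟩, rfl,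
    rfl, rfl, rfl⟩
  obtain ⟨hr, h, hs, ht, hb⟩ := hR
  refine ⟨hr, h, hs, ht, fun v => ?_⟩
  change R.β (h.v v) ≤ L.γ (f.v v) ∧ (L.γ (f.v v) : ℕ∞) ≤ R.δ (h.v v)
  rcases hγ v with h1 | ⟨-, h1, h2⟩
  · rw [h1]; exact hb v
  -- The old value is at least 12, so the finite choices for `δ` are excluded and any new value is
  -- allowed above.
  · refine ⟨(hβ _).trans h2, ?_⟩
    have h3 := (hb v).2
    rcases hδ (h.v v) with h4 | h4 | h4 | h4 | h4 <;> rw [h4] at h3 ⊢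
    · have : P.K.γ v ≤ 5 := by exact_mod_cast h3
      omega
    · have : P.K.γ v ≤ 6 := by exact_mod_cast h3
      omega
    · have : P.K.γ v ≤ 7 := by exact_mod_cast h3
      omega
    · have : P.K.γ v ≤ 8 := by exact_mod_cast h3
      omega
    · exact le_top

end Pass

/-- The image of a pass under a map of the vertices. -/
def PassIn.map {W L : Configuration} (ι : W.G.V → L.G.V) (τ : PassIn W) : PassIn L :=
  ⟨ι '' τ.verts, τ.r, ι τ.s, ι τ.t⟩

theorem PassIn.map_injective {W L : Configuration} {ι : W.G.V → L.G.V}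
    (hι : Function.Injective ι) : Function.Injective (PassIn.map ι) := by
  rintro ⟨v, r, s, t⟩ ⟨v', r', s', t'⟩ h
  simp only [PassIn.map, PassIn.mk.injEq] at h
  obtain ⟨h1, h2, h3, h4⟩ := h
  obtain rfl := hι.image_injective h1
  obtain rfl := hι h3
  obtain rfl := hι h4
  rw [h2]

/-- Two cartwheels with the same passes at the hub have the same value of `N`. -/
theorem Cartwheel.N_eq_of_passes (𝓡 : Set Rule) {W W' : Cartwheel} (ι : W'.G.V → W.G.V)
    (hι : Function.Injective ι) (hhub : ι W'.hub = W.hub) (hγ : W'.γ W'.hub = W.γ W.hub)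
    (hβ : ∀ R ∈ 𝓡, ∀ v, R.β v ≤ 12)
    (hδ : ∀ R ∈ 𝓡, ∀ v, R.δ v = 5 ∨ R.δ v = 6 ∨ R.δ v = 7 ∨ R.δ v = 8 ∨ R.δ v = ⊤)
    (H1 : ∀ (P : Pass) (R : Rule), P.Obeys R → ∀ a : P.K.Appearance W.toConfiguration,
      (a.f.v P.s = W.hub ∨ a.f.v P.t = W.hub) → ∃ f : SubdrawingEmb P.K.G W'.G, f.IsInduced ∧
        ∀ v, ι (f.v v) = a.f.v v ∧ (W'.γ (f.v v) = P.K.γ v ∨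
          (a.f.v v ≠ W.hub ∧ 12 ≤ P.K.γ v ∧ 12 ≤ W'.γ (f.v v))))
    (H2 : ∀ (P : Pass) (R : Rule), P.Obeys R → ∀ a : P.K.Appearance W'.toConfiguration,
      (a.f.v P.s = W'.hub ∨ a.f.v P.t = W'.hub) → ∃ f : SubdrawingEmb P.K.G W.G, f.IsInduced ∧
        ∀ v, f.v v = ι (a.f.v v) ∧ (W.γ (f.v v) = P.K.γ v ∨
          (a.f.v v ≠ W'.hub ∧ 12 ≤ P.K.γ v ∧ 12 ≤ W.γ (f.v v)))) :
    W'.N 𝓡 = W.N 𝓡 := by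
  -- Only passes from or to the hub enter the sums. `A` and `B` show that `PassIn.map ι` sends those
  -- of `W'` onto those of `W`; it preserves `r` and the role of the hub.
  have A : ∀ τ ∈ passesIn 𝓡 W'.toConfiguration, (τ.s = W'.hub ∨ τ.t = W'.hub) →
      PassIn.map ι τ ∈ passesIn 𝓡 W.toConfiguration := by
    rintro ⟨vs, r, s, t⟩ ⟨P, ⟨R, hR, hPR⟩, a, rfl, rfl, rfl, rfl⟩ hst
    obtain ⟨f, hf, hv⟩ := H2 P R hPR a hst
    obtain ⟨P', h1, h2⟩ := hPR.transfer a hst (hβ R hR) (hδ R hR) (L := W.toConfiguration) f hf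
      fun v => (hv v).2
    refine ⟨P', ⟨R, hR, h1⟩, ?_⟩
    have hfv : f.v = ι ∘ a.f.v := funext fun v => (hv v).1
    rw [hfv, Set.range_comp] at h2
    exact h2
  have B : ∀ τ ∈ passesIn 𝓡 W.toConfiguration, (τ.s = W.hub ∨ τ.t = W.hub) →
      ∃ τ' ∈ passesIn 𝓡 W'.toConfiguration, PassIn.map ι τ' = τ := by
    rintro ⟨vs, r, s, t⟩ ⟨P, ⟨R, hR, hPR⟩, a, rfl, rfl, rfl, rfl⟩ hst
    obtain ⟨f, hf, hv⟩ := H1 P R hPR a hst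
    obtain ⟨P', h1, h2⟩ := hPR.transfer a hst (hβ R hR) (hδ R hR) (L := W'.toConfiguration) f hf
      fun v => (hv v).2
    refine ⟨_, ⟨P', ⟨R, hR, h1⟩, h2⟩, ?_⟩
    have hfv : a.f.v = ι ∘ f.v := funext fun v => (hv v).1.symm
    rw [hfv, Set.range_comp]
    rfl
  unfold Cartwheel.N
  rw [hγ]
  congr 1
  · congr 1
    refine finsum_mem_eq_of_bijOn (PassIn.map ι) ⟨?_, (PassIn.map_injective hι).injOn, ?_⟩
      fun _ _ => rfl
    · rintro τ ⟨h1, h2⟩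
      exact ⟨A τ h1 (.inr h2), (congrArg ι h2).trans hhub⟩
    · rintro τ ⟨h1, h2⟩
      obtain ⟨τ', h3, rfl⟩ := B τ h1 (.inr h2)
      exact ⟨τ', ⟨h3, hι (h2.trans hhub.symm)⟩, rfl⟩
  · refine finsum_mem_eq_of_bijOn (PassIn.map ι) ⟨?_, (PassIn.map_injective hι).injOn, ?_⟩
      fun _ _ => rfl
    · rintro τ ⟨h1, h2⟩
      exact ⟨A τ h1 (.inl h2), (congrArg ι h2).trans hhub⟩
    · rintro τ ⟨h1, h2⟩
      obtain ⟨τ', h3, rfl⟩ := B τ h1 (.inl h2)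
      exact ⟨τ', ⟨h3, hι (h2.trans hhub.symm)⟩, rfl⟩

/-! ### Suppressing a vertex of degree three -/

namespace Drawing

variable {G : Drawing}

/-- The end of `E` has degree three and is left by the reversals of `E`, `p` and `q`.  Then the edge
of `E` can be deleted, and the edges of `p` and `q` can be merged. -/
structure Suppressible (G : Drawing) (E p q : G.D) : Prop where
  tail_eq_iff : ∀ d, G.tail d = G.head E ↔ d = G.rev E ∨ d = G.rev p ∨ d = G.rev q
  p_ne_q : p ≠ q
  p_ne_E : p ≠ E
  q_ne_E : q ≠ E
  tail_p : G.tail p ≠ G.head E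
  tail_q : G.tail q ≠ G.head E
  tail_E : G.tail E ≠ G.head E

namespace Suppressible

variable {E p q : G.D} (S : Suppressible G E p q)
include S

theorem head_p : G.head p = G.head E := (S.tail_eq_iff (G.rev p)).2 (.inr (.inl rfl))

theorem head_q : G.head q = G.head E := (S.tail_eq_iff (G.rev q)).2 (.inr (.inr rfl))

omit S in
open Classical in
/-- The new reversal of darts. -/
noncomputable def newRev (p q : G.D) (d : G.D) : G.D :=
  if d = p then q else if d = q then p else G.rev d

omit S in
theorem newRev_p : newRev p q p = q := by simp [newRev]

theorem newRev_q : newRev p q q = p := by simp [newRev, S.p_ne_q.symm]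

omit S in
theorem newRev_of_ne {d : G.D} (h1 : d ≠ p) (h2 : d ≠ q) : newRev p q d = G.rev d := by
  simp [newRev, h1, h2]

theorem newRev_of_head_ne {d : G.D} (h : G.head d ≠ G.head E) : newRev p q d = G.rev d :=
  newRev_of_ne (fun h' => h (h' ▸ S.head_p)) (fun h' => h (h' ▸ S.head_q))

theorem rev_mem {d : G.D} (h : G.tail d ≠ G.head E) (hE : d ≠ E) (h1 : d ≠ p) (h2 : d ≠ q) :
    G.tail (G.rev d) ≠ G.head E ∧ G.rev d ≠ E := by
  constructor
  · rw [Ne, S.tail_eq_iff, rev_injective.eq_iff, rev_injective.eq_iff, rev_injective.eq_iff]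
    tauto
  · rintro rfl
    exact h (by rw [head_rev])

theorem newRev_mem {d : G.D} (h : G.tail d ≠ G.head E) (hE : d ≠ E) :
    G.tail (newRev p q d) ≠ G.head E ∧ newRev p q d ≠ E := by
  by_cases h1 : d = p
  · rw [h1, newRev_p]; exact ⟨S.tail_q, S.q_ne_E⟩
  by_cases h2 : d = q
  · rw [h2, S.newRev_q]; exact ⟨S.tail_p, S.p_ne_E⟩
  rw [newRev_of_ne h1 h2]
  exact S.rev_mem h hE h1 h2

theorem newRev_newRev {d : G.D} (h : G.tail d ≠ G.head E) :
    newRev p q (newRev p q d) = d := by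
  by_cases h1 : d = p
  · rw [h1, newRev_p, S.newRev_q]
  by_cases h2 : d = q
  · rw [h2, S.newRev_q, newRev_p]
  rw [newRev_of_ne h1 h2, newRev_of_ne, G.rev_rev]
  · intro h3; exact h (by rw [← head_rev, h3, S.head_p])
  · intro h3; exact h (by rw [← head_rev, h3, S.head_q])

omit S in
open Classical in
/-- The order of darts around the vertices, from which `E` has been removed. -/
noncomputable def newNext (E : G.D) : Equiv.Perm G.D := G.next.skip E

omit S in
theorem newNext_of_ne {d : G.D} (h1 : d ≠ E) (h2 : G.next d ≠ E) : newNext E d = G.next d := by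
  classical
  exact G.next.skip_apply_of_ne h1 h2

omit S in
theorem newNext_of_eq {d : G.D} (h : G.next d = E) : newNext E d = G.next E := by
  classical
  exact G.next.skip_apply_of_eq h

omit S in
theorem newNext_of_tail_ne {d : G.D} (h : G.tail d ≠ G.tail E) : newNext E d = G.next d :=
  newNext_of_ne (fun h' => h (h' ▸ rfl)) fun h' => h (by rw [← h', tail_next])

omit S in
theorem tail_newNext (d : G.D) : G.tail (newNext E d) = G.tail d := by
  classical
  exact ((G.tail_eq_iff _ _).2 (G.next.sameCycle_skip_apply E d)).symm

omit S in
theorem newNext_mem_iff (d : G.D) : (G.tail (newNext E d) ≠ G.head E ∧ newNext E d ≠ E) ↔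
    (G.tail d ≠ G.head E ∧ d ≠ E) := by
  classical
  rw [tail_newNext]
  have : newNext E E = E := G.next.skip_apply_self E
  rw [← (newNext E).injective.ne_iff (x := d), this]

/-- The drawing obtained by suppressing the end of `E`. -/
noncomputable abbrev drawing : Drawing where
  V := {v : G.V // v ≠ G.head E}
  D := {d : G.D // G.tail d ≠ G.head E ∧ d ≠ E}
  finite_V := inferInstance
  finite_D := inferInstance
  tail d := ⟨G.tail d.1, d.2.1⟩
  rev d := ⟨newRev p q d.1, S.newRev_mem d.2.1 d.2.2⟩
  next := (newNext E).subtypePerm newNext_mem_iff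
  outer := {d | d.1 ∈ G.outer}
  rev_rev d := Subtype.ext (S.newRev_newRev d.2.1)
  rev_ne d h := by
    have h := congrArg Subtype.val h
    dsimp only at h
    by_cases h1 : d.1 = p
    · rw [h1, newRev_p] at h; exact S.p_ne_q h.symm
    by_cases h2 : d.1 = q
    · rw [h2, S.newRev_q] at h; exact S.p_ne_q h
    rw [newRev_of_ne h1 h2] at h
    exact G.rev_ne _ h
  tail_eq_iff d e := by
    classical
    rw [Equiv.Perm.sameCycle_subtypePerm, Subtype.mk.injEq, G.tail_eq_iff]
    exact (Equiv.Perm.sameCycle_skip _ d.2.2 e.2.2).symm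

theorem tail_val (d : S.drawing.D) : (S.drawing.tail d).1 = G.tail d.1 := rfl

theorem rev_val (d : S.drawing.D) : (S.drawing.rev d).1 = newRev p q d.1 := rfl

theorem face_val (d : S.drawing.D) : (S.drawing.face d).1 = newNext E (newRev p q d.1) := rfl

theorem head_val (d : S.drawing.D) : (S.drawing.head d).1 = G.tail (newRev p q d.1) := rfl

theorem head_val_of_ne {d : S.drawing.D} (h1 : d.1 ≠ p) (h2 : d.1 ≠ q) :
    (S.drawing.head d).1 = G.head d.1 := by
  rw [head_val, newRev_of_ne h1 h2]; rfl

theorem head_val_of_head_ne {d : S.drawing.D} (h : G.head d.1 ≠ G.head E) :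
    (S.drawing.head d).1 = G.head d.1 :=
  S.head_val_of_ne (fun h' => h (h' ▸ S.head_p)) (fun h' => h (h' ▸ S.head_q))

theorem ne_p_q_of_head {d : S.drawing.D} (h1 : S.drawing.tail d ≠ ⟨G.tail q, S.tail_q⟩)
    (h2 : S.drawing.head d ≠ ⟨G.tail q, S.tail_q⟩) : d.1 ≠ p ∧ d.1 ≠ q := by
  constructor
  · intro h
    exact h2 (Subtype.ext (by rw [head_val, h, newRev_p]))
  · intro h
    exact h1 (Subtype.ext (by rw [tail_val, h]))

omit S in
theorem mem_of_head_ne {d : G.D} (h1 : G.tail d ≠ G.head E) (h2 : G.head d ≠ G.head E) :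
    G.tail d ≠ G.head E ∧ d ≠ E := ⟨h1, fun h => h2 (h ▸ rfl)⟩

theorem adj_of_adj {a b : S.drawing.V} (h : G.graph.Adj a.1 b.1) : S.drawing.graph.Adj a b := by
  obtain ⟨h, d, h1, h2⟩ := h
  have ha : G.tail d ≠ G.head E := h1 ▸ a.2
  have hb : G.head d ≠ G.head E := h2 ▸ b.2
  refine ⟨fun h' => h (congrArg _ h'), ⟨d, mem_of_head_ne ha hb⟩, Subtype.ext h1,
    Subtype.ext ?_⟩
  rw [S.head_val_of_head_ne hb, h2]

theorem adj_cases {a b : S.drawing.V} (h : S.drawing.graph.Adj a b) : G.graph.Adj a.1 b.1 ∨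
    (a.1 = G.tail p ∧ b.1 = G.tail q) ∨ (a.1 = G.tail q ∧ b.1 = G.tail p) := by
  obtain ⟨h, d, rfl, rfl⟩ := h
  by_cases h1 : d.1 = p
  · right; left
    exact ⟨by rw [tail_val, h1], by rw [head_val, h1, newRev_p]⟩
  by_cases h2 : d.1 = q
  · right; right
    exact ⟨by rw [tail_val, h2], by rw [head_val, h2, S.newRev_q]⟩
  · left
    exact ⟨fun h' => h (Subtype.ext h'), d.1, rfl, (S.head_val_of_ne h1 h2).symm⟩

theorem adj_p_q (h : G.tail p ≠ G.tail q) :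
    S.drawing.graph.Adj ⟨G.tail p, S.tail_p⟩ ⟨G.tail q, S.tail_q⟩ :=
  ⟨fun h' => h (congrArg Subtype.val h'), ⟨p, S.tail_p, S.p_ne_E⟩, rfl,
    Subtype.ext (by rw [head_val]; exact congrArg _ newRev_p)⟩

theorem degree_of_ne {v : S.drawing.V} (h : v.1 ≠ G.tail E) :
    S.drawing.degree v = G.degree v.1 := by
  unfold degree
  rw [← Set.ncard_image_of_injective _ Subtype.val_injective]
  congr 1
  ext d
  constructor
  · rintro ⟨d, rfl, rfl⟩; rfl
  · intro hd
    exact ⟨⟨d, fun h' => v.2 (hd.symm.trans h'), fun h' => h (hd.symm.trans (congrArg _ h'))⟩,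
      Subtype.ext hd, rfl⟩

theorem degree_tail_E {v : S.drawing.V} (h : v.1 = G.tail E) :
    S.drawing.degree v + 1 = G.degree (G.tail E) := by
  unfold degree
  rw [← Set.ncard_image_of_injective _ Subtype.val_injective]
  rw [← Set.ncard_insert_of_notMem (a := E)]
  · congr 1
    ext d
    constructor
    · rintro (rfl | ⟨d, hd, rfl⟩)
      · rfl
      · exact (congrArg Subtype.val hd).trans h
    · intro hd
      by_cases hE : d = E
      · exact .inl hE
      · exact .inr ⟨⟨d, fun h' => v.2 (h.trans (hd.symm.trans h')), hE⟩,
          Subtype.ext (hd.trans h.symm), rfl⟩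
  · rintro ⟨d, -, hd⟩
    exact d.2.2 hd

/-- Subdrawings of `G` that avoid the suppressed vertex and the start of `q`. -/
noncomputable def embOfAvoid {K : Drawing} (f : SubdrawingEmb K G)
    (hE : G.head E ∉ Set.range f.v) : SubdrawingEmb K S.drawing where
  v a := ⟨f.v a, fun h => hE ⟨a, h⟩⟩
  e d := ⟨f.e d, mem_of_head_ne (fun h => hE ⟨_, (f.tail_e d).symm.trans h⟩)
    fun h => hE ⟨_, (f.head_e d).symm.trans h⟩⟩
  v_injective a b h := f.v_injective (congrArg Subtype.val h)
  e_injective a b h := f.e_injective (congrArg Subtype.val h)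
  tail_e d := Subtype.ext (f.tail_e d)
  rev_e d := Subtype.ext (by
    have h : G.head (f.e d) ≠ G.head E := fun h => hE ⟨_, (f.head_e d).symm.trans h⟩
    rw [rev_val]
    dsimp only
    rw [S.newRev_of_head_ne h, f.rev_e])
  next_e d := by
    classical
    have hE' : E ∉ Set.range f.e := by
      rintro ⟨d, rfl⟩
      exact hE ⟨_, (f.head_e d).symm⟩
    have h1 : FirstReturn G.next (Set.range f.e) (f.e d) (f.e (K.next d)) := f.next_e d
    have h2 := h1.skip hE' ⟨_, rfl⟩ (fun h => hE' ⟨_, h⟩)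
    refine FirstReturn.of_map (σ := S.drawing.next) (τ := newNext E) (ι := Subtype.val)
      (fun x => rfl) Subtype.val_injective ?_ h2
    rintro _ ⟨d, rfl⟩
    exact ⟨d, rfl⟩
  face_e d hd := by
    obtain ⟨h1, h2⟩ := f.face_e d hd
    refine ⟨h1, Subtype.ext ?_⟩
    have h : G.head (f.e d) ≠ G.head E := fun h => hE ⟨_, (f.head_e d).symm.trans h⟩
    rw [face_val]
    dsimp only
    rw [S.newRev_of_head_ne h]
    rw [← h2, face_apply]
    refine newNext_of_ne ?_ ?_
    · rw [f.rev_e]; rintro h3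
      exact hE ⟨_, (f.head_e _).symm.trans (congrArg _ h3)⟩
    · rw [← face_apply, h2]
      rintro h3
      exact hE ⟨_, (f.head_e _).symm.trans (congrArg _ h3)⟩

/-- The only edge of the new drawing that is not an edge of `G` is the merged one. It ends at `tail
q`, which the subdrawing avoids. -/
theorem embOfAvoid_isInduced {K : Drawing} (f : SubdrawingEmb K G) (hE : G.head E ∉ Set.range f.v)
    (hq : G.tail q ∉ Set.range f.v) (hf : f.IsInduced) : (S.embOfAvoid f hE).IsInduced := by
  rintro d ⟨a, ha⟩ ⟨b, hb⟩
  have ha' : f.v a = G.tail d.1 := congrArg Subtype.val ha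
  obtain ⟨h1, h2⟩ := S.ne_p_q_of_head (d := d)
    (fun h => hq ⟨a, ha'.trans (congrArg Subtype.val h)⟩)
    (fun h => hq ⟨b, (congrArg Subtype.val hb).trans (congrArg Subtype.val h)⟩)
  have hb' : f.v b = G.head d.1 := (congrArg Subtype.val hb).trans (S.head_val_of_ne h1 h2)
  obtain ⟨c, hc⟩ := hf d.1 ⟨a, ha'⟩ ⟨b, hb'⟩
  exact ⟨c, Subtype.ext hc⟩

section OfEmb

variable {K : Drawing} (f : SubdrawingEmb K S.drawing)
  (hq : ⟨G.tail q, S.tail_q⟩ ∉ Set.range f.v)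
include hq

theorem emb_ne_p_q (d : K.D) : (f.e d).1 ≠ p ∧ (f.e d).1 ≠ q :=
  S.ne_p_q_of_head (fun h => hq ⟨_, (f.tail_e d).symm.trans h⟩)
    (fun h => hq ⟨_, (f.head_e d).symm.trans h⟩)

/-- Subdrawings of the new drawing that avoid the start of `q`. -/
noncomputable def ofEmb (hy : G.head (G.next E) = G.tail q) : SubdrawingEmb K G where
  v a := (f.v a).1
  e d := (f.e d).1
  v_injective a b h := f.v_injective (Subtype.ext h)
  e_injective a b h := f.e_injective (Subtype.ext h)
  tail_e d := congrArg Subtype.val (f.tail_e d)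
  rev_e d := by
    obtain ⟨h1, h2⟩ := S.emb_ne_p_q f hq d
    rw [← newRev_of_ne h1 h2, ← f.rev_e, rev_val]
  next_e d := by
    classical
    have hE' : E ∉ Set.range fun d => (f.e d).1 := by
      rintro ⟨d, hd⟩
      exact (f.e d).2.2 hd
    have h1 : FirstReturn S.drawing.next (Set.range f.e) (f.e d) (f.e (K.next d)) := f.next_e d
    refine FirstReturn.of_skip hE' (f.e d).2.2
      (h1.map (τ := newNext E) (ι := Subtype.val) (fun x => rfl) ?_)
    rintro x ⟨d, hd⟩
    exact ⟨d, Subtype.ext hd⟩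
  face_e d hd := by
    obtain ⟨h1, h2⟩ := f.face_e d hd
    refine ⟨h1, ?_⟩
    obtain ⟨h3, h4⟩ := S.emb_ne_p_q f hq d
    have h5 := congrArg Subtype.val h2
    rw [face_val, newRev_of_ne h3 h4] at h5
    have h6 : G.rev (f.e d).1 ≠ E := (S.rev_mem (f.e d).2.1 (f.e d).2.2 h3 h4).2
    -- If the old walk around the region met `E`, the new one would continue with `next E`. By `hy`
    -- this dart ends at the avoided vertex `tail q`.
    by_cases h7 : G.next (G.rev (f.e d).1) = E
    · exfalso
      rw [newNext_of_eq h7] at h5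
      refine hq ⟨_, (f.head_e (K.face d)).symm.trans (Subtype.ext ?_)⟩
      obtain ⟨h8, h9⟩ := S.emb_ne_p_q f hq (K.face d)
      rw [S.head_val_of_ne h8 h9, ← h5, hy]
    · rw [newNext_of_ne h6 h7] at h5
      exact h5

theorem ofEmb_isInduced (hy : G.head (G.next E) = G.tail q) (hf : f.IsInduced) :
    (S.ofEmb f hq hy).IsInduced := by
  rintro d ⟨a, ha⟩ ⟨b, hb⟩
  have ha' : (f.v a).1 = G.tail d := ha
  have hb' : (f.v b).1 = G.head d := hb
  have h1 : G.tail d ≠ G.head E := ha' ▸ (f.v a).2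
  have h2 : G.head d ≠ G.head E := hb' ▸ (f.v b).2
  obtain ⟨c, hc⟩ := hf ⟨d, mem_of_head_ne h1 h2⟩ ⟨a, Subtype.ext ha'⟩ ⟨b, Subtype.ext (by
    rw [S.head_val_of_head_ne h2]; exact hb')⟩
  exact ⟨c, congrArg Subtype.val hc⟩

end OfEmb

end Suppressible

end Drawing

/-! ### Removing a fan vertex over a spoke of large degree -/

namespace Cartwheel

open Drawing

variable {W : Cartwheel}

/-- `E` joins a spoke of large degree to a fan vertex which is followed by another fan vertex. -/
structure FanPair (W : Cartwheel) (E : W.G.D) : Prop where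
  spoke : W.IsSpoke (W.G.tail E)
  rim : W.IsRim (W.G.head E)
  rim_next : W.IsRim (W.G.head (W.G.next E))
  rim_prev : W.IsRim (W.G.head (W.G.next⁻¹ E))
  rim_next_next : W.IsRim (W.G.head (W.G.next (W.G.next E)))
  degree : 13 ≤ W.G.degree (W.G.tail E)

/-- Four consecutive positions in the rotation, `2` to `5` after the dart to the hub, lead to the
rim. The dart `E` is at position `3`, so that it and its successor both have their neighbours on the
rim. -/
theorem exists_fanPair {u : W.G.V} (hu : W.IsSpoke u) (h13 : 13 ≤ W.γ u) :
    ∃ E, W.FanPair E := by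
  rw [gamma_eq_degree hu.not_isRim] at h13
  obtain ⟨h, hh, rfl⟩ := exists_hub_dart hu
  have key : ∀ k, 2 ≤ k → k ≤ 5 → W.IsRim (W.G.head ((W.G.next ^ k) (W.G.rev h))) :=
    fun k h1 h2 => isRim_head_next_pow hh h1 (by omega)
  have t : W.G.tail ((W.G.next ^ 3) (W.G.rev h)) = W.G.head h := by rw [tail_next_pow, tail_rev]
  refine ⟨(W.G.next ^ 3) (W.G.rev h), t ▸ hu, key 3 (by norm_num) (by norm_num),
    key 4 (by norm_num) (by norm_num), ?_, key 5 (by norm_num) (by norm_num), by rw [t]; exact h13⟩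
  have := key 2 (by norm_num) (by norm_num)
  rw [← next_inv_next ((W.G.next ^ 2) (W.G.rev h))] at this
  exact this

/-! ### The rotation at a fan vertex -/

section MiddleDarts

variable {e : W.G.D} (he : W.IsSpoke (W.G.tail e)) (h0 : W.IsRim (W.G.head e))
  (h1 : W.IsRim (W.G.head (W.G.next e))) (h2 : W.IsRim (W.G.head (W.G.next⁻¹ e)))
include he h0 h1 h2

theorem middle_outer : W.G.next⁻¹ (W.G.rev e) ∈ W.G.outer := by
  obtain ⟨d, hd, h3, -⟩ := middle_dart he h0 h1 h2
  rwa [← h3, next_inv_next]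

theorem middle_next_next : W.G.next (W.G.next (W.G.rev e)) = W.G.next⁻¹ (W.G.rev e) := by
  obtain ⟨d, hd, h3, h4⟩ := middle_dart he h0 h1 h2
  rw [h4, next_next_inv, ← h3, next_inv_next]

theorem middle_tail_iff (d : W.G.D) : W.G.tail d = W.G.head e ↔
    d = W.G.rev e ∨ d = W.G.next (W.G.rev e) ∨ d = W.G.next⁻¹ (W.G.rev e) := by
  constructor
  · intro h
    refine next_induction (d := W.G.rev e) h (p := fun d => d = W.G.rev e ∨
      d = W.G.next (W.G.rev e) ∨ d = W.G.next⁻¹ (W.G.rev e)) (.inl rfl) ?_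
    rintro x - (rfl | rfl | rfl)
    · exact .inr (.inl rfl)
    · exact .inr (.inr (middle_next_next he h0 h1 h2))
    · left; rw [next_next_inv]
  · rintro (rfl | rfl | rfl)
    · rfl
    · rw [tail_next, tail_rev]
    · rw [tail_next_inv, tail_rev]

theorem eq_rev_of_middle {f : W.G.D} (hf : W.G.tail f = W.G.head e)
    (hf' : W.IsSpoke (W.G.head f)) : f = W.G.rev e := by
  rcases (middle_tail_iff he h0 h1 h2 f).1 hf with h | rfl | rfl
  · exact h
  · rw [head_next_rev he] at hf'; exact absurd h2 hf'.not_isRim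
  · rw [head_next_inv_rev he] at hf'; exact absurd h1 hf'.not_isRim

end MiddleDarts

namespace FanPair

variable {E : W.G.D} (F : W.FanPair E)

/-- The dart of the rim that ends at the removed vertex. -/
local notation "pD" => W.G.rev (W.G.next (W.G.rev E))
/-- The dart of the rim that ends at the removed vertex from the other side. -/
local notation "qD" => W.G.rev (W.G.next⁻¹ (W.G.rev E))

include F

theorem middle_fan : W.IsFanOver (W.G.head E) (W.G.tail E) :=
  isFanOver_of_middle F.spoke F.rim F.rim_next F.rim_prev

theorem next_fan : W.IsFanOver (W.G.head (W.G.next E)) (W.G.tail E) := by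
  rw [← tail_next E]
  exact isFanOver_of_middle (by rw [tail_next]; exact F.spoke) F.rim_next F.rim_next_next
    (by rw [next_inv_next]; exact F.rim)

theorem rho_outer : W.G.next⁻¹ (W.G.rev E) ∈ W.G.outer :=
  middle_outer F.spoke F.rim F.rim_next F.rim_prev

theorem next_next_rev : W.G.next (W.G.next (W.G.rev E)) = W.G.next⁻¹ (W.G.rev E) :=
  middle_next_next F.spoke F.rim F.rim_next F.rim_prev

theorem tail_p : W.G.tail pD = W.G.head (W.G.next⁻¹ E) := head_next_rev F.spoke

theorem tail_q : W.G.tail qD = W.G.head (W.G.next E) := head_next_inv_rev F.spoke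

theorem face_p : W.G.face pD = W.G.next⁻¹ (W.G.rev E) := by
  rw [face_apply, W.G.rev_rev, F.next_next_rev]

theorem p_outer : pD ∈ W.G.outer := by
  rw [← W.nearTriangulation.face_mem_outer, F.face_p]; exact F.rho_outer

theorem q_notMem_outer : qD ∉ W.G.outer := rev_notMem_outer F.rho_outer

theorem E_notMem_outer : E ∉ W.G.outer := notMem_outer_of_tail F.spoke.not_isRim

omit F in
theorem head_p : W.G.head pD = W.G.head E := by rw [head_rev, tail_next, tail_rev]

omit F in
theorem head_q : W.G.head qD = W.G.head E := by rw [head_rev, tail_next_inv, tail_rev]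

/-- The merged edge must not be a loop. Otherwise `next⁻¹ E` and `next E` would end at the same fan
vertex, which has only one dart to a spoke, and the rotation at the spoke would close up after two
steps. -/
theorem tail_p_ne_tail_q : W.G.tail pD ≠ W.G.tail qD := by
  rw [F.tail_p, F.tail_q]
  intro h
  have h1 : W.G.tail (W.G.next E) = W.G.tail E := tail_next _
  have := eq_rev_of_middle (e := W.G.next E) (f := W.G.rev (W.G.next⁻¹ E))
    (h1 ▸ F.spoke) F.rim_next F.rim_next_next (by rw [next_inv_next]; exact F.rim) h
    (by rw [head_rev, tail_next_inv]; exact F.spoke)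
  have := rev_injective this
  refine next_pow_ne F.spoke.not_isRim (k := 2) (by norm_num) (by norm_num) ?_
  rw [pow_two, Equiv.Perm.mul_apply, ← this, next_next_inv]

theorem suppressible : W.G.Suppressible E pD qD where
  tail_eq_iff d := by
    rw [W.G.rev_rev, W.G.rev_rev]
    exact middle_tail_iff F.spoke F.rim F.rim_next F.rim_prev d
  p_ne_q h := F.q_notMem_outer (h ▸ F.p_outer)
  p_ne_E h := F.E_notMem_outer (h ▸ F.p_outer)
  q_ne_E h := by
    have := F.tail_q
    rw [h] at this
    exact F.spoke.not_isRim (this ▸ F.rim_next)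
  tail_p := head_p ▸ (loopless _).symm
  tail_q := head_q ▸ (loopless _).symm
  tail_E h := F.spoke.not_isRim (h ▸ F.rim)

/-- The drawing without the fan vertex. -/
noncomputable abbrev drawing : Drawing := F.suppressible.drawing

theorem rim_tail_p : W.IsRim (W.G.tail pD) := F.tail_p ▸ F.rim_prev

theorem rim_tail_q : W.IsRim (W.G.tail qD) := F.tail_q ▸ F.rim_next

/-! The new regions. -/

theorem face_p_val {d : F.drawing.D} (h : d.1 = pD) :
    (F.drawing.face d).1 = W.G.face (W.G.face pD) := by
  rw [Suppressible.face_val, h, Suppressible.newRev_p, Suppressible.newNext_of_tail_ne, F.face_p]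
  · rfl
  · exact fun h => F.spoke.not_isRim (h ▸ F.rim_tail_q)

theorem face_q_val {d : F.drawing.D} (h : d.1 = qD) :
    (F.drawing.face d).1 = W.G.rev (W.G.next⁻¹ E) := by
  rw [Suppressible.face_val, h, F.suppressible.newRev_q, Suppressible.newNext_of_tail_ne]
  · have := rev_next_rev_next (e := W.G.next⁻¹ E) (by rw [tail_next_inv]; exact F.spoke)
    rw [next_next_inv] at this
    rw [this, next_next_inv]
  · exact fun h => F.spoke.not_isRim (h ▸ F.rim_tail_p)

theorem face_prev_val {d : F.drawing.D} (h : d.1 = W.G.rev (W.G.next⁻¹ E)) :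
    (F.drawing.face d).1 = W.G.next E := by
  have h1 : W.G.head d.1 ≠ W.G.head E := by
    rw [h, head_rev, tail_next_inv]; exact F.suppressible.tail_E
  rw [Suppressible.face_val, F.suppressible.newRev_of_head_ne h1, h, W.G.rev_rev,
    Suppressible.newNext_of_eq (next_next_inv E)]

theorem head_next_ne : W.G.head (W.G.next E) ≠ W.G.head E := F.tail_q ▸ F.suppressible.tail_q

theorem face_next_val {d : F.drawing.D} (h : d.1 = W.G.next E) :
    (F.drawing.face d).1 = qD := by
  rw [Suppressible.face_val, F.suppressible.newRev_of_head_ne (h ▸ F.head_next_ne), h,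
    Suppressible.newNext_of_tail_ne]
  · rw [← rev_next_rev_next F.spoke, W.G.rev_rev]
  · intro h
    exact F.spoke.not_isRim (h ▸ F.rim_next)

theorem face_val_of_ne {d : F.drawing.D} (h1 : d.1 ≠ pD) (h2 : d.1 ≠ qD)
    (h3 : d.1 ≠ W.G.rev (W.G.next⁻¹ E)) : (F.drawing.face d).1 = W.G.face d.1 := by
  rw [Suppressible.face_val, Suppressible.newRev_of_ne h1 h2, Suppressible.newNext_of_ne]
  · rfl
  · exact (F.suppressible.rev_mem d.2.1 d.2.2 h1 h2).2
  · intro h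
    have h4 := congrArg (fun d => W.G.next⁻¹ d) h
    rw [next_inv_next] at h4
    exact h3 (by rw [← h4, W.G.rev_rev])

/-- Deleting the edge of `E` merges its two triangles into a quadrilateral, and suppressing its end
makes this a triangle again, with darts `T`. Finite regions outside `T` are unchanged. -/
theorem triangle {d : F.drawing.D} (hd : d ∉ F.drawing.outer) :
    F.drawing.face (F.drawing.face (F.drawing.face d)) = d := by
  let T : F.drawing.D → Prop := fun d => d.1 = qD ∨ d.1 = W.G.rev (W.G.next⁻¹ E) ∨ d.1 = W.G.next E
  have tri : ∀ d, T d → F.drawing.face (F.drawing.face (F.drawing.face d)) = d := by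
    rintro d (h | h | h)
    · exact Subtype.ext ((F.face_next_val (F.face_prev_val (F.face_q_val h))).trans h.symm)
    · exact Subtype.ext ((F.face_q_val (F.face_next_val (F.face_prev_val h))).trans h.symm)
    · exact Subtype.ext ((F.face_prev_val (F.face_q_val (F.face_next_val h))).trans h.symm)
  have step : ∀ d, T d → T (F.drawing.face d) := by
    rintro d (h | h | h)
    · exact .inr (.inl (F.face_q_val h))
    · exact .inr (.inr (F.face_prev_val h))
    · exact .inl (F.face_next_val h)
  have back : ∀ d, T (F.drawing.face d) → T d := by
    intro d h
    have := tri _ h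
    have := F.drawing.face.injective this
    rw [← this]
    exact step _ (step _ h)
  by_cases hT : T d
  · exact tri d hT
  have val : ∀ d, d ∉ F.drawing.outer → ¬ T d → (F.drawing.face d).1 = W.G.face d.1 := by
    intro d hd hT
    exact F.face_val_of_ne (fun h => hd (show d.1 ∈ W.G.outer from h ▸ F.p_outer))
      (fun h => hT (.inl h)) fun h => hT (.inr (.inl h))
  have out : ∀ d, d ∉ F.drawing.outer → ¬ T d → F.drawing.face d ∉ F.drawing.outer := by
    intro d hd hT h
    have h : (F.drawing.face d).1 ∈ W.G.outer := h
    rw [val d hd hT, W.nearTriangulation.face_mem_outer] at h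
    exact hd h
  have hT1 : ¬ T (F.drawing.face d) := fun h => hT (back _ h)
  have hT2 : ¬ T (F.drawing.face (F.drawing.face d)) := fun h => hT1 (back _ h)
  have hd1 := out _ hd hT
  apply Subtype.ext
  rw [val _ (out _ hd1 hT1) hT2, val _ hd1 hT1, val _ hd hT]
  exact W.nearTriangulation.triangle _ hd

/-- The boundary of the infinite region is the old one without the dart `next⁻¹ (rev E)` at the
removed vertex, which followed the dart of `p`. -/
theorem outer_face {d : F.drawing.D} (hd : d ∈ F.drawing.outer) (e : F.drawing.D) :
    e ∈ F.drawing.outer ↔ F.drawing.face.SameCycle d e := by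
  have hE := F.E_notMem_outer
  have hprev : W.G.rev (W.G.next⁻¹ E) ∉ W.G.outer := notMem_outer_of_head (by
    rw [head_rev, tail_next_inv]; exact F.spoke.not_isRim)
  constructor
  · intro he
    have hd' : d.1 ∈ W.G.outer := hd
    have hpD : W.G.tail pD ≠ W.G.head E ∧ pD ≠ E := ⟨F.suppressible.tail_p, F.suppressible.p_ne_E⟩
    -- Walk along the old boundary. The last clause covers the one removed dart on it, where what is
    -- remembered is that its predecessor was reached.
    have := ((W.nearTriangulation.outer_face _ hd' _).1 he).induction_forward
      (p := fun x => x ∈ W.G.outer ∧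
        (∀ hx : W.G.tail x ≠ W.G.head E ∧ x ≠ E, F.drawing.face.SameCycle d ⟨x, hx⟩) ∧
        (x = W.G.next⁻¹ (W.G.rev E) → F.drawing.face.SameCycle d ⟨pD, hpD⟩))
      ⟨hd', fun _ => .refl _ _, fun h => absurd (by rw [h, tail_next_inv, tail_rev]) d.2.1⟩ ?_
    · exact this.2.1 e.2
    rintro x ⟨h1, h2, h3⟩
    refine ⟨(W.nearTriangulation.face_mem_outer x).2 h1, fun hx => ?_, fun hx => ?_⟩
    · by_cases hxρ : x = W.G.next⁻¹ (W.G.rev E)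
      · refine (h3 hxρ).trans ⟨1, ?_⟩
        apply Subtype.ext
        rw [zpow_one, F.face_p_val rfl, F.face_p]
        exact congrArg _ hxρ.symm
      · have hxD : W.G.tail x ≠ W.G.head E ∧ x ≠ E :=
          ⟨fun h => hxρ (outer_dart_unique F.rho_outer h1 (by rw [h, tail_next_inv, tail_rev])),
            fun h => hE (h ▸ h1)⟩
        refine (h2 hxD).trans ⟨1, ?_⟩
        apply Subtype.ext
        rw [zpow_one, F.face_val_of_ne]
        · rintro (rfl : x = _)
          exact hx.1 (by rw [F.face_p, tail_next_inv, tail_rev])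
        · rintro (rfl : x = _)
          exact F.q_notMem_outer h1
        · rintro (rfl : x = _)
          exact hprev h1
    · obtain rfl : x = pD := W.G.face.injective (hx.trans F.face_p.symm)
      exact h2 hpD
  · intro h
    refine h.induction_forward (p := fun e => e ∈ F.drawing.outer) hd ?_
    intro x hx
    have hx' : x.1 ∈ W.G.outer := hx
    change (F.drawing.face x).1 ∈ W.G.outer
    by_cases h1 : x.1 = pD
    · rw [F.face_p_val h1, W.nearTriangulation.face_mem_outer, W.nearTriangulation.face_mem_outer]
      exact F.p_outer
    · rw [F.face_val_of_ne h1 (fun h => F.q_notMem_outer (h ▸ hx')) (fun h => hprev (h ▸ hx')),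
        W.nearTriangulation.face_mem_outer]
      exact hx'

theorem card_V : Nat.card F.drawing.V + 1 = Nat.card W.G.V := by
  have h1 : Nat.card F.drawing.V = ({W.G.head E}ᶜ : Set W.G.V).ncard := by
    rw [← Nat.card_coe_set_eq]; rfl
  have := Set.ncard_add_ncard_compl {W.G.head E}
  rw [Set.ncard_singleton] at this
  omega

theorem removed_ncard : ({E, W.G.rev E, W.G.rev pD, W.G.rev qD} : Set W.G.D).ncard = 4 := by
  have hrim : ¬ W.IsRim (W.G.tail E) := F.spoke.not_isRim
  have h1 : W.G.tail E ≠ W.G.head E := F.suppressible.tail_E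
  have t1 : ∀ d, W.G.head d = W.G.head E → W.G.tail (W.G.rev d) = W.G.head E := fun d h => h
  have e1 : ∀ d, W.G.head d = W.G.head E → E ≠ W.G.rev d := fun d h h' =>
    h1 ((congrArg W.G.tail h').trans h)
  rw [Set.ncard_insert_of_notMem, Set.ncard_insert_of_notMem, Set.ncard_pair]
  · exact fun h => F.suppressible.p_ne_q (rev_injective h)
  · rintro (h | h)
    · exact F.suppressible.p_ne_E (rev_injective h).symm
    · exact F.suppressible.q_ne_E (rev_injective h).symm
  · rintro (h | h | h)
    · exact e1 _ rfl h
    · exact e1 _ head_p h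
    · exact e1 _ head_q h

theorem mem_removed_iff (d : W.G.D) : d ∈ ({E, W.G.rev E, W.G.rev pD, W.G.rev qD} : Set W.G.D) ↔
    ¬ (W.G.tail d ≠ W.G.head E ∧ d ≠ E) := by
  have := F.suppressible.tail_eq_iff d
  simp only [Set.mem_insert_iff, Set.mem_singleton_iff]
  tauto

theorem card_D : Nat.card F.drawing.D + 4 = Nat.card W.G.D := by
  have h1 : Nat.card F.drawing.D =
      ({E, W.G.rev E, W.G.rev pD, W.G.rev qD}ᶜ : Set W.G.D).ncard := by
    rw [← Nat.card_coe_set_eq]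
    refine Nat.card_congr (Equiv.subtypeEquivRight fun d => ?_)
    rw [Set.mem_compl_iff, F.mem_removed_iff, not_not]
  have := Set.ncard_add_ncard_compl ({E, W.G.rev E, W.G.rev pD, W.G.rev qD} : Set W.G.D)
  rw [F.removed_ncard] at this
  omega

/-- Of the four removed darts, only `rev q` lay on the infinite region. -/
theorem ncard_compl_outer : F.drawing.outerᶜ.ncard + 3 = W.G.outerᶜ.ncard := by
  rw [← Set.ncard_image_of_injective _ Subtype.val_injective]
  have h4 := F.removed_ncard
  have hρ : W.G.rev qD ∈ W.G.outer := by rw [W.G.rev_rev]; exact F.rho_outer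
  have h3 : ({E, W.G.rev E, W.G.rev pD} : Set W.G.D).ncard = 3 := by
    have h5 : ({E, W.G.rev E, W.G.rev pD, W.G.rev qD} : Set W.G.D) =
        insert (W.G.rev qD) {E, W.G.rev E, W.G.rev pD} := by
      ext; simp only [Set.mem_insert_iff, Set.mem_singleton_iff]; tauto
    have h6 := Set.ncard_insert_le (W.G.rev qD) ({E, W.G.rev E, W.G.rev pD} : Set W.G.D)
    have h7 := Set.ncard_insert_le E ({W.G.rev E, W.G.rev pD} : Set W.G.D)
    have h8 := Set.ncard_pair_le (W.G.rev E) (W.G.rev pD)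
    rw [← h5] at h6
    omega
  have hsub : ({E, W.G.rev E, W.G.rev pD} : Set W.G.D) ⊆ W.G.outerᶜ := by
    rintro d (rfl | rfl | rfl)
    · exact F.E_notMem_outer
    · exact rev_notMem_outer_of_tail F.spoke.not_isRim
    · exact rev_notMem_outer F.p_outer
  rw [← Set.ncard_sdiff_add_ncard_of_subset hsub, h3]
  congr 2
  ext d
  have hm := F.mem_removed_iff d
  simp only [Set.mem_insert_iff, Set.mem_singleton_iff] at hm
  constructor
  · rintro ⟨d, hd, rfl⟩
    refine ⟨hd, fun h => hm.1 ?_ d.2⟩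
    rcases h with h | h | h
    · exact .inl h
    · exact .inr (.inl h)
    · exact .inr (.inr (.inl h))
  · rintro ⟨hd, h⟩
    by_cases h' : W.G.tail d ≠ W.G.head E ∧ d ≠ E
    · exact ⟨⟨d, h'⟩, hd, rfl⟩
    · exfalso
      rcases hm.2 h' with h'' | h'' | h'' | h''
      · exact h (.inl h'')
      · exact h (.inr (.inl h''))
      · exact h (.inr (.inr h''))
      · exact hd (h'' ▸ hρ)

/-! ### Adjacency and connectivity after the removal -/

/-- The vertex of the rim that precedes the removed vertex. -/
noncomputable abbrev left : F.drawing.V := ⟨W.G.tail pD, F.suppressible.tail_p⟩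

/-- The fan vertex that follows the removed vertex. -/
noncomputable abbrev right : F.drawing.V := ⟨W.G.tail qD, F.suppressible.tail_q⟩

/-- The spoke. -/
noncomputable abbrev base : F.drawing.V := ⟨W.G.tail E, F.suppressible.tail_E⟩

theorem adj_left_right : F.drawing.graph.Adj F.left F.right :=
  F.suppressible.adj_p_q F.tail_p_ne_tail_q

theorem adj_right_base : F.drawing.graph.Adj F.right F.base := by
  refine F.suppressible.adj_of_adj (a := F.right) (b := F.base) ?_
  have h := W.nearTriangulation.adj (W.G.next E)
  rw [tail_next, ← F.tail_q] at h
  exact h.symm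

theorem adj_left_base : F.drawing.graph.Adj F.left F.base := by
  refine F.suppressible.adj_of_adj (a := F.left) (b := F.base) ?_
  have h := W.nearTriangulation.adj (W.G.next⁻¹ E)
  rw [tail_next_inv, ← F.tail_p] at h
  exact h.symm

theorem adj_removed {b : W.G.V} (h : W.G.graph.Adj (W.G.head E) b) :
    b = W.G.tail E ∨ b = W.G.tail pD ∨ b = W.G.tail qD := by
  obtain ⟨-, d, h1, rfl⟩ := h
  rcases (F.suppressible.tail_eq_iff d).1 h1 with rfl | rfl | rfl
  · exact .inl (head_rev _)
  · exact .inr (.inl (head_rev _))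
  · exact .inr (.inr (head_rev _))

/-- Contracting the removed vertex to one of its neighbours on the rim preserves connectivity. -/
theorem exists_contraction (A : Set W.G.V) (A' : Set F.drawing.V) (hA : ∀ v, v ∈ A' ↔ v.1 ∈ A)
    (t : F.drawing.V) (ht : t = F.left ∨ t = F.right) (htA : W.G.head E ∈ A → t ∈ A') :
    ∃ f : A → A', Function.Surjective f ∧ ∀ a b, (W.G.graph.induce A).Adj a b →
      (F.drawing.graph.induce A').Reachable (f a) (f b) := by
  classical
  let g : W.G.V → F.drawing.V := fun v => if h : v = W.G.head E then t else ⟨v, h⟩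
  have gx : g (W.G.head E) = t := dif_pos rfl
  have gv : ∀ v (h : v ≠ W.G.head E), g v = ⟨v, h⟩ := fun v h => dif_neg h
  have hg : ∀ v ∈ A, g v ∈ A' := by
    intro v hv
    by_cases h : v = W.G.head E
    · subst h; rw [gx]; exact htA hv
    · rw [gv v h]; exact (hA _).2 hv
  have key : ∀ b, W.G.graph.Adj (W.G.head E) b → g b = t ∨ F.drawing.graph.Adj t (g b) := by
    intro b hb
    rw [gv b hb.ne']
    rcases F.adj_removed hb with h | h | h
    · right
      rcases ht with rfl | rfl
      · convert F.adj_left_base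
      · convert F.adj_right_base
    · rcases ht with rfl | rfl
      · left; exact Subtype.ext h
      · right; convert F.adj_left_right.symm
    · rcases ht with rfl | rfl
      · right; convert F.adj_left_right
      · left; exact Subtype.ext h
  have adj : ∀ a b, W.G.graph.Adj a b → g a = g b ∨ F.drawing.graph.Adj (g a) (g b) := by
    intro a b h
    by_cases ha : a = W.G.head E
    · subst ha
      rw [gx]
      exact (key b h).imp Eq.symm id
    by_cases hb : b = W.G.head E
    · subst hb
      rw [gx]
      exact (key a h.symm).imp id SimpleGraph.Adj.symm
    · rw [gv a ha, gv b hb]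
      exact .inr (F.suppressible.adj_of_adj (a := ⟨a, ha⟩) (b := ⟨b, hb⟩) h)
  refine ⟨fun a => ⟨g a.1, hg _ a.2⟩, ?_, ?_⟩
  · rintro ⟨v, hv⟩
    exact ⟨⟨v.1, (hA v).1 hv⟩, Subtype.ext (gv v.1 v.2)⟩
  · rintro ⟨a, ha⟩ ⟨b, hb⟩ hab
    rcases adj a b hab with h | h
    · have : (⟨g a, hg a ha⟩ : A') = ⟨g b, hg b hb⟩ := Subtype.ext h
      dsimp only
      rw [this]
    · exact SimpleGraph.Adj.reachable
        (show (F.drawing.graph.induce A').Adj ⟨g a, hg a ha⟩ ⟨g b, hg b hb⟩ from h)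

/-- Every spoke keeps its edge to the hub, and every remaining vertex of the rim keeps its edges to
spokes. -/
theorem connected : F.drawing.graph.Connected := by
  have hhub : W.hub ≠ W.G.head E := fun h => not_isRim_hub (h ▸ F.rim)
  have : Nonempty F.drawing.V := ⟨F.base⟩
  suffices h : ∀ v, F.drawing.graph.Reachable v ⟨W.hub, hhub⟩ from
    ⟨fun a b => (h a).trans (h b).symm⟩
  have spoke : ∀ v : F.drawing.V, W.IsSpoke v.1 → F.drawing.graph.Reachable v ⟨W.hub, hhub⟩ :=
    fun v hv => (F.suppressible.adj_of_adj (a := v) (b := ⟨W.hub, hhub⟩) hv.symm).reachable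
  intro v
  rcases vertex_cases v.1 with h | h | h
  · rw [show v = ⟨W.hub, hhub⟩ from Subtype.ext h]
  · exact spoke v h
  · obtain ⟨u, hu, huv⟩ := exists_adj_isSpoke h
    have hux : u ≠ W.G.head E := fun h => hu.not_isRim (h ▸ F.rim)
    exact (F.suppressible.adj_of_adj (a := v) (b := ⟨u, hux⟩) huv).reachable.trans
      (spoke ⟨u, hux⟩ hu)

/-- Contract the removed vertex to `left` or `right`, whichever is not the vertex `v` being deleted.
-/
theorem numComponentsDelete_le (v : F.drawing.V) :
    F.drawing.numComponentsDelete v ≤ W.G.numComponentsDelete v.1 := by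
  have hA : ∀ w : F.drawing.V, w ∈ ({v}ᶜ : Set F.drawing.V) ↔ w.1 ∈ ({v.1}ᶜ : Set W.G.V) :=
    fun w => not_congr Subtype.ext_iff
  have : ∃ t, (t = F.left ∨ t = F.right) ∧ t ∈ ({v}ᶜ : Set F.drawing.V) := by
    by_cases h : v = F.left
    · exact ⟨F.right, .inr rfl, fun h' : F.right = v =>
        F.tail_p_ne_tail_q (congrArg Subtype.val (h.symm.trans h'.symm))⟩
    · exact ⟨F.left, .inl rfl, fun h' : F.left = v => h h'.symm⟩
  obtain ⟨t, ht, htv⟩ := this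
  obtain ⟨f, hf, hadj⟩ := F.exists_contraction {v.1}ᶜ {v}ᶜ hA t ht fun _ => htv
  exact SimpleGraph.card_connectedComponent_le_of_weak_hom f hf hadj

/-- Only the darts `p` and `q` get another head, and both the old and the new one are on the rim. So
the type of the head never changes. -/
theorem head_cases (d : F.drawing.D) : (F.drawing.head d).1 = W.G.head d.1 ∨
    (W.IsRim (W.G.tail d.1) ∧ W.IsRim (W.G.head d.1) ∧ W.IsRim (F.drawing.head d).1) := by
  by_cases h1 : d.1 = pD
  · right
    rw [Suppressible.head_val, h1, Suppressible.newRev_p]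
    exact ⟨F.rim_tail_p, (head_p (E := E)).symm ▸ F.rim, F.rim_tail_q⟩
  by_cases h2 : d.1 = qD
  · right
    rw [Suppressible.head_val, h2, F.suppressible.newRev_q]
    exact ⟨F.rim_tail_q, (head_q (E := E)).symm ▸ F.rim, F.rim_tail_p⟩
  exact .inl (F.suppressible.head_val_of_ne h1 h2)

theorem isRim_head_val_iff (d : F.drawing.D) :
    W.IsRim (F.drawing.head d).1 ↔ W.IsRim (W.G.head d.1) := by
  rcases F.head_cases d with h | ⟨-, h1, h2⟩
  · rw [h]
  · simp [h1, h2]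

theorem isSpoke_head_val_iff (d : F.drawing.D) :
    W.IsSpoke (F.drawing.head d).1 ↔ W.IsSpoke (W.G.head d.1) := by
  rcases F.head_cases d with h | ⟨-, h1, h2⟩
  · rw [h]
  · exact ⟨fun h => absurd h h2.2, fun h => absurd h h1.2⟩

theorem loopless (d : F.drawing.D) : F.drawing.head d ≠ F.drawing.tail d := by
  intro h
  have h := congrArg Subtype.val h
  rw [Suppressible.head_val, Suppressible.tail_val] at h
  by_cases h1 : d.1 = pD
  · rw [h1, Suppressible.newRev_p] at h
    exact F.tail_p_ne_tail_q h.symm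
  by_cases h2 : d.1 = qD
  · rw [h2, F.suppressible.newRev_q] at h
    exact F.tail_p_ne_tail_q h
  rw [Suppressible.newRev_of_ne h1 h2] at h
  exact Cartwheel.loopless _ h

theorem outer_nonempty : F.drawing.outer.Nonempty :=
  ⟨⟨pD, F.suppressible.tail_p, F.suppressible.p_ne_E⟩, F.p_outer⟩

theorem nearTriangulation : F.drawing.IsNearTriangulation where
  loopless := F.loopless
  connected := F.connected
  outer_nonempty _ := F.outer_nonempty
  outer_face _ hd := F.outer_face hd
  triangle _ hd := F.triangle hd
  -- There is one vertex less, four darts less, and three darts less off the infinite region, hence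
  -- one region less.
  euler := by
    have h1 := W.nearTriangulation.euler
    have h2 := W.nearTriangulation.three_mul_numFaces ⟨_, F.p_outer⟩
    have h3 : 3 * F.drawing.numFaces = F.drawing.outerᶜ.ncard + 3 := by
      obtain ⟨d, hd⟩ := F.outer_nonempty
      have key := card_cycles_of_triangles F.drawing.face F.drawing.outer d hd
        (fun _ hd => F.outer_face hd) (fun _ hd => F.triangle hd)
        fun d _ h => F.loopless d (by rw [← tail_face, h])
      have : 0 < Nat.card (Quotient (Equiv.Perm.SameCycle.setoid F.drawing.face)) := by omega
      rw [numFaces, max_eq_right this, key]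
    have h4 := F.ncard_compl_outer
    have h5 := F.card_V
    have h6 := F.card_D
    omega

theorem onOuter_iff (v : F.drawing.V) : F.drawing.OnOuter v ↔ W.IsRim v.1 := by
  constructor
  · rintro (⟨d, hd, rfl⟩ | h)
    · exact (isRim_of_outer hd).1
    · have : Nontrivial F.drawing.V :=
        ⟨F.left, F.right, fun h => F.tail_p_ne_tail_q (congrArg Subtype.val h)⟩
      obtain ⟨w, -, d, hd, -⟩ := F.connected.preconnected.exists_adj_of_nontrivial v
      exact absurd hd (h d)
  · intro h
    obtain ⟨d, hd, hd'⟩ := exists_outer_dart h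
    exact .inl ⟨⟨d, fun h => v.2 (hd'.symm.trans h), fun h => F.E_notMem_outer (h ▸ hd)⟩, hd,
      Subtype.ext hd'⟩

/-! ### The configuration and the cartwheel after the removal -/

open Classical in
/-- The new map `γ`: the spoke has lost an edge, and the fan vertex that follows the removed one
is given a value that keeps the good configurations away. -/
noncomputable def newγ (v : F.drawing.V) : ℕ :=
  -- The value 12 is just above what good configurations contain, and it exceeds the degree, at most
  -- four, by enough to give ring-size two.
  if v = F.base then W.γ v.1 - 1 else if v = F.right then 12 else W.γ v.1

theorem base_ne_right : F.base ≠ F.right := fun h =>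
  F.spoke.not_isRim (by
    have h : W.G.tail E = W.G.tail qD := congrArg Subtype.val h
    exact h ▸ F.rim_tail_q)

theorem newγ_base : F.newγ F.base = W.γ (W.G.tail E) - 1 := by simp [newγ]

theorem newγ_right : F.newγ F.right = 12 := by simp [newγ, F.base_ne_right.symm]

theorem newγ_of_ne {v : F.drawing.V} (h1 : v ≠ F.base) (h2 : v ≠ F.right) :
    F.newγ v = W.γ v.1 := by simp [newγ, h1, h2]

theorem thirteen_le : 13 ≤ W.γ (W.G.tail E) := by
  rw [gamma_eq_degree F.spoke.not_isRim]; exact F.degree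

theorem degree_base : F.drawing.degree F.base + 1 = W.G.degree (W.G.tail E) :=
  F.suppressible.degree_tail_E rfl

theorem degree_of_ne {v : F.drawing.V} (h : v ≠ F.base) :
    F.drawing.degree v = W.G.degree v.1 :=
  F.suppressible.degree_of_ne fun h' => h (Subtype.ext h')

theorem gamma_outer (v : F.drawing.V) (hv : F.drawing.OnOuter v) :
    F.drawing.degree v < F.newγ v := by
  rw [F.onOuter_iff] at hv
  have h1 : v ≠ F.base := by rintro rfl; exact F.spoke.not_isRim hv
  rw [F.degree_of_ne h1]
  by_cases h2 : v = F.right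
  · have := degree_le_four hv
    rw [h2, F.newγ_right, ← h2]; omega
  · rw [F.newγ_of_ne h1 h2]
    exact W.gamma_outer _ ((Cartwheel.onOuter_iff _).2 hv)

/-- The configuration without the fan vertex. -/
noncomputable def configuration : Configuration where
  G := F.drawing
  γ := F.newγ
  nearTriangulation := F.nearTriangulation
  components_le v := (F.numComponentsDelete_le v).trans (W.components_le _)
  -- There are no cut vertices: one would be a cut vertex of `W`, hence off the rim, where `γ` is
  -- the degree and not the degree plus two.
  gamma_cut v hv := by
    have h2 := F.numComponentsDelete_le v
    have h3 := W.components_le v.1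
    have h4 := W.gamma_cut v.1 (by omega)
    have h5 : ¬ W.IsRim v.1 := fun h => by
      have := Cartwheel.numComponentsDelete_le_one h
      omega
    exact absurd h4 (by rw [gamma_eq_degree h5]; omega)
  gamma_inner v hv := by
    rw [F.onOuter_iff] at hv
    by_cases h1 : v = F.base
    · subst h1
      have := F.degree_base
      rw [F.newγ_base, gamma_eq_degree hv]
      dsimp only
      omega
    · have h2 : v ≠ F.right := by rintro rfl; exact hv F.rim_tail_q
      rw [F.newγ_of_ne h1 h2, F.degree_of_ne h1, gamma_eq_degree hv]
  gamma_outer := F.gamma_outer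
  five_le v := by
    by_cases h1 : v = F.base
    · have := F.thirteen_le
      rw [h1, F.newγ_base]; omega
    by_cases h2 : v = F.right
    · rw [h2, F.newγ_right]; norm_num
    · rw [F.newγ_of_ne h1 h2]; exact W.five_le _
  two_le_ring := by
    refine two_le_ring_of_exists _ _ F.gamma_outer (v₀ := F.right)
      ((F.onOuter_iff _).2 F.rim_tail_q)
      ((F.numComponentsDelete_le _).trans (Cartwheel.numComponentsDelete_le_one F.rim_tail_q)) ?_
    have := degree_le_four F.rim_tail_q
    rw [F.newγ_right, F.degree_of_ne F.base_ne_right.symm]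
    dsimp only
    omega

theorem hub_ne : W.hub ≠ W.G.head E := fun h => not_isRim_hub (h ▸ F.rim)

theorem adj_cases {a b : F.drawing.V} (h : F.drawing.graph.Adj a b) :
    W.G.graph.Adj a.1 b.1 ∨ (W.IsRim a.1 ∧ W.IsRim b.1) := by
  rcases F.suppressible.adj_cases h with h | ⟨h1, h2⟩ | ⟨h1, h2⟩
  · exact .inl h
  · exact .inr ⟨h1 ▸ F.rim_tail_p, h2 ▸ F.rim_tail_q⟩
  · exact .inr ⟨h1 ▸ F.rim_tail_q, h2 ▸ F.rim_tail_p⟩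

theorem adj_hub_iff (v : F.drawing.V) :
    F.drawing.graph.Adj ⟨W.hub, F.hub_ne⟩ v ↔ W.IsSpoke v.1 := by
  constructor
  · intro h
    rcases F.adj_cases h with h | ⟨h, -⟩
    · exact h
    · exact absurd h not_isRim_hub
  · intro h
    exact F.suppressible.adj_of_adj (a := ⟨W.hub, F.hub_ne⟩) h

/-- Connectivity survives the contraction of the removed vertex. The degrees survive because no dart
changes whether its head lies in `A`, and `E` is not an edge inside `A`. -/
theorem isInducedCircuit (A : Set W.G.V) (A' : Set F.drawing.V) (hA : ∀ v, v ∈ A' ↔ v.1 ∈ A)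
    (t : F.drawing.V) (ht : t = F.left ∨ t = F.right) (htA : W.G.head E ∈ A → t ∈ A')
    (hE : W.G.tail E ∈ A → W.G.head E ∉ A)
    (hhead : ∀ d : F.drawing.D, (F.drawing.head d).1 ∈ A ↔ W.G.head d.1 ∈ A)
    (h : IsInducedCircuit A) : IsInducedCircuit A' := by
  obtain ⟨h1, h2⟩ := h
  obtain ⟨f, hf, hadj⟩ := F.exists_contraction A A' hA t ht htA
  refine ⟨h1.of_weak_hom f hf hadj, fun v hv => ?_⟩
  rw [← h2 v.1 ((hA v).1 hv), ← Set.ncard_image_of_injective _ Subtype.val_injective]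
  congr 1
  ext d
  constructor
  · rintro ⟨d, ⟨hd, hd'⟩, rfl⟩
    exact ⟨congrArg Subtype.val hd, (hhead d).1 ((hA _).1 hd')⟩
  · rintro ⟨hd, hd'⟩
    have hdE : d ≠ E := by
      rintro rfl
      exact hE (hd ▸ (hA v).1 hv) hd'
    let d' : F.drawing.D := ⟨d, fun h => v.2 (hd.symm.trans h), hdE⟩
    exact ⟨d', ⟨Subtype.ext hd, (hA _).2 ((hhead d').2 hd')⟩, rfl⟩

/-- The cartwheel without the fan vertex. -/
noncomputable def cartwheel : Cartwheel where
  toConfiguration := F.configuration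
  hub := ⟨W.hub, F.hub_ne⟩
  circuits := by
    refine ⟨{v | W.IsSpoke v.1}, {v | W.IsRim v.1}, not_isSpoke_hub, not_isRim_hub, ?_, ?_, ?_, ?_,
      ?_, ?_, ?_⟩
    · exact Set.disjoint_left.2 fun v h1 h2 => h2.2 h1
    · ext v
      refine ⟨fun _ => trivial, fun _ => ?_⟩
      rcases vertex_cases v.1 with h | h | h
      · exact .inl (.inl (Subtype.ext h))
      · exact .inl (.inr h)
      · exact .inr h
    · exact F.isInducedCircuit {v | W.IsSpoke v} _ (fun v => Iff.rfl) F.left (.inl rfl)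
        (fun h => absurd F.rim (IsSpoke.not_isRim h)) (fun _ h => IsSpoke.not_isRim h F.rim)
        F.isSpoke_head_val_iff W.circuits_eq.1
    · exact F.isInducedCircuit {v | W.IsRim v} _ (fun v => Iff.rfl) F.left (.inl rfl)
        (fun _ => F.rim_tail_p) (fun h => absurd h F.spoke.not_isRim)
        F.isRim_head_val_iff W.circuits_eq.2.1
    · intro (d : F.drawing.D)
      change (d.1 ∈ W.G.outer ∨ (F.drawing.rev d).1 ∈ W.G.outer) ↔
        W.IsRim (W.G.tail d.1) ∧ W.IsRim (F.drawing.head d).1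
      rw [F.isRim_head_val_iff, ← outer_or_rev_outer_iff, Suppressible.rev_val]
      have hp := F.p_outer
      by_cases h1 : d.1 = pD
      · simp [h1, hp]
      by_cases h2 : d.1 = qD
      · rw [h2, F.suppressible.newRev_q, W.G.rev_rev]
        exact ⟨fun _ => .inr F.rho_outer, fun _ => .inr hp⟩
      rw [Suppressible.newRev_of_ne h1 h2]
    · exact fun v h => (F.adj_hub_iff v).2 h
    · exact fun v h h' => h.2 ((F.adj_hub_iff v).1 h')

theorem isSpoke_cartwheel_iff (v : F.drawing.V) : F.cartwheel.IsSpoke v ↔ W.IsSpoke v.1 :=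
  F.adj_hub_iff v

/-- This makes passes at the new hub avoid `right`, so that they can be carried back to `W`. -/
theorem right_fan : F.cartwheel.IsFanOver F.right F.base := by
  obtain ⟨h1, h2, h3⟩ := F.next_fan
  rw [← F.tail_q] at h1 h2 h3
  refine ⟨fun h => h1 (congrArg Subtype.val h), fun h => h2 ((F.isSpoke_cartwheel_iff _).1 h),
    fun (u : F.drawing.V) => ?_⟩
  change (F.cartwheel.IsSpoke u ∧ F.drawing.graph.Adj F.right u) ↔ u = F.base
  rw [F.isSpoke_cartwheel_iff]
  constructor
  · rintro ⟨h4, h5⟩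
    rcases F.adj_cases h5 with h | ⟨-, h⟩
    · exact Subtype.ext ((h3 u.1).1 ⟨h4, h⟩)
    · exact absurd h h4.not_isRim
  · rintro rfl
    exact ⟨F.spoke, F.adj_right_base⟩

theorem card_cartwheel_lt : Nat.card F.cartwheel.G.V < Nat.card W.G.V := by
  have := F.card_V
  change Nat.card F.drawing.V < _
  omega

theorem gamma_hub : F.cartwheel.γ F.cartwheel.hub = W.γ W.hub := by
  refine F.newγ_of_ne ?_ ?_
  · intro h
    exact F.spoke.ne_hub (congrArg Subtype.val h).symm
  · intro h
    have h : W.hub = W.G.tail qD := congrArg Subtype.val h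
    exact not_isRim_hub (h ▸ F.rim_tail_q)

/-- Good configurations in the new cartwheel appear in the old one. -/
theorem appearsIn {K : Configuration} (hK : ∀ v, K.γ v ≤ 11)
    (h : K.AppearsIn F.cartwheel.toConfiguration) : K.AppearsIn W.toConfiguration := by
  obtain ⟨a⟩ := h
  -- All values of `K` are at most 11, so it avoids `right`, and with it the merged edge. It also
  -- avoids `base`, whose new value is at least 12.
  have hq : F.right ∉ Set.range a.f.v := by
    rintro ⟨v, hv⟩
    have h1 := hK v
    rw [← a.gamma, hv] at h1
    have h2 : F.cartwheel.γ F.right = 12 := F.newγ_right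
    omega
  refine ⟨⟨F.suppressible.ofEmb a.f hq F.tail_q.symm,
    F.suppressible.ofEmb_isInduced a.f hq _ a.induced, fun v => ?_⟩⟩
  rw [← a.gamma]
  refine (F.newγ_of_ne ?_ fun h => hq ⟨v, h⟩).symm
  intro h
  have h1 := hK v
  rw [← a.gamma] at h1
  have h2 : F.cartwheel.γ (a.f.v v) = W.γ (W.G.tail E) - 1 := by
    rw [show a.f.v v = F.base from h]; exact F.newγ_base
  have := F.thirteen_le
  omega

/-- The spoke has value at least 13 before and at least 12 after the removal. In both cartwheels the
passes at the hub therefore avoid the fan over it. The spoke itself is the only altered vertex that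
they can contain, and both its values are at least 12. -/
theorem N_eq (𝓡 : Set Rule) (hβ : ∀ R ∈ 𝓡, ∀ v, R.β v ≤ 12)
    (hδ : ∀ R ∈ 𝓡, ∀ v, R.δ v = 5 ∨ R.δ v = 6 ∨ R.δ v = 7 ∨ R.δ v = 8 ∨ R.δ v = ⊤) :
    F.cartwheel.N 𝓡 = W.N 𝓡 := by
  have h13 := F.thirteen_le
  refine N_eq_of_passes 𝓡 (W := W) (W' := F.cartwheel) Subtype.val Subtype.val_injective rfl
    F.gamma_hub hβ hδ ?_ ?_
  · intro P R hR a hub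
    have hE : W.G.head E ∉ Set.range a.f.v := hR.fan_notMem a hub F.middle_fan (by omega)
    have hq : W.G.tail qD ∉ Set.range a.f.v := by
      rw [F.tail_q]; exact hR.fan_notMem a hub F.next_fan (by omega)
    refine ⟨F.suppressible.embOfAvoid a.f hE,
      F.suppressible.embOfAvoid_isInduced a.f hE hq a.induced, fun v => ⟨rfl, ?_⟩⟩
    have hx : a.f.v v ≠ W.G.head E := fun h => hE ⟨v, h⟩
    change F.newγ ⟨a.f.v v, hx⟩ = P.K.γ v ∨ (_ ∧ _ ∧ 12 ≤ F.newγ ⟨a.f.v v, hx⟩)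
    by_cases hv : a.f.v v = W.G.tail E
    · right
      have h1 : F.newγ ⟨a.f.v v, hx⟩ = W.γ (W.G.tail E) - 1 := by
        rw [← F.newγ_base]; congr 1; exact Subtype.ext hv
      refine ⟨hv ▸ F.spoke.ne_hub, ?_, ?_⟩
      · rw [← a.gamma, hv]; omega
      · omega
    · left
      rw [F.newγ_of_ne (fun h => hv (congrArg Subtype.val h))
        (fun h => hq ⟨v, congrArg Subtype.val h⟩)]
      exact a.gamma v
  · intro P R hR a hub
    have hbase : F.cartwheel.γ F.base = W.γ (W.G.tail E) - 1 := F.newγ_base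
    have hq : F.right ∉ Set.range a.f.v := hR.fan_notMem a hub F.right_fan (by omega)
    refine ⟨F.suppressible.ofEmb a.f hq F.tail_q.symm,
      F.suppressible.ofEmb_isInduced a.f hq _ a.induced, fun v => ⟨rfl, ?_⟩⟩
    change W.γ (a.f.v v).1 = P.K.γ v ∨ (_ ∧ _ ∧ 12 ≤ W.γ (a.f.v v).1)
    by_cases hv : a.f.v v = F.base
    · right
      refine ⟨?_, ?_, ?_⟩
      · intro h
        exact F.spoke.ne_hub (congrArg Subtype.val (hv.symm.trans h))
      · rw [← a.gamma, hv]; omega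
      · rw [hv]; dsimp only; omega
    · left
      rw [← a.gamma]
      exact (F.newγ_of_ne hv fun h => hq ⟨v, h⟩).symm

end FanPair

end Cartwheel

/-! ### Truncating the map `γ` of a cartwheel -/

namespace Cartwheel

open Drawing

variable (W : Cartwheel)

/-- The cartwheel in which `γ` is cut off at `12`, provided that this concerns the rim only. -/
def truncate (h : ∀ v, ¬ W.IsRim v → W.γ v ≤ 12) : Cartwheel where
  G := W.G
  γ v := min (W.γ v) 12
  nearTriangulation := W.nearTriangulation
  components_le := W.components_le
  gamma_cut v hv := by
    have h1 := W.gamma_cut v hv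
    have h2 : ¬ W.IsRim v := fun h => by
      have := numComponentsDelete_le_one h
      omega
    rw [min_eq_left (h v h2), h1]
  gamma_inner v hv := by
    have h2 : ¬ W.IsRim v := by rwa [← onOuter_iff]
    rw [min_eq_left (h v h2)]
    exact W.gamma_inner v hv
  gamma_outer v hv := by
    have h1 := W.gamma_outer v hv
    have h2 := degree_le_four ((onOuter_iff v).1 hv)
    exact lt_min h1 (by omega)
  five_le v := le_min (W.five_le v) (by norm_num)
  two_le_ring := by
    by_cases h' : ∀ v, W.γ v ≤ 12
    · simp only [min_eq_left (h' _)]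
      exact W.two_le_ring
    · obtain ⟨v, hv⟩ := not_forall.1 h'
      have hr : W.IsRim v := by
        by_contra hr
        exact hv (h v hr)
      -- A vertex that is cut off keeps the value 12 and has degree at most four.
      refine two_le_ring_of_exists _ _ (fun v hv => ?_) (v₀ := v) ((onOuter_iff v).2 hr)
        (numComponentsDelete_le_one hr) ?_
      · have h1 := W.gamma_outer v hv
        have h2 := degree_le_four ((onOuter_iff v).1 hv)
        exact lt_min h1 (by omega)
      · have h2 := degree_le_four hr
        omega
  hub := W.hub
  circuits := W.circuits

variable {W} (h : ∀ v, ¬ W.IsRim v → W.γ v ≤ 12)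

theorem appearsIn_of_truncate {K : Configuration} (hK : ∀ v, K.γ v ≤ 11)
    (hT : K.AppearsIn (W.truncate h).toConfiguration) : K.AppearsIn W.toConfiguration := by
  obtain ⟨⟨f, hf, hγ⟩⟩ := hT
  refine ⟨⟨f, hf, fun v => ?_⟩⟩
  have h1 := hγ v
  have h2 := hK v
  change min (W.γ (f.v v)) 12 = K.γ v at h1
  omega

/-- A value changes only from above 12 to 12, and the hub is not affected, so `N_eq_of_passes`
applies with the identity. -/
theorem N_truncate (𝓡 : Set Rule) (hβ : ∀ R ∈ 𝓡, ∀ v, R.β v ≤ 12)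
    (hδ : ∀ R ∈ 𝓡, ∀ v, R.δ v = 5 ∨ R.δ v = 6 ∨ R.δ v = 7 ∨ R.δ v = 8 ∨ R.δ v = ⊤) :
    (W.truncate h).N 𝓡 = W.N 𝓡 := by
  have hhub := h W.hub not_isRim_hub
  refine N_eq_of_passes 𝓡 (W := W) (W' := W.truncate h) id Function.injective_id rfl
    (min_eq_left hhub) hβ hδ ?_ ?_
  · intro P R hR a hub
    refine ⟨a.f, a.induced, fun v => ⟨rfl, ?_⟩⟩
    change min (W.γ (a.f.v v)) 12 = P.K.γ v ∨ (a.f.v v ≠ W.hub ∧ _ ∧ 12 ≤ min (W.γ (a.f.v v)) 12)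
    have h1 := a.gamma v
    by_cases hv : a.f.v v = W.hub
    · left
      rw [hv] at h1 ⊢
      omega
    · by_cases h12 : W.γ (a.f.v v) ≤ 12
      · left; omega
      · exact .inr ⟨hv, by omega, by omega⟩
  · intro P R hR a hub
    refine ⟨a.f, a.induced, fun v => ⟨rfl, ?_⟩⟩
    change W.γ (a.f.v v) = P.K.γ v ∨ (a.f.v v ≠ W.hub ∧ 12 ≤ P.K.γ v ∧ 12 ≤ W.γ (a.f.v v))
    have h1 : min (W.γ (a.f.v v)) 12 = P.K.γ v := a.gamma v
    by_cases hv : a.f.v v = W.hub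
    · left
      rw [hv] at h1 ⊢
      omega
    · by_cases h12 : W.γ (a.f.v v) ≤ 12
      · left; omega
      · exact .inr ⟨hv, by omega, by omega⟩

/-- It suffices to bound `N` on the cartwheels all of whose values are at most `12`. -/
theorem good_or_N_nonpos_of_le_twelve (𝒢 : Set Configuration) (h𝒢 : ∀ K ∈ 𝒢, ∀ v, K.γ v ≤ 11)
    (𝓡 : Set Rule) (hβ : ∀ R ∈ 𝓡, ∀ v, R.β v ≤ 12)
    (hδ : ∀ R ∈ 𝓡, ∀ v, R.δ v = 5 ∨ R.δ v = 6 ∨ R.δ v = 7 ∨ R.δ v = 8 ∨ R.δ v = ⊤)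
    (d : ℕ) (hd : d ≤ 12)
    (H : ∀ W : Cartwheel, W.γ W.hub = d → (∀ v, W.γ v ≤ 12) →
      (∃ K : Configuration, K.IsGood 𝒢 ∧ K.AppearsIn W.toConfiguration) ∨ W.N 𝓡 ≤ 0)
    (W : Cartwheel) (hW : W.γ W.hub = d) :
    (∃ K : Configuration, K.IsGood 𝒢 ∧ K.AppearsIn W.toConfiguration) ∨ W.N 𝓡 ≤ 0 := by
  have good : ∀ K : Configuration, K.IsGood 𝒢 → ∀ v, K.γ v ≤ 11 := by
    rintro K ⟨L, hL, f, hf⟩ v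
    rw [← hf]
    exact h𝒢 L hL _
  induction hn : Nat.card W.G.V using Nat.strong_induction_on generalizing W with
  | _ n ih =>
    -- Each removal leaves a smaller cartwheel with the same hub value. Once no spoke is too large,
    -- only the rim needs truncation, as the hub has value `d ≤ 12`.
    by_cases hs : ∃ u, W.IsSpoke u ∧ 13 ≤ W.γ u
    · obtain ⟨u, hu, h13⟩ := hs
      obtain ⟨E, F⟩ := exists_fanPair hu h13
      have := ih _ (hn ▸ F.card_cartwheel_lt) F.cartwheel (F.gamma_hub.trans hW) rfl
      rw [F.N_eq 𝓡 hβ hδ] at this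
      exact this.imp (fun ⟨K, hK, hKW⟩ => ⟨K, hK, F.appearsIn (good K hK) hKW⟩) id
    · have h : ∀ v, ¬ W.IsRim v → W.γ v ≤ 12 := by
        intro v hv
        rcases vertex_cases v with rfl | h | h
        · omega
        · by_contra h'
          exact hs ⟨v, h, by omega⟩
        · exact absurd h hv
      have := H (W.truncate h) ((min_eq_left (h _ not_isRim_hub)).trans hW)
        fun v => min_le_right _ _
      rw [N_truncate h 𝓡 hβ hδ] at this
      exact this.imp (fun ⟨K, hK, hKW⟩ => ⟨K, hK, appearsIn_of_truncate h (good K hK) hKW⟩) id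

end Cartwheel

/-! ### Existence and injectivity of first returns -/

theorem FirstReturn.exists {α : Type*} [Finite α] (σ : Equiv.Perm α) {S : Set α} {d : α}
    (hd : d ∈ S) : ∃ e ∈ S, FirstReturn σ S d e := by
  classical
  have h : ∃ k, 0 < k ∧ (σ ^ k) d ∈ S :=
    ⟨orderOf σ, orderOf_pos σ, by rw [pow_orderOf_eq_one]; exact hd⟩
  obtain ⟨h1, h2⟩ := Nat.find_spec h
  exact ⟨_, h2, Nat.find h, h1, rfl, fun j hj1 hj2 hj3 => Nat.find_min h hj2 ⟨hj1, hj3⟩⟩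

theorem FirstReturn.injective {α : Type*} {σ : Equiv.Perm α} {S : Set α} {d d' e : α}
    (hd : d ∈ S) (hd' : d' ∈ S) (h : FirstReturn σ S d e) (h' : FirstReturn σ S d' e) :
    d = d' := by
  -- If one return takes fewer steps than the other, the longer walk meets `d ∈ S` after `k' - k`
  -- steps, too early.
  have aux : ∀ {k k' : ℕ} {d d' : α}, d ∈ S → 0 < k → k < k' → (σ ^ k) d = (σ ^ k') d' →
      ¬ ∀ j, 0 < j → j < k' → (σ ^ j) d' ∉ S := by
    intro k k' d d' hd hk0 hk h hj
    refine hj (k' - k) (by omega) (by omega) ?_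
    have : (σ ^ k) ((σ ^ (k' - k)) d') = (σ ^ k) d := by
      rw [← Equiv.Perm.mul_apply, ← pow_add, h]; congr 2; omega
    rw [(σ ^ k).injective this]
    exact hd
  obtain ⟨k, h1, h2, h3⟩ := h
  obtain ⟨k', h1', h2', h3'⟩ := h'
  rcases lt_trichotomy k k' with hk | rfl | hk
  · exact absurd h3' (aux hd h1 hk (h2.trans h2'.symm))
  · exact (σ ^ k).injective (h2.trans h2'.symm)
  · exact absurd h3 (aux hd' h1' hk (h2'.trans h2.symm))

/-! ### The core of a cartwheel -/

/-- The darts that belong to a spoke, in a cartwheel without its fans: from the hub to the spoke and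
back, to the next and to the previous spoke, and to and from the two hats. -/
inductive CoreKind
  | out | inn | nxt | prv | fst | lst | fstRev | lstRev

/-- The vertices of a cartwheel without its fans. -/
inductive CoreVertex (d : ℕ)
  | hub
  | spoke (i : ZMod d)
  | hat (i : ZMod d)

namespace CoreKind

variable {d : ℕ}

/-- The reversal of darts in the core. -/
def rev : CoreKind → ZMod d → CoreKind × ZMod d
  | out, i => (inn, i)
  | inn, i => (out, i)
  | nxt, i => (prv, i - 1)
  | prv, i => (nxt, i + 1)
  | fst, i => (fstRev, i)
  | lst, i => (lstRev, i)
  | fstRev, i => (fst, i)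
  | lstRev, i => (lst, i)

/-- The tail of darts in the core. -/
def tail : CoreKind → ZMod d → CoreVertex d
  | out, _ => .hub
  | inn, i => .spoke i
  | nxt, i => .spoke i
  | prv, i => .spoke i
  | fst, i => .spoke i
  | lst, i => .spoke i
  | fstRev, i => .hat i
  | lstRev, i => .hat (i + 1)

/-- The order of the darts in the core. -/
def next : CoreKind → ZMod d → CoreKind × ZMod d
  | out, i => (out, i + 1)
  | inn, i => (nxt, i)
  | nxt, i => (fst, i)
  | prv, i => (inn, i)
  | fst, i => (lst, i)
  | lst, i => (prv, i)
  | fstRev, i => (lstRev, i - 1)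
  | lstRev, i => (fstRev, i + 1)

/-- The walk around the regions in the core, for the darts that do not lie on its infinite
region. -/
def face : CoreKind → ZMod d → CoreKind × ZMod d
  | out, i => (nxt, i)
  | inn, i => (out, i + 1)
  | nxt, i => (inn, i - 1)
  | prv, i => (fst, i + 1)
  | fst, i => (lstRev, i - 1)
  | lst, i => (lst, i)
  | fstRev, i => (fstRev, i)
  | lstRev, i => (prv, i)

/-- The darts that lie on finite regions of the core. -/
def Inner (k : CoreKind) : Prop := k ≠ lst ∧ k ≠ fstRev

end CoreKind

namespace Cartwheel

open Drawing

variable {W : Cartwheel} {d : ℕ}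

/-- The darts at the hub, numbered in their order. -/
structure IsHubCycle (W : Cartwheel) {d : ℕ} (η : ZMod d → W.G.D) : Prop where
  tail : ∀ i, W.G.tail (η i) = W.hub
  surj : ∀ e, W.G.tail e = W.hub → ∃ i, η i = e
  inj : Function.Injective η
  succ : ∀ i, η (i + 1) = W.G.next (η i)

theorem exists_isHubCycle (W : Cartwheel) [NeZero d] (hd : W.G.degree W.hub = d) :
    ∃ η : ZMod d → W.G.D, W.IsHubCycle η := by
  obtain ⟨h, hh⟩ := exists_dart W.hub
  have it : ∀ k, W.G.next^[k] h = (W.G.next ^ k) h := fun k =>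
    (Equiv.Perm.iterate_eq_pow _ _ ▸ rfl)
  have hper : h ∈ Function.periodicPts W.G.next :=
    Function.mk_mem_periodicPts (orderOf_pos W.G.next) (by
      change W.G.next^[_] h = h
      rw [it, pow_orderOf_eq_one]; rfl)
  have hpos := Function.minimalPeriod_pos_of_mem_periodicPts hper
  have hall : ∀ e, W.G.tail e = W.hub →
      ∃ k < Function.minimalPeriod W.G.next h, W.G.next^[k] h = e := by
    intro e he
    obtain ⟨k, rfl⟩ := exists_next_pow_eq (he.trans hh.symm)
    exact ⟨_, Nat.mod_lt k hpos, by rw [Function.iterate_mod_minimalPeriod_eq, it]⟩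
  -- The iterates of `next` below the minimal period list the darts at the hub without repetition,
  -- so the period is the degree.
  have hm : Function.minimalPeriod W.G.next h = d := by
    rw [← hd, degree]
    have : {e | W.G.tail e = W.hub} =
        (fun k => W.G.next^[k] h) '' (Set.Iio (Function.minimalPeriod W.G.next h)) := by
      ext e
      constructor
      · exact hall e
      · rintro ⟨k, -, rfl⟩
        change W.G.tail (W.G.next^[k] h) = _
        rw [it, tail_next_pow, hh]
    rw [this, Set.InjOn.ncard_image Function.iterate_injOn_Iio_minimalPeriod,
      Set.ncard_eq_toFinset_card']
    simp
  refine ⟨fun i => W.G.next^[i.val] h, ?_, ?_, ?_, ?_⟩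
  · intro i
    rw [it, tail_next_pow, hh]
  · intro e he
    obtain ⟨k, hk, rfl⟩ := hall e he
    exact ⟨(k : ZMod d), by rw [ZMod.val_natCast, Nat.mod_eq_of_lt (hm ▸ hk)]⟩
  · intro i j hij
    exact ZMod.val_injective d (Function.iterate_injOn_Iio_minimalPeriod
      (by rw [hm]; exact ZMod.val_lt i) (by rw [hm]; exact ZMod.val_lt j) hij)
  · intro i
    have h1 : (i + 1).val = (i.val + 1) % Function.minimalPeriod W.G.next h := by
      rw [hm, ZMod.val_add, ZMod.val_one_eq_one_mod, Nat.add_mod_mod]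
    rw [h1, Function.iterate_mod_minimalPeriod_eq, Function.iterate_succ_apply']

/-- The darts of the core. -/
def coreDart (η : ZMod d → W.G.D) : CoreKind × ZMod d → W.G.D
  | (.out, i) => η i
  | (.inn, i) => W.G.rev (η i)
  | (.nxt, i) => W.G.next (W.G.rev (η i))
  | (.prv, i) => W.G.next⁻¹ (W.G.rev (η i))
  | (.fst, i) => W.G.next (W.G.next (W.G.rev (η i)))
  | (.lst, i) => W.G.next⁻¹ (W.G.next⁻¹ (W.G.rev (η i)))
  | (.fstRev, i) => W.G.rev (W.G.next (W.G.next (W.G.rev (η i))))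
  | (.lstRev, i) => W.G.rev (W.G.next⁻¹ (W.G.next⁻¹ (W.G.rev (η i))))

/-- The vertices of the core. -/
def coreVertex (η : ZMod d → W.G.D) : CoreVertex d → W.G.V
  | .hub => W.hub
  | .spoke i => W.G.head (η i)
  | .hat i => W.G.head (W.G.next (W.G.next (W.G.rev (η i))))

/-! #### Hats -/

/-- No three consecutive darts lead to spokes, so the darts before `s` and after `next s` run along
the rim. The rotation at a hat thus reads `d`, `s`, `next s`, `next⁻¹ d`. -/
theorem eq_next_of_isSpoke {d s : W.G.D} (hd : d ∈ W.G.outer) (hs : W.G.tail s = W.G.tail d)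
    (h0 : W.IsSpoke (W.G.head s)) (h1 : W.IsSpoke (W.G.head (W.G.next s))) :
    s = W.G.next d ∧ W.G.next (W.G.next s) = W.G.next⁻¹ d := by
  have hr := (isRim_of_outer hd).1
  have a1 : W.IsRim (W.G.head (W.G.next⁻¹ s)) :=
    (head_isSpoke_or_isRim (by rw [tail_next_inv, hs]; exact hr)).resolve_left
      (not_isSpoke_three (hs ▸ hr) h0 h1)
  have a2 : W.IsRim (W.G.head (W.G.next (W.G.next s))) := by
    refine (head_isSpoke_or_isRim (by rw [tail_next, tail_next, hs]; exact hr)).resolve_left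
      fun h => ?_
    refine not_isSpoke_three (s := W.G.next s) (by rw [tail_next, hs]; exact hr) h1 h ?_
    rwa [next_inv_next]
  constructor
  · rcases eq_of_isRim_head hd (by rw [tail_next_inv, hs]) a1 with h | h
    · rw [← h, next_next_inv]
    · rw [W.G.next⁻¹.injective h] at h0
      exact absurd (isRim_of_outer hd).2 h0.not_isRim
  · rcases eq_of_isRim_head hd (by rw [tail_next, tail_next, hs]) a2 with h | h
    · refine absurd (isRim_head_next_inv hd) ?_
      rw [← h, next_inv_next]
      exact h1.not_isRim
    · exact h

namespace IsHubCycle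

variable {η : ZMod d → W.G.D} (H : W.IsHubCycle η)
include H

theorem next_inv (i : ZMod d) : W.G.next⁻¹ (η i) = η (i - 1) := by
  have := H.succ (i - 1)
  rw [sub_add_cancel] at this
  rw [this, next_inv_next]

theorem exists_eq_head {u : W.G.V} (hu : W.IsSpoke u) : ∃ i, u = W.G.head (η i) := by
  obtain ⟨h, hh, rfl⟩ := exists_hub_dart hu
  obtain ⟨i, rfl⟩ := H.surj h hh
  exact ⟨i, rfl⟩

theorem isSpoke (i : ZMod d) : W.IsSpoke (W.G.head (η i)) := isSpoke_head (H.tail i)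

theorem head_injective {i j : ZMod d} (h : W.G.head (η i) = W.G.head (η j)) : i = j :=
  H.inj (hub_dart_unique (H.tail j) (H.tail i) h)

theorem rev_coreDart (k : CoreKind) (i : ZMod d) :
    W.G.rev (coreDart η (k, i)) = coreDart η (k.rev i) := by
  cases k
  · rfl
  · exact W.G.rev_rev _
  · exact (rev_next_rev_hub (H.tail i)).trans (by rw [H.next_inv]; rfl)
  · exact (rev_next_inv_rev_hub (H.tail i)).trans (by rw [← H.succ]; rfl)
  · rfl
  · rfl
  · exact W.G.rev_rev _
  · exact W.G.rev_rev _

theorem isRim_head_fst (i : ZMod d) :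
    W.IsRim (W.G.head (W.G.next (W.G.next (W.G.rev (η i))))) := by
  have h5 := five_le_degree (H.isSpoke i).not_isRim
  exact isRim_head_next_pow (H.tail i) (k := 2) le_rfl (by omega)

theorem isRim_head_lst (i : ZMod d) :
    W.IsRim (W.G.head (W.G.next⁻¹ (W.G.next⁻¹ (W.G.rev (η i))))) := by
  rw [isRim_head_iff (H.tail i) (by rw [tail_next_inv, tail_next_inv, tail_rev])]
  have hr := tail_rev_hub_not_isRim (H.tail i)
  set r := W.G.rev (η i)
  have key : ∀ k, 0 < k → k < 5 → (W.G.next ^ k) r ≠ r := fun k h1 h2 => next_pow_ne hr h1 h2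
  refine ⟨fun h => key 2 (by norm_num) (by norm_num) ?_,
    fun h => key 3 (by norm_num) (by norm_num) ?_, fun h => key 1 (by norm_num) (by norm_num) ?_⟩
  · change W.G.next (W.G.next r) = r
    conv_lhs => rw [← h, next_next_inv, next_next_inv]
  · change W.G.next (W.G.next (W.G.next r)) = r
    rw [← h, next_next_inv, next_next_inv]
  · change W.G.next r = r
    conv_lhs => rw [← W.G.next⁻¹.injective h, next_next_inv]

/-- The darts at a hat. -/
theorem next_rev_fst (i : ZMod d) : W.G.next (W.G.rev (W.G.next (W.G.next (W.G.rev (η i))))) =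
    W.G.rev (W.G.next⁻¹ (W.G.next⁻¹ (W.G.rev (η (i - 1))))) := by
  have hn : W.G.rev (W.G.next (W.G.rev (η i))) ∉ W.G.outer :=
    rev_notMem_outer_of_tail (by rw [tail_next, tail_rev]; exact (H.isSpoke i).not_isRim)
  have h1 := W.nearTriangulation.rev_third hn
  have h2 : W.G.rev (W.G.next (W.G.rev (η i))) = W.G.next⁻¹ (W.G.rev (η (i - 1))) :=
    H.rev_coreDart .nxt i
  rw [h2] at h1
  rw [← h1, W.G.rev_rev]

theorem head_lst (i : ZMod d) : W.G.head (W.G.next⁻¹ (W.G.next⁻¹ (W.G.rev (η i)))) =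
    W.G.head (W.G.next (W.G.next (W.G.rev (η (i + 1))))) := by
  have h := congrArg W.G.tail (H.next_rev_fst (i + 1))
  rw [add_sub_cancel_right, tail_next, tail_rev, tail_rev] at h
  exact h.symm

theorem tail_coreDart (k : CoreKind) (i : ZMod d) :
    W.G.tail (coreDart η (k, i)) = coreVertex η (k.tail i) := by
  cases k
  · exact H.tail i
  · rfl
  · exact tail_next _
  · exact tail_next_inv _
  · exact (tail_next _).trans (tail_next _)
  · exact (tail_next_inv _).trans (tail_next_inv _)
  · rfl
  · exact H.head_lst i

theorem head_coreDart (k : CoreKind) (i : ZMod d) :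
    W.G.head (coreDart η (k, i)) = coreVertex η ((k.rev i).1.tail (k.rev i).2) := by
  rw [← tail_rev, H.rev_coreDart, ← H.tail_coreDart]

/-- Between its two darts along the rim, a hat has exactly its darts `fstRev i` and `lstRev (i - 1)`
of the core. -/
theorem hat_darts (i : ZMod d) : ∃ d ∈ W.G.outer,
    W.G.next d = W.G.rev (W.G.next (W.G.next (W.G.rev (η i)))) ∧
    W.G.next (W.G.rev (W.G.next⁻¹ (W.G.next⁻¹ (W.G.rev (η (i - 1)))))) = W.G.next⁻¹ d := by
  obtain ⟨d, hd, hd'⟩ := exists_outer_dart (H.isRim_head_fst i)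
  have h1 := eq_next_of_isSpoke (s := W.G.rev (W.G.next (W.G.next (W.G.rev (η i))))) hd hd'.symm
    (by rw [head_rev, tail_next, tail_next]; exact H.isSpoke i)
    (by rw [H.next_rev_fst, head_rev, tail_next_inv, tail_next_inv]; exact H.isSpoke _)
  rw [H.next_rev_fst] at h1
  exact ⟨d, hd, h1.1.symm, h1.2⟩

theorem coreVertex_injective : Function.Injective (coreVertex η) := by
  have a : ∀ i, W.G.head (η i) ≠ W.hub := fun i => (H.isSpoke i).ne_hub
  have b : ∀ i j, W.G.head (W.G.next (W.G.next (W.G.rev (η i)))) ≠ W.G.head (η j) := fun i j h =>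
    (H.isSpoke j).not_isRim (h ▸ H.isRim_head_fst i)
  have c : ∀ i, W.G.head (W.G.next (W.G.next (W.G.rev (η i)))) ≠ W.hub := fun i =>
    (H.isRim_head_fst i).1
  rintro (_ | i | i) (_ | j | j) h
  · rfl
  · exact absurd h.symm (a j)
  · exact absurd h.symm (c j)
  · exact absurd h (a i)
  · rw [H.head_injective h]
  · exact absurd h.symm (b j i)
  · exact absurd h (c i)
  · exact absurd h (b i j)
  · congr 1
    -- The unique outer dart at a hat is followed by the dart `fstRev i`, from which `η i` can be
    -- recovered.
    obtain ⟨d, hd, h1, -⟩ := H.hat_darts i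
    obtain ⟨e, he, h2, -⟩ := H.hat_darts j
    have h3 : W.G.tail e = W.G.tail d := by
      rw [← tail_next, ← tail_next (d := d), h1, h2]
      exact h.symm
    rw [outer_dart_unique hd he h3, h1] at h2
    exact H.inj (rev_injective (W.G.next.injective (W.G.next.injective (rev_injective h2))))

/-- The type of the head separates the dart to the hub, the darts to spokes and the darts to hats.
Within the last two classes, equality would close up the rotation after two or four steps. -/
theorem spoke_coreDart_injective (i : ZMod d) :
    ∀ k l : CoreKind, (k.tail i = .spoke i) → (l.tail i = .spoke i) →
      coreDart η (k, i) = coreDart η (l, i) → k = l := by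
  have hr := tail_rev_hub_not_isRim (H.tail i)
  have hub : ∀ k : CoreKind, (k.tail i = .spoke i) →
      coreDart η (k, i) = W.G.rev (η i) → k = .inn := by
    intro k hk h
    have := congrArg W.G.head h
    rw [head_rev, H.tail, H.head_coreDart] at this
    have := H.coreVertex_injective (a₂ := .hub) this
    cases k <;> simp [CoreKind.rev, CoreKind.tail] at this hk ⊢
  have rims : ∀ k : CoreKind, W.IsRim (W.G.head (coreDart η (k, i))) → (k.tail i = .spoke i) →
      k = .fst ∨ k = .lst := by
    intro k hk hk'
    rw [H.head_coreDart] at hk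
    cases k
    · simp [CoreKind.tail] at hk'
    · exact absurd hk not_isRim_hub
    · exact absurd hk (H.isSpoke _).not_isRim
    · exact absurd hk (H.isSpoke _).not_isRim
    · exact .inl rfl
    · exact .inr rfl
    · simp [CoreKind.tail] at hk'
    · simp [CoreKind.tail] at hk'
  have ne1 : coreDart η (.nxt, i) ≠ coreDart η (.prv, i) := next_rev_ne_next_inv_rev (H.tail i)
  have ne2 : coreDart η (.fst, i) ≠ coreDart η (.lst, i) := by
    intro h
    have h : W.G.next (W.G.next (W.G.rev (η i))) = W.G.next⁻¹ (W.G.next⁻¹ (W.G.rev (η i))) := h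
    refine next_pow_ne hr (k := 4) (by norm_num) (by norm_num) ?_
    change W.G.next (W.G.next (W.G.next (W.G.next (W.G.rev (η i))))) = _
    rw [h, next_next_inv, next_next_inv]
  intro k l hk hl h
  by_cases hrim : W.IsRim (W.G.head (coreDart η (k, i)))
  · rcases rims k hrim hk with rfl | rfl <;> rcases rims l (h ▸ hrim) hl with rfl | rfl
    · rfl
    · exact absurd h ne2
    · exact absurd h.symm ne2
    · rfl
  have hk1 : k ≠ .fst := fun h' => hrim (h' ▸ H.isRim_head_fst i)
  have hk2 : k ≠ .lst := fun h' => hrim (h' ▸ H.isRim_head_lst i)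
  rw [h] at hrim
  have hl1 : l ≠ .fst := fun h' => hrim (h' ▸ H.isRim_head_fst i)
  have hl2 : l ≠ .lst := fun h' => hrim (h' ▸ H.isRim_head_lst i)
  by_cases hki : k = .inn
  · exact hki.trans (hub l hl (by rw [← h, hki]; rfl)).symm
  by_cases hli : l = .inn
  · exact (hub k hk (by rw [h, hli]; rfl)).trans hli.symm
  cases k <;> simp [CoreKind.tail] at hk hk1 hk2 hki <;>
    cases l <;> simp [CoreKind.tail] at hl hl1 hl2 hli ⊢
  · exact ne1 h
  · exact ne1 h.symm

theorem coreDart_injective : Function.Injective (coreDart η) := by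
  rintro ⟨k, i⟩ ⟨l, j⟩ h
  have ht := congrArg W.G.tail h
  rw [H.tail_coreDart, H.tail_coreDart] at ht
  have ht := H.coreVertex_injective ht
  have spoke : ∀ (k l : CoreKind) (i j : ZMod d), k.tail i = .spoke i → l.tail j = .spoke j →
      k.tail i = l.tail j → coreDart η (k, i) = coreDart η (l, j) → (k, i) = (l, j) := by
    intro k l i j hk hl ht h
    rw [hk, hl] at ht
    obtain rfl : i = j := by simpa using ht
    rw [H.spoke_coreDart_injective i k l hk hl h]
  have hrev := congrArg W.G.rev h
  rw [H.rev_coreDart, H.rev_coreDart] at hrev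
  have hh := congrArg W.G.tail hrev
  rw [H.tail_coreDart, H.tail_coreDart] at hh
  have hh := H.coreVertex_injective hh
  by_cases hout : k = .out
  · subst hout
    cases l <;> simp [CoreKind.tail] at ht
    rw [H.inj h]
  by_cases hk : k.tail i = .spoke i
  · refine spoke k l i j hk ?_ ht h
    rw [hk] at ht
    cases l <;> simp [CoreKind.tail] at ht ⊢
  -- The remaining darts start at hats; their reversals start at spokes.
  · have : (k.rev i) = (l.rev j) := by
      refine spoke _ _ _ _ ?_ ?_ hh hrev
      · cases k <;> simp [CoreKind.tail] at hk hout ⊢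
      · cases k <;> simp [CoreKind.tail] at hk hout ht ⊢ <;>
          cases l <;> simp at ht ⊢
    have hinv : ∀ (k : CoreKind) (i : ZMod d), (k.rev i).1.rev (k.rev i).2 = (k, i) := by
      intro k i; cases k <;> simp [CoreKind.rev]
    rw [← hinv k i, this, hinv]

end IsHubCycle

end Cartwheel

/-! ### The core as the cartwheel without its fans -/

namespace Cartwheel

open Drawing

variable {W : Cartwheel} {d : ℕ}

namespace IsHubCycle

variable {η : ZMod d → W.G.D} (H : W.IsHubCycle η)
include H

theorem isRim_coreVertex_iff (v : CoreVertex d) : W.IsRim (coreVertex η v) ↔ ∃ i, v = .hat i := by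
  cases v with
  | hub => simp [coreVertex, not_isRim_hub]
  | spoke i => simp [coreVertex, (H.isSpoke i).not_isRim]
  | hat i => simp [coreVertex, H.isRim_head_fst i]

/-- The core contains no edge of the rim, hence no dart of the infinite region of `W`. -/
theorem not_rim_rim (x : CoreKind × ZMod d) :
    ¬ (W.IsRim (W.G.tail (coreDart η x)) ∧ W.IsRim (W.G.head (coreDart η x))) := by
  obtain ⟨k, i⟩ := x
  rw [H.tail_coreDart, H.head_coreDart, H.isRim_coreVertex_iff, H.isRim_coreVertex_iff]
  cases k <;> simp [CoreKind.tail, CoreKind.rev]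

theorem notMem_range_of_rim_rim {e : W.G.D} (h1 : W.IsRim (W.G.tail e))
    (h2 : W.IsRim (W.G.head e)) : e ∉ Set.range (coreDart η) := by
  rintro ⟨x, rfl⟩
  exact H.not_rim_rim x ⟨h1, h2⟩

/-- The order of the darts in the core is inherited from the cartwheel. -/
theorem firstReturn_coreDart (k : CoreKind) (i : ZMod d) :
    FirstReturn W.G.next (Set.range (coreDart η)) (coreDart η (k, i)) (coreDart η (k.next i)) := by
  have inn : ∀ i, FirstReturn W.G.next (Set.range (coreDart η)) (coreDart η (.inn, i))
      (coreDart η (.nxt, i)) := fun i => .of_apply rfl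
  have nxt : ∀ i, FirstReturn W.G.next (Set.range (coreDart η)) (coreDart η (.nxt, i))
      (coreDart η (.fst, i)) := fun i => .of_apply rfl
  have prv : ∀ i, FirstReturn W.G.next (Set.range (coreDart η)) (coreDart η (.prv, i))
      (coreDart η (.inn, i)) := fun i => .of_apply (next_next_inv _)
  have lst : ∀ i, FirstReturn W.G.next (Set.range (coreDart η)) (coreDart η (.lst, i))
      (coreDart η (.prv, i)) := fun i => .of_apply (next_next_inv _)
  cases k with
  | out => exact .of_apply (H.succ i).symm
  | inn => exact inn i
  | nxt => exact nxt i
  | prv => exact prv i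
  | fst =>
    -- The number of fan vertices skipped here is arbitrary. The first return is some core dart at
    -- the same spoke, and the other four are already first returns of other darts, which leaves
    -- `lst`.
    obtain ⟨_, ⟨⟨l, j⟩, rfl⟩, h⟩ :=
      FirstReturn.exists W.G.next (S := Set.range (coreDart η)) ⟨(.fst, i), rfl⟩
    have ht : W.G.tail (coreDart η (l, j)) = W.G.tail (coreDart η (.fst, i)) := by
      obtain ⟨n, -, h, -⟩ := h
      rw [← h, tail_next_pow]
    rw [H.tail_coreDart, H.tail_coreDart] at ht
    have ht : l.tail j = .spoke i := H.coreVertex_injective ht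
    have ne : ∀ k, k ≠ .fst → ¬ FirstReturn W.G.next (Set.range (coreDart η)) (coreDart η (k, i))
        (coreDart η (l, j)) := by
      intro k hk h'
      have := H.coreDart_injective (h.injective (Set.mem_range_self _) (Set.mem_range_self _) h')
      exact hk (congrArg Prod.fst this).symm
    cases l <;> simp [CoreKind.tail] at ht <;> subst ht
    · exact absurd (prv j) (ne _ (by simp))
    · exact absurd (inn j) (ne _ (by simp))
    · exact absurd (lst j) (ne _ (by simp))
    · exact absurd (nxt j) (ne _ (by simp))
    · exact h
  | lst => exact lst i
  | fstRev => exact .of_apply (H.next_rev_fst i)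
  | lstRev =>
    -- After `lstRev` come the two darts along the rim, `next⁻¹ d` and `d`, neither of which is in
    -- the core; then `fstRev`.
    obtain ⟨d, hd, h1, h2⟩ := H.hat_darts (i + 1)
    rw [add_sub_cancel_right] at h2
    have h2 : W.G.next (coreDart η (.lstRev, i)) = W.G.next⁻¹ d := h2
    have hr := isRim_of_outer hd
    refine .of_step ?_ ?_
    · rw [h2]
      exact H.notMem_range_of_rim_rim (by rw [tail_next_inv]; exact hr.1) (isRim_head_next_inv hd)
    rw [h2]
    refine .of_step ?_ (.of_apply ?_)
    · rw [next_next_inv]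
      exact H.notMem_range_of_rim_rim hr.1 hr.2
    · rw [next_next_inv]
      exact h1

theorem face_coreDart {k : CoreKind} (hk : k.Inner) (i : ZMod d) :
    W.G.face (coreDart η (k, i)) = coreDart η (k.face i) := by
  rw [face_apply, H.rev_coreDart]
  cases k with
  | out => rfl
  | inn => exact (H.succ i).symm
  | nxt => exact next_next_inv _
  | prv => rfl
  | fst => exact H.next_rev_fst i
  | lst => exact absurd rfl hk.1
  | fstRev => exact absurd rfl hk.2
  | lstRev => exact next_next_inv _

/-- The outer darts of the core lead to darts outside the core. -/
theorem face_lst_notMem (i : ZMod d) :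
    W.G.face (coreDart η (.lst, i)) ∉ Set.range (coreDart η) := by
  obtain ⟨d, hd, h1, h2⟩ := H.hat_darts (i + 1)
  rw [add_sub_cancel_right] at h2
  have h2 : W.G.face (coreDart η (.lst, i)) = W.G.next⁻¹ d := h2
  rw [h2]
  exact H.notMem_range_of_rim_rim (by rw [tail_next_inv]; exact (isRim_of_outer hd).1)
    (isRim_head_next_inv hd)

/-- With `face_lst_notMem` this shows that `lst` and `fstRev` cannot lie on finite regions of a
realization of the core. -/
theorem exists_face_eq_fstRev (i : ZMod d) : ∃ e ∉ Set.range (coreDart η),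
    W.G.face e = coreDart η (.fstRev, i) := by
  obtain ⟨d, hd, h1, h2⟩ := H.hat_darts i
  have hr := isRim_of_outer hd
  refine ⟨W.G.rev d, H.notMem_range_of_rim_rim hr.2 (by rw [head_rev]; exact hr.1), ?_⟩
  rw [face_apply, W.G.rev_rev]
  exact h1

theorem coreDart_notMem_outer (x : CoreKind × ZMod d) : coreDart η x ∉ W.G.outer :=
  fun h => H.not_rim_rim x (isRim_of_outer h)

/-- A vertex of the rim is a hat or a fan vertex. -/
theorem hat_or_fan {x : W.G.V} (hx : W.IsRim x) :
    (∃ i, x = coreVertex η (.hat i)) ∨ ∃ u, W.IsSpoke u ∧ W.IsFanOver x u := by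
  obtain ⟨d, hd, rfl⟩ := exists_outer_dart hx
  have hs := isSpoke_head_next hd
  -- The dart after `d` leads to a spoke. The vertex is a hat if the following one does too;
  -- otherwise it has only these three darts and is a fan vertex.
  by_cases h1 : W.IsSpoke (W.G.head (W.G.next (W.G.next d)))
  · left
    obtain ⟨i, hi⟩ := H.exists_eq_head hs
    refine ⟨i, ?_⟩
    have hn : W.G.rev (W.G.next d) ∉ W.G.outer :=
      notMem_outer_of_tail (by rw [tail_rev]; exact hs.not_isRim)
    have h2 := W.nearTriangulation.rev_third hn
    have h3 : W.IsSpoke (W.G.head (W.G.next⁻¹ (W.G.rev (W.G.next d)))) := by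
      rw [← h2, head_rev, tail_third]; exact h1
    rcases eq_of_isSpoke_head (H.tail i) (by rw [tail_next_inv, tail_rev, hi]) h3 with h4 | h4
    · change _ = W.G.head (W.G.next (W.G.next (W.G.rev (η i))))
      rw [← h4, next_next_inv, head_rev, tail_next]
    · have := congrArg W.G.head (W.G.next⁻¹.injective h4)
      rw [head_rev, head_rev, tail_next, H.tail] at this
      exact absurd this hx.1
  · right
    refine ⟨_, hs, hx.1, hx.2, fun u => ⟨?_, ?_⟩⟩
    · rintro ⟨hu, -, f, hf, rfl⟩
      have h2 : W.G.next (W.G.next d) = W.G.next⁻¹ d := by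
        have hr := (head_isSpoke_or_isRim (d := W.G.next (W.G.next d))
          (by rw [tail_next, tail_next]; exact hx)).resolve_left h1
        refine (eq_of_isRim_head hd (by rw [tail_next, tail_next]) hr).resolve_left fun h => ?_
        have h3 : W.G.next d = W.G.next⁻¹ d := by conv_rhs => rw [← h, next_inv_next]
        rw [h3] at hs
        exact hs.not_isRim (isRim_head_next_inv hd)
      have h3 : f = d ∨ f = W.G.next d ∨ f = W.G.next⁻¹ d := by
        refine next_induction (d := d) hf
          (p := fun f => f = d ∨ f = W.G.next d ∨ f = W.G.next⁻¹ d) (.inl rfl) ?_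
        rintro x - (rfl | rfl | rfl)
        · exact .inr (.inl rfl)
        · exact .inr (.inr h2)
        · left; rw [next_next_inv]
      rcases h3 with rfl | rfl | rfl
      · exact absurd (isRim_of_outer hd).2 hu.not_isRim
      · rfl
      · exact absurd (isRim_head_next_inv hd) hu.not_isRim
    · rintro rfl
      exact ⟨hs, (adj_head_next hd).1⟩

theorem hat_adj (i : ZMod d) : W.G.graph.Adj (coreVertex η (.hat i)) (coreVertex η (.spoke i)) ∧
    W.G.graph.Adj (coreVertex η (.hat i)) (coreVertex η (.spoke (i - 1))) := by
  have h1 := W.nearTriangulation.adj (coreDart η (.fstRev, i))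
  have h2 := W.nearTriangulation.adj (coreDart η (.lstRev, i - 1))
  rw [H.tail_coreDart, H.head_coreDart] at h1 h2
  refine ⟨h1, ?_⟩
  simpa [CoreKind.tail, CoreKind.rev] using h2

/-- A hat is adjacent to the spokes `i` and `i - 1`, which are different as `ZMod d` is nontrivial,
so it is not a fan vertex. -/
theorem notMem_range_coreVertex_iff [Nontrivial (ZMod d)] (x : W.G.V) :
    x ∉ Set.range (coreVertex η) ↔ ∃ u, W.IsSpoke u ∧ W.IsFanOver x u := by
  constructor
  · intro h
    rcases vertex_cases x with rfl | hx | hx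
    · exact absurd ⟨.hub, rfl⟩ h
    · obtain ⟨i, rfl⟩ := H.exists_eq_head hx
      exact absurd ⟨.spoke i, rfl⟩ h
    · rcases H.hat_or_fan hx with ⟨i, rfl⟩ | hf
      · exact absurd ⟨_, rfl⟩ h
      · exact hf
  · rintro ⟨u, hu, hf1, hf2, hf⟩ ⟨v, rfl⟩
    cases v with
    | hub => exact hf1 rfl
    | spoke i => exact hf2 (H.isSpoke i)
    | hat i =>
      have h1 := (hf _).1 ⟨H.isSpoke i, (H.hat_adj i).1⟩
      have h2 := (hf _).1 ⟨H.isSpoke (i - 1), (H.hat_adj i).2⟩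
      have := H.head_injective (h1.trans h2.symm)
      exact one_ne_zero (sub_eq_self.1 this.symm)

theorem isHat_of_not_fan [Nontrivial (ZMod d)] {x : W.G.V} (hx : W.IsRim x)
    (h : ¬ ∃ u, W.IsSpoke u ∧ W.IsFanOver x u) : W.IsHat x := by
  obtain ⟨i, rfl⟩ := (H.hat_or_fan hx).resolve_right h
  refine ⟨hx.1, hx.2, _, _, ?_, H.isSpoke i, H.isSpoke (i - 1), (H.hat_adj i).1, (H.hat_adj i).2⟩
  intro h
  exact one_ne_zero (sub_eq_self.1 (H.head_injective h).symm)

theorem rev_mem_range_iff (e : W.G.D) :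
    W.G.rev e ∈ Set.range (coreDart η) ↔ e ∈ Set.range (coreDart η) := by
  have : ∀ e, e ∈ Set.range (coreDart η) → W.G.rev e ∈ Set.range (coreDart η) := by
    rintro _ ⟨⟨k, i⟩, rfl⟩
    exact ⟨_, (H.rev_coreDart k i).symm⟩
  exact ⟨fun h => W.G.rev_rev e ▸ this _ h, this e⟩

theorem tail_mem_range {e : W.G.D} (h : e ∈ Set.range (coreDart η)) :
    W.G.tail e ∈ Set.range (coreVertex η) := by
  obtain ⟨⟨k, i⟩, rfl⟩ := h
  exact ⟨_, (H.tail_coreDart k i).symm⟩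

/-- Among the darts from a spoke to the rim, only `fst` and `lst` are next to a dart to another
spoke. Any other one has both rotation neighbours leading to the rim. -/
theorem isFanOver_of_notMem {e : W.G.D} (he : W.IsSpoke (W.G.tail e))
    (he' : W.IsRim (W.G.head e)) (h : e ∉ Set.range (coreDart η)) :
    W.IsFanOver (W.G.head e) (W.G.tail e) := by
  obtain ⟨i, hi⟩ := H.exists_eq_head he
  have hrim := (isRim_head_iff (H.tail i) hi).1 he'
  refine isFanOver_of_middle he he' ?_ ?_
  · rw [isRim_head_iff (H.tail i) (by rw [tail_next, hi])]
    refine ⟨fun h' => hrim.2.2 ?_, fun h' => hrim.1 (W.G.next.injective h'), fun h' => h ?_⟩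
    · rw [← h', next_inv_next]
    · exact ⟨(.lst, i), by rw [← next_inv_next e, h']; rfl⟩
  · rw [isRim_head_iff (H.tail i) (by rw [tail_next_inv, hi])]
    refine ⟨fun h' => hrim.2.1 ?_, fun h' => h ?_, fun h' => hrim.1 (W.G.next⁻¹.injective h')⟩
    · rw [← h', next_next_inv]
    · exact ⟨(.fst, i), by rw [← next_next_inv e, h']; rfl⟩

/-- The edges outside the core join a spoke to a fan vertex or lie on the rim. An edge of the rim
has a spoke adjacent to both ends, which settles the case of two hats. -/
theorem notMem_range_coreDart_iff [Nontrivial (ZMod d)] (e : W.G.D) :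
    e ∉ Set.range (coreDart η) ↔ ∃ u, W.IsSpoke u ∧ W.EdgeOver e u := by
  constructor
  · intro h
    have outer : ∀ e, e ∈ W.G.outer → ∃ u, W.IsSpoke u ∧ W.G.graph.Adj (W.G.tail e) u ∧
        W.G.graph.Adj (W.G.head e) u := fun e he =>
      ⟨_, isSpoke_head_next he, adj_head_next he⟩
    rcases vertex_cases (W.G.tail e) with h1 | h1 | h1
    · obtain ⟨i, rfl⟩ := H.surj e h1
      exact absurd ⟨(.out, i), rfl⟩ h
    · rcases vertex_cases (W.G.head e) with h2 | h2 | h2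
      · obtain ⟨i, hi⟩ := H.surj (W.G.rev e) h2
        exact absurd ⟨(.inn, i), by change W.G.rev (η i) = e; rw [hi, W.G.rev_rev]⟩ h
      · obtain ⟨i, hi⟩ := H.exists_eq_head h1
        rcases eq_of_isSpoke_head (H.tail i) hi h2 with rfl | rfl
        · exact absurd ⟨(.nxt, i), rfl⟩ h
        · exact absurd ⟨(.prv, i), rfl⟩ h
      · exact ⟨_, h1, .inr (.inl (H.isFanOver_of_notMem h1 h2 h))⟩
    · rcases head_isSpoke_or_isRim h1 with h2 | h2
      · rw [← H.rev_mem_range_iff] at h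
        have := H.isFanOver_of_notMem (e := W.G.rev e) h2 (by rwa [head_rev]) h
        rw [head_rev] at this
        exact ⟨_, h2, .inl this⟩
      · by_cases h3 : ∃ u, W.IsSpoke u ∧ W.IsFanOver (W.G.tail e) u
        · obtain ⟨u, hu, hf⟩ := h3
          exact ⟨u, hu, .inl hf⟩
        by_cases h4 : ∃ u, W.IsSpoke u ∧ W.IsFanOver (W.G.head e) u
        · obtain ⟨u, hu, hf⟩ := h4
          exact ⟨u, hu, .inr (.inl hf)⟩
        obtain ⟨u, hu, h5, h6⟩ : ∃ u, W.IsSpoke u ∧ W.G.graph.Adj (W.G.tail e) u ∧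
            W.G.graph.Adj (W.G.head e) u := by
          rcases (outer_or_rev_outer_iff e).2 ⟨h1, h2⟩ with h | h
          · exact outer e h
          · obtain ⟨u, hu, h5, h6⟩ := outer _ h
            rw [head_rev] at h6
            exact ⟨u, hu, h6, h5⟩
        exact ⟨u, hu, .inr (.inr ⟨hu, H.isHat_of_not_fan h1 h3, H.isHat_of_not_fan h2 h4, h5, h6⟩)⟩
  · rintro ⟨u, hu, h1 | h1 | ⟨-, h1, h2, -⟩⟩ he
    · exact (H.notMem_range_coreVertex_iff _).2 ⟨u, hu, h1⟩ (H.tail_mem_range he)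
    · exact (H.notMem_range_coreVertex_iff _).2 ⟨u, hu, h1⟩
        (H.tail_mem_range ((H.rev_mem_range_iff e).2 he))
    · exact H.notMem_range_of_rim_rim ⟨h1.1, h1.2.1⟩ ⟨h2.1, h2.2.1⟩ he

end IsHubCycle

/-- A subdrawing that realizes the core of one cartwheel also realizes the core of any other
cartwheel with the same degree of the hub. -/
theorem exists_core_emb {W₀ W : Cartwheel} {η₀ : ZMod d → W₀.G.D} {η : ZMod d → W.G.D}
    (H₀ : W₀.IsHubCycle η₀) (H : W.IsHubCycle η) {K : Drawing} (hK : K.IsNearTriangulation)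
    (f : SubdrawingEmb K W₀.G) (hv : Set.range f.v = Set.range (coreVertex η₀))
    (he : Set.range f.e = Set.range (coreDart η₀)) :
    ∃ g : SubdrawingEmb K W.G, (∀ a, f.v a = W₀.hub → g.v a = W.hub) ∧
      Set.range g.v = Set.range (coreVertex η) ∧ Set.range g.e = Set.range (coreDart η) := by
  have hv' : ∀ a, ∃ v, coreVertex η₀ v = f.v a := fun a => hv.subset (Set.mem_range_self a)
  choose cv hcv using hv'
  have he' : ∀ a, ∃ x, coreDart η₀ x = f.e a := fun a => he.subset (Set.mem_range_self a)
  choose ce hce using he'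
  have cv_inj : Function.Injective cv := fun a b h => f.v_injective (by rw [← hcv, ← hcv, h])
  have ce_inj : Function.Injective ce := fun a b h => f.e_injective (by rw [← hce, ← hce, h])
  have cv_surj : Function.Surjective cv := fun v => by
    obtain ⟨a, ha⟩ : coreVertex η₀ v ∈ Set.range f.v := hv ▸ Set.mem_range_self v
    exact ⟨a, H₀.coreVertex_injective ((hcv a).trans ha)⟩
  have ce_surj : Function.Surjective ce := fun x => by
    obtain ⟨a, ha⟩ : coreDart η₀ x ∈ Set.range f.e := he ▸ Set.mem_range_self x
    exact ⟨a, H₀.coreDart_injective ((hce a).trans ha)⟩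
  have htail : ∀ a, (ce a).1.tail (ce a).2 = cv (K.tail a) := fun a =>
    H₀.coreVertex_injective (by rw [hcv, ← f.tail_e, ← hce, ← H₀.tail_coreDart])
  have hrev : ∀ a, (ce a).1.rev (ce a).2 = ce (K.rev a) := fun a =>
    H₀.coreDart_injective (by rw [hce, ← f.rev_e, ← hce, ← H₀.rev_coreDart])
  -- Both sides give the first return to the same set of darts, so the rotation of `K` is forced to
  -- be that of the core.
  have hnext : ∀ a, (ce a).1.next (ce a).2 = ce (K.next a) := fun a => by
    have h1 : FirstReturn W₀.G.next (Set.range f.e) (f.e a) (f.e (K.next a)) := f.next_e a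
    rw [he, ← hce, ← hce] at h1
    exact H₀.coreDart_injective
      ((H₀.firstReturn_coreDart _ _).unique h1 (Set.mem_range_self _) (Set.mem_range_self _))
  -- A finite region of `K` is a region of `W₀` with all its darts in the core. The region of `lst`
  -- leaves the core right afterwards, and that of `fstRev` comes from outside.
  have hinner : ∀ a, a ∉ K.outer → (ce a).1.Inner := by
    intro a ha
    constructor
    · intro h
      have h1 := (f.face_e a ha).2
      have h2 : f.e a = coreDart η₀ (.lst, (ce a).2) := by rw [← hce, ← h]
      refine H₀.face_lst_notMem (ce a).2 ?_
      rw [← h2, h1, ← he]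
      exact Set.mem_range_self _
    · intro h
      obtain ⟨e, he1, he2⟩ := H₀.exists_face_eq_fstRev (ce a).2
      have h2 : f.e a = coreDart η₀ (.fstRev, (ce a).2) := by rw [← hce, ← h]
      have a1 : K.face a ∉ K.outer := by rwa [hK.face_mem_outer]
      have a2 : K.face (K.face a) ∉ K.outer := by rwa [hK.face_mem_outer]
      have h3 := (f.face_e _ a2).2
      rw [hK.triangle a ha, h2, ← he2] at h3
      have h4 := W₀.G.face.injective h3
      exact he1 (by rw [← h4, ← he]; exact Set.mem_range_self _)
  have hface : ∀ a, a ∉ K.outer → (ce a).1.face (ce a).2 = ce (K.face a) := fun a ha =>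
    H₀.coreDart_injective (by
      rw [hce, ← (f.face_e a ha).2, ← hce, ← H₀.face_coreDart (hinner a ha)])
  have range_e : (Set.range fun a => coreDart η (ce a)) = Set.range (coreDart η) :=
    ce_surj.range_comp (coreDart η)
  let g : SubdrawingEmb K W.G :=
    { v := fun a => coreVertex η (cv a)
      e := fun a => coreDart η (ce a)
      v_injective := H.coreVertex_injective.comp cv_inj
      e_injective := H.coreDart_injective.comp ce_inj
      tail_e := fun a => by rw [← htail, ← H.tail_coreDart]
      rev_e := fun a => by rw [← hrev, ← H.rev_coreDart]
      next_e := fun a => by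
        have := H.firstReturn_coreDart (ce a).1 (ce a).2
        rw [hnext, ← range_e] at this
        exact this
      face_e := fun a ha => ⟨H.coreDart_notMem_outer _, by
        rw [← hface a ha, ← H.face_coreDart (hinner a ha)]⟩ }
  refine ⟨g, fun a ha => ?_, cv_surj.range_comp (coreVertex η), range_e⟩
  have : cv a = .hub := H₀.coreVertex_injective ((hcv a).trans ha)
  change coreVertex η (cv a) = W.hub
  rw [this]
  rfl

end Cartwheel

/-! ### Trivial limited parts -/

namespace CartwheelPart

open Cartwheel

/-- A trivial limited part fits all cartwheels with the right hub and values at most `12`. -/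
theorem IsTrivialLimited.fits {P : CartwheelPart} (hP : P.IsTrivialLimited) {d : ℕ} (hd : 2 ≤ d)
    (hPd : P.K.degree P.hub = d) (W : Cartwheel) (hW : W.γ W.hub = d) (h12 : ∀ v, W.γ v ≤ 12) :
    P.Fits W := by
  have : NeZero d := ⟨by omega⟩
  have : Fact (1 < d) := ⟨by omega⟩
  -- Off the hub the bounds are 5 and 12, so the fan over every spoke is deleted and the drawing of
  -- `P` is the core of `W₀`.
  have hba : ∀ u, (P.b u : ℕ∞) ≠ P.a u ↔ u ≠ P.hub := by
    intro u
    constructor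
    · rintro h rfl
      exact h (by rw [P.a_hub, P.b_hub])
    · intro h
      rw [(hP u h).1, (hP u h).2]
      decide
  obtain ⟨W₀, f, hhub, hfv, hfe, hγ⟩ := P.exists_fits
  have hW₀ : W₀.γ W₀.hub = d := by
    have := hγ P.hub
    rw [hhub, P.a_hub, P.b_hub, hPd] at this
    exact le_antisymm (by exact_mod_cast this.2) (by exact_mod_cast this.1)
  rw [gamma_eq_degree not_isRim_hub] at hW₀
  obtain ⟨η₀, H₀⟩ := exists_isHubCycle W₀ hW₀
  obtain ⟨η, H⟩ := exists_isHubCycle W (gamma_eq_degree (W := W) not_isRim_hub ▸ hW)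
  have spoke_range : ∀ u, W₀.IsSpoke u → ∃ a, a ≠ P.hub ∧ f.v a = u := by
    intro u hu
    by_cases h : u ∈ Set.range f.v
    · obtain ⟨a, rfl⟩ := h
      exact ⟨a, fun h => hu.ne_hub (by rw [h, hhub]), rfl⟩
    · obtain ⟨-, -, -, h2, -⟩ := (hfv u).1 h
      exact absurd hu h2
  have spoke_of_fan : ∀ (W : Cartwheel) x u, W.IsFanOver x u → W.IsSpoke u :=
    fun W x u h => ((h.2.2 u).2 rfl).1
  have spoke_of_edge : ∀ (W : Cartwheel) e u, W.EdgeOver e u → W.IsSpoke u := by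
    rintro W e u (h | h | h)
    · exact spoke_of_fan W _ u h
    · exact spoke_of_fan W _ u h
    · exact h.1
  have hv : Set.range f.v = Set.range (coreVertex η₀) := by
    ext x
    rw [← not_iff_not, hfv, H₀.notMem_range_coreVertex_iff]
    constructor
    · rintro ⟨u, -, h⟩
      exact ⟨_, spoke_of_fan W₀ _ _ h, h⟩
    · rintro ⟨u, hu, h⟩
      obtain ⟨a, ha, rfl⟩ := spoke_range u hu
      exact ⟨a, (hba a).2 ha, h⟩
  have he : Set.range f.e = Set.range (coreDart η₀) := by
    ext e
    rw [← not_iff_not, hfe, H₀.notMem_range_coreDart_iff]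
    constructor
    · rintro ⟨u, -, h⟩
      exact ⟨_, spoke_of_edge W₀ _ _ h, h⟩
    · rintro ⟨u, hu, h⟩
      obtain ⟨a, ha, rfl⟩ := spoke_range u hu
      exact ⟨a, (hba a).2 ha, h⟩
  obtain ⟨g, ghub, gv, ge⟩ := exists_core_emb H₀ H P.nearTriangulation f hv he
  have ghub := ghub _ hhub
  have spoke_range' : ∀ u, W.IsSpoke u → ∃ a, a ≠ P.hub ∧ g.v a = u := by
    intro u hu
    obtain ⟨i, rfl⟩ := H.exists_eq_head hu
    obtain ⟨a, ha⟩ : coreVertex η (.spoke i) ∈ Set.range g.v := gv ▸ Set.mem_range_self _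
    refine ⟨a, ?_, ha⟩
    rintro rfl
    exact hu.ne_hub (ha.symm.trans ghub)
  refine ⟨g, ghub, fun x => ?_, fun e => ?_, fun v => ?_⟩
  · rw [gv, H.notMem_range_coreVertex_iff]
    constructor
    · rintro ⟨u, hu, h⟩
      obtain ⟨a, ha, rfl⟩ := spoke_range' u hu
      exact ⟨a, (hba a).2 ha, h⟩
    · rintro ⟨u, -, h⟩
      exact ⟨_, spoke_of_fan W _ _ h, h⟩
  · rw [ge, H.notMem_range_coreDart_iff]
    constructor
    · rintro ⟨u, hu, h⟩
      obtain ⟨a, ha, rfl⟩ := spoke_range' u hu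
      exact ⟨a, (hba a).2 ha, h⟩
    · rintro ⟨u, -, h⟩
      exact ⟨_, spoke_of_edge W _ _ h, h⟩
  · by_cases hvh : v = P.hub
    · subst hvh
      rw [ghub, P.a_hub, P.b_hub, hPd, hW]
      exact ⟨le_rfl, le_rfl⟩
    · rw [(hP v hvh).1, (hP v hvh).2]
      exact ⟨by exact_mod_cast W.five_le _, by exact_mod_cast h12 _⟩

end CartwheelPart

/-! ### The theorem -/

theorem mainTheorem2
    (𝒢 : Set Configuration) (h𝒢 : ∀ K ∈ 𝒢, ∀ v, K.γ v ≤ 11)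
    (𝓡 : Set Rule) (h𝓡 : 𝓡.Finite)
    (hβ : ∀ R ∈ 𝓡, ∀ v, R.β v ≤ 12)
    (hδ : ∀ R ∈ 𝓡, ∀ v, R.δ v = 5 ∨ R.δ v = 6 ∨ R.δ v = 7 ∨ R.δ v = 8 ∨ R.δ v = ⊤)
    (d : ℕ) (hd : d ∈ Set.Icc 7 11)
    (P Q : CartwheelPart)
    (hP : P.IsTrivialLimited) (hPd : P.K.degree P.hub = d)
    (hQ : Q.IsTrivial) (hQd : Q.K.degree Q.hub = d)
    (hPs : P.Successful 𝒢 𝓡) :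
    Q.Successful 𝒢 𝓡 := by
  intro W hW
  obtain ⟨h7, h11⟩ := hd
  refine W.good_or_N_nonpos_of_le_twelve 𝒢 h𝒢 𝓡 hβ hδ d (by omega) ?_ ?_
  · intro W' hW' h12
    exact hPs W' (hP.fits (by omega) hPd W' hW' h12)
  -- Of the fit of the trivial part, only the value at the hub is needed.
  · obtain ⟨f, hhub, -, -, hγ⟩ := hW
    have := hγ Q.hub
    rw [hhub, Q.a_hub, Q.b_hub, hQd] at this
    exact le_antisymm (by exact_mod_cast this.2) (by exact_mod_cast this.1)
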